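/- Let $d\ge 2$, $S^1=\mathbb R/2\pi\mathbb Z$, and let $W^{1,\infty}$ be the Banach space of Lipschitz functions $c\colon S^1\to\mathbb R^d$ with norm $\|c\|_{L^\infty}+\|c_\theta\|_{L^\infty}$. The quotient of $W^{1,\infty}$ by translations is identified with the closed subspace $W^{1,\infty}_0=\{c\in W^{1,\infty}:\int_{S^1}c\,d\theta=0\}$, and the space of Lipschitz immersions modulo translations with its open subset $$\mathcal I^{1,\infty}_0=\{c\in W^{1,\infty}_0:\ \operatorname{ess\,inf}_\theta|c_\theta|>0\},$$ a Banach manifold modelled on $W^{1,\infty}_0$. It carries the weak Riemannian metric $$G_c(h,k)=\frac1{\ell_c}\int_{S^1}\frac{1}{|c_\theta|}\langle h_\theta,k_\theta\rangle\,d\theta,\qquad \ell_c=\int_{S^1}|c_\theta|\,d\theta,\qquad c\in\mathcal I^{1,\infty}_0,\ h,k\in W^{1,\infty}_0 .$$ For $n\ge 1$ let $\mathcal{PI}^1_0\subseteq\mathcal I^{1,\infty}_0$ be the set of those $c\in\mathcal I^{1,\infty}_0$ that are affine on each of the intervals $[2\pi i/n,\,2\pi(i+1)/n]$, $0\le i<n$.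 Geodesics are smooth paths, defined on open intervals, that on every compact subinterval $[a,b]$ are critical points of the energy $\frac12\int_a^b G_c(c_t,c_t)\,dt$ among smooth variations with fixed end points; for geodesics of the submanifold $\mathcal{PI}^1_0$ with the induced metric, the path and the variations lie in $\mathcal{PI}^1_0$. **Theorem.** For every $n\ge 1$, $\mathcal{PI}^1_0$ is a totally geodesic submanifold of dimension $(n-1)d$ of $\mathcal I^{1,\infty}_0$ with the metric $G$. That is, $\mathcal{PI}^1_0$ is a split smooth submanifold of $\mathcal I^{1,\infty}_0$ of dimension $(n-1)d$ (empty if $n=1$), and 1. for every $c_0\in\mathcal{PI}^1_0$ and every vector $h$ tangent to $\mathcal{PI}^1_0$ at $c_0$ there is a geodesic $c$ of $\mathcal I^{1,\infty}_0$, defined on some interval $(-\delta,\delta)$, with $c(0)=c_0$ and $c_t(0)=h$; 2. every geodesic of $\mathcal I^{1,\infty}_0$ that is tangent to $\mathcal{PI}^1_0$ at some time $t_0$ lies in $\mathcal{PI}^1_0$ for all $t$ near $t_0$; 3. every geodesic of $\mathcal{PI}^1_0$ with the induced metric is a geodesic of $\mathcal I^{1,\infty}_0$. -/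

import Mathlib

open MeasureTheory Set Filter Topology
open scoped Real ContDiff NNReal Manifold

noncomputable section

/-! ### The Banach space of Lipschitz closed curves -/

/-- The length `2π` of the circle is positive. -/
instance fact_two_pi_pos : Fact (0 < 2 * π) := ⟨Real.two_pi_pos⟩

/-- The Lipschitz functions from the circle `ℝ / 2πℤ` to `ℝ^d`, as a vector space. -/
def lipschitzSubmodule (d : ℕ) :
    Submodule ℝ (AddCircle (2 * π) → EuclideanSpace ℝ (Fin d)) where
  carrier := {c | ∃ K : ℝ≥0, LipschitzWith K c}
  add_mem' := by
    rintro a b ⟨K, hK⟩ ⟨L, hL⟩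
    exact ⟨K + L, hK.add hL⟩
  zero_mem' := ⟨0, LipschitzWith.const 0⟩
  smul_mem' := by
    rintro r a ⟨K, hK⟩
    exact ⟨‖r‖₊ * K, (lipschitzWith_smul r).comp hK⟩

/-- The space `W^{1,∞}` of Lipschitz functions from the circle `ℝ / 2πℤ` to `ℝ^d`. It is a type of
its own, so that it carries only the norm defined below. -/
def LipCurve (d : ℕ) : Type := lipschitzSubmodule d

namespace LipCurve

variable {d : ℕ}

instance : AddCommGroup (LipCurve d) := inferInstanceAs (AddCommGroup (lipschitzSubmodule d))

instance : Module ℝ (LipCurve d) := inferInstanceAs (Module ℝ (lipschitzSubmodule d))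

instance : FunLike (LipCurve d) (AddCircle (2 * π)) (EuclideanSpace ℝ (Fin d)) where
  coe c := c.1
  coe_injective := Subtype.val_injective

@[ext] theorem ext {c k : LipCurve d} (h : ∀ x, c x = k x) : c = k := DFunLike.ext _ _ h

theorem lipschitz (c : LipCurve d) : ∃ K : ℝ≥0, LipschitzWith K c := c.2

@[simp] theorem add_apply (c k : LipCurve d) (x : AddCircle (2 * π)) : (c + k) x = c x + k x := rfl

@[simp] theorem zero_apply (x : AddCircle (2 * π)) : (0 : LipCurve d) x = 0 := rfl

@[simp] theorem neg_apply (c : LipCurve d) (x : AddCircle (2 * π)) : (-c) x = -c x := rfl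

@[simp] theorem sub_apply (c k : LipCurve d) (x : AddCircle (2 * π)) : (c - k) x = c x - k x := rfl

@[simp] theorem smul_apply (r : ℝ) (c : LipCurve d) (x : AddCircle (2 * π)) :
    (r • c) x = r • c x := rfl

/-- The underlying continuous map of a Lipschitz curve. -/
def toCM (c : LipCurve d) : C(AddCircle (2 * π), EuclideanSpace ℝ (Fin d)) :=
  ⟨c, c.lipschitz.choose_spec.continuous⟩

@[simp] theorem toCM_apply (c : LipCurve d) (x : AddCircle (2 * π)) : c.toCM x = c x := rfl

/-- The curve as a `2π`-periodic function of a real variable. -/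
def lift (c : LipCurve d) (θ : ℝ) : EuclideanSpace ℝ (Fin d) := c (θ : AddCircle (2 * π))

/-- The derivative `c_θ` of a Lipschitz curve, as a `2π`-periodic function on the real line; it is
the true derivative at almost every `θ`. -/
def dθ (c : LipCurve d) : ℝ → EuclideanSpace ℝ (Fin d) := deriv c.lift

theorem lipschitzWith_coe : LipschitzWith 1 ((↑) : ℝ → AddCircle (2 * π)) :=
  LipschitzWith.of_dist_le_mul fun s t => by
    rw [dist_eq_norm, ← AddCircle.coe_sub, dist_eq_norm, NNReal.coe_one, one_mul]
    exact QuotientAddGroup.norm_mk_le_norm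

theorem lipschitzWith_lift {c : LipCurve d} {K : ℝ≥0} (h : LipschitzWith K c) :
    LipschitzWith K c.lift := by
  have h1 := h.comp lipschitzWith_coe
  rw [mul_one] at h1
  exact h1

theorem ae_differentiableAt_lift (c : LipCurve d) : ∀ᵐ θ : ℝ, DifferentiableAt ℝ c.lift θ := by
  obtain ⟨K, hK⟩ := c.lipschitz
  exact (lipschitzWith_lift hK).ae_differentiableAt_real

theorem aestronglyMeasurable_dθ (c : LipCurve d) : AEStronglyMeasurable c.dθ volume :=
  (measurable_deriv c.lift).aestronglyMeasurable

theorem norm_dθ_le {c : LipCurve d} {K : ℝ≥0} (h : LipschitzWith K c) (θ : ℝ) : ‖c.dθ θ‖ ≤ K :=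
  norm_deriv_le_of_lipschitz (lipschitzWith_lift h)

theorem dθ_add (c k : LipCurve d) : (c + k).dθ =ᵐ[volume] c.dθ + k.dθ := by
  filter_upwards [c.ae_differentiableAt_lift, k.ae_differentiableAt_lift] with θ h1 h2
  exact deriv_add h1 h2

theorem dθ_smul (r : ℝ) (c : LipCurve d) : (r • c).dθ = r • c.dθ := by
  ext1 θ
  exact deriv_const_smul_field r c.lift

theorem eLpNorm_dθ_ne_top (c : LipCurve d) : eLpNorm c.dθ ⊤ volume ≠ ⊤ := by
  obtain ⟨K, hK⟩ := c.lipschitz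
  exact (memLp_top_of_bound c.aestronglyMeasurable_dθ K
    (Eventually.of_forall (norm_dθ_le hK))).eLpNorm_ne_top

/-- The norm `‖c‖_{L^∞} + ‖c_θ‖_{L^∞}`; by periodicity the essential supremum of `|c_θ|` may be
taken over the real line. -/
def lipNorm (d : ℕ) : AddGroupNorm (LipCurve d) where
  toFun c := ‖c.toCM‖ + (eLpNorm c.dθ ⊤ volume).toReal
  map_zero' := by
    have h1 : (0 : LipCurve d).toCM = 0 := rfl
    have h2 : (0 : LipCurve d).dθ = 0 := by
      simpa using dθ_smul 0 (0 : LipCurve d)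
    simp [h1, h2]
  add_le' c k := by
    have h1 : (c + k).toCM = c.toCM + k.toCM := rfl
    have h2 : (eLpNorm (c + k).dθ ⊤ volume).toReal
        ≤ (eLpNorm c.dθ ⊤ volume).toReal + (eLpNorm k.dθ ⊤ volume).toReal := by
      rw [eLpNorm_congr_ae (dθ_add c k),
        ← ENNReal.toReal_add c.eLpNorm_dθ_ne_top k.eLpNorm_dθ_ne_top]
      exact ENNReal.toReal_mono (ENNReal.add_ne_top.2 ⟨c.eLpNorm_dθ_ne_top, k.eLpNorm_dθ_ne_top⟩)
        (eLpNorm_add_le c.aestronglyMeasurable_dθ k.aestronglyMeasurable_dθ le_top)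
    have h3 := norm_add_le c.toCM k.toCM
    rw [h1]
    linarith
  neg' c := by
    have h1 : (-c).toCM = -c.toCM := rfl
    have h2 : (-c).dθ = -c.dθ := by simpa using dθ_smul (-1) c
    rw [h1, h2, norm_neg, eLpNorm_neg]
  eq_zero_of_map_eq_zero' c hc := by
    have h0 : ‖c.toCM‖ = 0 :=
      ((add_eq_zero_iff_of_nonneg (norm_nonneg _) ENNReal.toReal_nonneg).1 hc).1
    ext1 x
    simpa using DFunLike.congr_fun (norm_eq_zero.1 h0) x

instance : NormedAddCommGroup (LipCurve d) := (lipNorm d).toNormedAddCommGroup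

theorem norm_def (c : LipCurve d) : ‖c‖ = ‖c.toCM‖ + (eLpNorm c.dθ ⊤ volume).toReal := rfl

instance : NormedSpace ℝ (LipCurve d) where
  norm_smul_le r c := by
    have h1 : (r • c).toCM = r • c.toCM := rfl
    rw [norm_def, norm_def, h1, dθ_smul, eLpNorm_const_smul, norm_smul, ENNReal.toReal_mul,
      toReal_enorm, mul_add]

theorem ae_norm_dθ_le (c : LipCurve d) :
    ∀ᵐ θ : ℝ, ‖c.dθ θ‖ ≤ (eLpNorm c.dθ ⊤ volume).toReal := by
  filter_upwards [ae_le_eLpNormEssSup (f := c.dθ) (μ := volume)] with θ hθ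
  rw [← toReal_enorm]
  exact ENNReal.toReal_mono c.eLpNorm_dθ_ne_top (by simpa using hθ)

theorem eLpNorm_dθ_le {c : LipCurve d} {K : ℝ≥0} (h : LipschitzWith K c) :
    (eLpNorm c.dθ ⊤ volume).toReal ≤ K := by
  have h1 : eLpNorm c.dθ ⊤ volume ≤ ENNReal.ofReal K := by
    rw [eLpNorm_exponent_top]
    exact eLpNormEssSup_le_of_ae_bound (Eventually.of_forall (norm_dθ_le h))
  exact ENNReal.toReal_le_of_le_ofReal K.2 h1

/-- The essential supremum of `|c_θ|` is a Lipschitz constant of `c`. -/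
theorem lipschitzWith_eLpNorm (c : LipCurve d) :
    LipschitzWith (eLpNorm c.dθ ⊤ volume).toNNReal c := by
  set L : ℝ := (eLpNorm c.dθ ⊤ volume).toReal with hL
  have hL0 : 0 ≤ L := ENNReal.toReal_nonneg
  obtain ⟨K, hK⟩ := c.lipschitz
  have hlift := lipschitzWith_lift hK
  have key : ∀ s t : ℝ, ‖c.lift t - c.lift s‖ ≤ L * |t - s| := by
    intro s t
    set v := c.lift t - c.lift s with hv
    let φ : EuclideanSpace ℝ (Fin d) →L[ℝ] ℝ := innerSL ℝ v
    have hφ : LipschitzWith (‖φ‖₊ * K) (φ ∘ c.lift) := φ.lipschitz.comp hlift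
    have hac := (hφ.lipschitzOnWith (s := uIcc s t)).absolutelyContinuousOnInterval
    have hint := hac.integral_deriv_eq_sub
    have hb : ‖∫ x in s..t, deriv (φ ∘ c.lift) x‖ ≤ (‖v‖ * L) * |t - s| := by
      refine intervalIntegral.norm_integral_le_of_norm_le_const_ae ?_
      filter_upwards [c.ae_norm_dθ_le, c.ae_differentiableAt_lift] with x hx hd _
      have : deriv (φ ∘ c.lift) x = φ (c.dθ x) :=
        (φ.hasFDerivAt.comp_hasDerivAt x hd.hasDerivAt).deriv
      rw [this]
      calc ‖φ (c.dθ x)‖ ≤ ‖φ‖ * ‖c.dθ x‖ := φ.le_opNorm _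
        _ ≤ ‖v‖ * L := by
          rw [show ‖φ‖ = ‖v‖ from innerSL_apply_norm ℝ v]
          exact mul_le_mul_of_nonneg_left hx (norm_nonneg _)
    have hsq : (φ ∘ c.lift) t - (φ ∘ c.lift) s = ‖v‖ * ‖v‖ := by
      have h1 : (φ ∘ c.lift) t - (φ ∘ c.lift) s = φ v := by simp [hv]
      rw [h1]
      exact real_inner_self_eq_norm_mul_norm v
    rw [hint, hsq, Real.norm_of_nonneg (by positivity), mul_assoc] at hb
    rcases (norm_nonneg v).eq_or_lt with h0 | h0
    · rw [← h0]; positivity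
    · exact le_of_mul_le_mul_left hb h0
  refine LipschitzWith.of_dist_le_mul fun x y => ?_
  obtain ⟨s, rfl⟩ := QuotientAddGroup.mk_surjective y
  obtain ⟨z, hz⟩ := QuotientAddGroup.mk_surjective (x - (s : AddCircle (2 * π)))
  have hn := AddCircle.norm_eq (p := 2 * π) (x := z)
  set w : ℝ := z - round ((2 * π)⁻¹ * z) * (2 * π) with hw
  have hwz : ((w : ℝ) : AddCircle (2 * π)) = (z : AddCircle (2 * π)) := by
    rw [hw, AddCircle.coe_sub, ← zsmul_eq_mul, AddCircle.coe_zsmul, AddCircle.coe_period, smul_zero,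
      sub_zero]
  have hx : x = ((s + w : ℝ) : AddCircle (2 * π)) := by
    rw [AddCircle.coe_add, hwz]
    have : (z : AddCircle (2 * π)) = x - (s : AddCircle (2 * π)) := hz
    rw [this]; abel
  have hk := key s (s + w)
  have e1 : dist x (s : AddCircle (2 * π)) = |w| := by
    rw [dist_eq_norm]
    have : x - (s : AddCircle (2 * π)) = (z : AddCircle (2 * π)) := hz.symm
    rw [this, hn]
  change dist (c x) (c (s : AddCircle (2 * π))) ≤ L * dist x (s : AddCircle (2 * π))
  rw [e1, dist_eq_norm, hx]
  simpa [lift] using hk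

/-- `W^{1,∞}` is a Banach space. -/
instance : CompleteSpace (LipCurve d) := by
  refine Metric.complete_of_cauchySeq_tendsto fun u hu => ?_
  have hle : ∀ a b : LipCurve d, dist a b = ‖(a - b).toCM‖ + (eLpNorm (a - b).dθ ⊤ volume).toReal :=
    fun a b => by rw [dist_eq_norm, norm_def]
  have hcm : CauchySeq fun m => (u m).toCM := by
    refine Metric.cauchySeq_iff'.2 fun ε hε => ?_
    obtain ⟨N, hN⟩ := Metric.cauchySeq_iff'.1 hu ε hε
    refine ⟨N, fun m hm => lt_of_le_of_lt ?_ (hN m hm)⟩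
    rw [hle, dist_eq_norm]
    exact le_add_of_nonneg_right ENNReal.toReal_nonneg
  obtain ⟨f, hf⟩ := cauchySeq_tendsto_of_complete hcm
  have hpt : ∀ x, Tendsto (fun m => u m x) atTop (𝓝 (f x)) := fun x =>
    ((continuous_eval_const (F := C(AddCircle (2 * π), EuclideanSpace ℝ (Fin d))) x).tendsto f).comp hf
  obtain ⟨R, hR⟩ := hu.isBounded_range.exists_norm_le
  have hflip : LipschitzWith R.toNNReal f := by
    refine LipschitzWith.of_dist_le_mul fun x y => ?_
    refine le_of_tendsto ((hpt x).dist (hpt y)) (Eventually.of_forall fun m => ?_)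
    refine ((u m).lipschitzWith_eLpNorm.dist_le_mul x y).trans
      (mul_le_mul_of_nonneg_right ?_ dist_nonneg)
    have h1 : ‖u m‖ ≤ R := hR _ (mem_range_self m)
    rw [norm_def] at h1
    exact ((le_add_of_nonneg_left (norm_nonneg _)).trans h1).trans (Real.le_coe_toNNReal R)
  let c : LipCurve d := ⟨f, ⟨_, hflip⟩⟩
  refine ⟨c, Metric.tendsto_atTop.2 fun ε hε => ?_⟩
  obtain ⟨N, hN⟩ := Metric.cauchySeq_iff.1 hu (ε / 3) (by positivity)
  refine ⟨N, fun m hm => ?_⟩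
  have hsup : ‖(u m - c).toCM‖ ≤ ε / 3 := by
    refine (ContinuousMap.norm_le _ (by positivity)).2 fun x => ?_
    refine le_of_tendsto ((tendsto_const_nhds (x := u m x)).sub (hpt x)).norm ?_
    filter_upwards [eventually_ge_atTop N] with k hk
    have h1 := hN m hm k hk
    rw [hle] at h1
    have h2 := (u m - u k).toCM.norm_coe_le_norm x
    have h3 : 0 ≤ (eLpNorm (u m - u k).dθ ⊤ volume).toReal := ENNReal.toReal_nonneg
    simp only [toCM_apply, sub_apply] at h2
    linarith
  have hlip : LipschitzWith (ε / 3).toNNReal (u m - c) := by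
    refine LipschitzWith.of_dist_le_mul fun x y => ?_
    have ht := ((tendsto_const_nhds (x := u m x)).sub (hpt x)).dist
      ((tendsto_const_nhds (x := u m y)).sub (hpt y))
    refine le_of_tendsto ht ?_
    filter_upwards [eventually_ge_atTop N] with k hk
    have h1 := hN m hm k hk
    rw [hle] at h1
    refine ((u m - u k).lipschitzWith_eLpNorm.dist_le_mul x y).trans
      (mul_le_mul_of_nonneg_right ?_ dist_nonneg)
    have h2 : 0 ≤ ‖(u m - u k).toCM‖ := norm_nonneg _
    exact (by linarith : (eLpNorm (u m - u k).dθ ⊤ volume).toReal ≤ ε / 3).trans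
      (Real.le_coe_toNNReal _)
  have hder := eLpNorm_dθ_le hlip
  rw [Real.coe_toNNReal _ (by positivity)] at hder
  rw [hle]
  linarith

/-! ### Curves modulo translations, immersions and the metric -/

/-- The length `ℓ_c = ∫ |c_θ| dθ`. -/
def length (c : LipCurve d) : ℝ := ∫ θ in (0 : ℝ)..2 * π, ‖c.dθ θ‖

/-- The reparametrization- and scale-invariant `H¹`-metric
`G_c(h, k) = (1 / ℓ_c) ∫ ⟨h_θ, k_θ⟩ / |c_θ| dθ`. -/
def metricG (c h k : LipCurve d) : ℝ :=
  (c.length)⁻¹ * ∫ θ in (0 : ℝ)..2 * π, ‖c.dθ θ‖⁻¹ * inner ℝ (h.dθ θ) (k.dθ θ)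

/-- A Lipschitz immersion: the essential infimum of `|c_θ|` is positive. -/
def IsImmersed (c : LipCurve d) : Prop := ∃ ε : ℝ, 0 < ε ∧ ∀ᵐ θ : ℝ, ε ≤ ‖c.dθ θ‖

/-- The curve is piecewise linear with respect to the uniform grid `0, 2π/n, …, 2π`. -/
def IsPiecewiseLinear (n : ℕ) (c : LipCurve d) : Prop :=
  ∀ i : ℕ, i < n → ∃ a b : EuclideanSpace ℝ (Fin d),
    ∀ θ ∈ Icc (2 * π * i / n) (2 * π * (i + 1) / n), c.lift θ = a + θ • b

theorem continuous_lift (c : LipCurve d) : Continuous c.lift :=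
  (lipschitzWith_lift c.lipschitz.choose_spec).continuous

end LipCurve

/-- The space `W^{1,∞}_0` of Lipschitz curves with `∫ c dθ = 0`, which represents the quotient of
`W^{1,∞}` by translations. -/
def LipCurve₀ (d : ℕ) : Submodule ℝ (LipCurve d) where
  carrier := {c | ∫ θ in (0 : ℝ)..2 * π, c.lift θ = 0}
  add_mem' {a b} ha hb := by
    have h : ∫ θ in (0 : ℝ)..2 * π, (a.lift θ + b.lift θ) = 0 := by
      rw [intervalIntegral.integral_add (a.continuous_lift.intervalIntegrable _ _)
        (b.continuous_lift.intervalIntegrable _ _), ha, hb, add_zero]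
    exact h
  zero_mem' := by
    have h : ∫ _ in (0 : ℝ)..2 * π, (0 : EuclideanSpace ℝ (Fin d)) = 0 := by simp
    exact h
  smul_mem' r a ha := by
    have h : ∫ θ in (0 : ℝ)..2 * π, r • a.lift θ = 0 := by
      rw [intervalIntegral.integral_smul, ha, smul_zero]
    exact h

/-- The manifold `I^{1,∞}_0` of Lipschitz immersions modulo translations, an open subset of the
Banach space `W^{1,∞}_0`. -/
def Immersions₀ (d : ℕ) : TopologicalSpace.Opens (LipCurve₀ d) where
  carrier := {c | (c : LipCurve d).IsImmersed}
  is_open' := by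
    refine Metric.isOpen_iff.2 ?_
    rintro c ⟨ε, hε, hc⟩
    refine ⟨ε / 2, by positivity, fun k hk => ⟨ε / 2, by positivity, ?_⟩⟩
    have hd : (eLpNorm ((k : LipCurve d) - (c : LipCurve d)).dθ ⊤ volume).toReal < ε / 2 := by
      have h1 : ‖(k : LipCurve d) - (c : LipCurve d)‖ < ε / 2 := by
        rw [← dist_eq_norm]; exact hk
      rw [LipCurve.norm_def] at h1
      exact lt_of_le_of_lt (le_add_of_nonneg_left (norm_nonneg _)) h1
    have hadd := LipCurve.dθ_add ((k : LipCurve d) - (c : LipCurve d)) (c : LipCurve d)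
    rw [sub_add_cancel] at hadd
    filter_upwards [hc, hadd, ((k : LipCurve d) - (c : LipCurve d)).ae_norm_dθ_le] with θ h1 h2 h3
    rw [h2, Pi.add_apply]
    have h4 := norm_sub_le (((k : LipCurve d) - (c : LipCurve d)).dθ θ + (c : LipCurve d).dθ θ)
      (((k : LipCurve d) - (c : LipCurve d)).dθ θ)
    rw [add_sub_cancel_left] at h4
    linarith

/-- The metric `G` on `I^{1,∞}_0`, whose tangent spaces are `W^{1,∞}_0`. -/
def metricG₀ {d : ℕ} (c h k : LipCurve₀ d) : ℝ := LipCurve.metricG (c : LipCurve d) h k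

/-- The space of piecewise linear immersed curves on the uniform grid of `n` points, modulo
translations, as a subset of `I^{1,∞}_0`. -/
def PLImmersions₀ (n d : ℕ) : Set (Immersions₀ d) :=
  {c | ((c : LipCurve₀ d) : LipCurve d).IsPiecewiseLinear n}

/-! ### Submanifolds, geodesics and totally geodesic submanifolds -/

/-- `N` is a split smooth submanifold of dimension `k` of the Banach manifold `M` modelled on `E`:
around each point of `N` there is a chart of `M` that takes `N` to a `k`-dimensional complemented
linear subspace of `E`. -/
def IsSplitSubmanifold (E : Type*) [NormedAddCommGroup E] [NormedSpace ℝ E] {M : Type*}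
    [TopologicalSpace M] [ChartedSpace E M] (N : Set M) (k : ℕ) : Prop :=
  ∀ x ∈ N, ∃ φ ∈ IsManifold.maximalAtlas 𝓘(ℝ, E) ∞ M, x ∈ φ.source ∧
    ∃ F : Submodule ℝ E, FiniteDimensional ℝ F ∧ Module.finrank ℝ F = k ∧
      F.ClosedComplemented ∧ ∀ y ∈ φ.source, y ∈ N ↔ φ y ∈ F

section Geodesics

variable {E : Type*} [NormedAddCommGroup E] [NormedSpace ℝ E]

/-- The vectors tangent to the subset `N` of `E` at `x`: velocities of smooth curves in `N`
through `x`. For a submanifold this is the tangent space. -/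
def tangentVectors (N : Set E) (x : E) : Set E :=
  {v | ∃ σ : ℝ → E, ContDiffAt ℝ ∞ σ 0 ∧ (∀ᶠ t in 𝓝 0, σ t ∈ N) ∧ σ 0 = x ∧ deriv σ 0 = v}

/-- The energy of the path `γ` on `[a, b]` for the metric `G`. -/
def energy (G : E → E → E → ℝ) (a b : ℝ) (γ : ℝ → E) : ℝ :=
  (1 / 2) * ∫ t in a..b, G (γ t) (deriv γ t) (deriv γ t)

/-- `Γ ε t`, `|ε| < δ`, is a smooth variation of the path `γ : I → N`, through paths that lie in `N`
on `[a, b]`, with fixed values at `a` and `b`. -/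
structure IsProperVariation (N : Set E) (I : Set ℝ) (γ : ℝ → E) (a b δ : ℝ) (Γ : ℝ → ℝ → E) :
    Prop where
  smooth : ContDiffOn ℝ ∞ (Function.uncurry Γ) (Ioo (-δ) δ ×ˢ I)
  mem : ∀ ε ∈ Ioo (-δ) δ, ∀ t ∈ Icc a b, Γ ε t ∈ N
  base : ∀ t ∈ I, Γ 0 t = γ t
  left : ∀ ε ∈ Ioo (-δ) δ, Γ ε a = γ a
  right : ∀ ε ∈ Ioo (-δ) δ, Γ ε b = γ b

/-- `γ` is a geodesic, defined on the open interval `I`, of the submanifold `N` of `E` (for instance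
an open subset of `E`) with the metric induced by `G`: it is smooth with values in `N` and on
every compact subinterval it is a critical point of the energy under variations in `N` with fixed
end points. -/
structure IsGeodesic (G : E → E → E → ℝ) (N : Set E) (I : Set ℝ) (γ : ℝ → E) : Prop where
  isOpen : IsOpen I
  ordConnected : I.OrdConnected
  smooth : ContDiffOn ℝ ∞ γ I
  mem : ∀ t ∈ I, γ t ∈ N
  critical : ∀ a b : ℝ, a < b → Icc a b ⊆ I → ∀ (δ : ℝ) (Γ : ℝ → ℝ → E), 0 < δ →
    IsProperVariation N I γ a b δ Γ → HasDerivAt (fun ε => energy G a b (Γ ε)) 0 0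

/-- `N` is a totally geodesic submanifold of dimension `k` of the open subset `M` of the Banach
space `E`, with respect to the weak Riemannian metric `G` on `M`. -/
structure IsTotallyGeodesicSubmanifold (M : TopologicalSpace.Opens E) (G : E → E → E → ℝ)
    (N : Set M) (k : ℕ) : Prop where
  isSubmanifold : IsSplitSubmanifold E N k
  /-- Every vector tangent to `N` is the initial velocity of a geodesic of `M`. -/
  exists_geodesic : ∀ x ∈ Subtype.val '' N, ∀ v ∈ tangentVectors (Subtype.val '' N) x,
    ∃ δ > 0, ∃ γ : ℝ → E, IsGeodesic G M (Ioo (-δ) δ) γ ∧ γ 0 = x ∧ deriv γ 0 = v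
  /-- A geodesic of `M` that is tangent to `N` at some time lies in `N` near that time. -/
  geodesic_stays : ∀ (I : Set ℝ) (γ : ℝ → E), IsGeodesic G M I γ → ∀ t₀ ∈ I,
    γ t₀ ∈ Subtype.val '' N → deriv γ t₀ ∈ tangentVectors (Subtype.val '' N) (γ t₀) →
      ∀ᶠ t in 𝓝 t₀, γ t ∈ Subtype.val '' N
  /-- Every geodesic of `N`, for the induced metric, is a geodesic of `M`. -/
  geodesic_of_geodesic : ∀ (I : Set ℝ) (γ : ℝ → E),
    IsGeodesic G (Subtype.val '' N) I γ → IsGeodesic G M I γ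

end Geodesics

end

/-!
The proof never writes the geodesic equation as an ordinary differential equation in the Banach
space; it works with its weak form throughout.

*The weak geodesic equation.* The length `lenI`, the form `formI c h k = ∫ |c_θ|⁻¹ ⟨h_θ, k_θ⟩` and
their derivatives are integrals of smooth functions of the pointwise values of `c_θ`, `h_θ`,
`k_θ`. These values stay, for almost every `θ`, in a compact set on which `c_θ` does not vanish,
so such functionals can be differentiated under the integral sign (`IsEssBoundedEval`). The first
variation formula `hasDerivAt_energy` then shows that a smooth path `γ` of immersions is a
geodesic if and only if `eulerLagrange γ γ' γ'' k = 0` for all directions `k`. The functional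
`k ↦ eulerLagrange c h z k` is `k ↦ ∫ ⟨D, k_θ⟩`, where the density `D = elDensity` depends
smoothly on the pointwise values of `c_θ`, `h_θ`, `z_θ` and on two real numbers `A`, `B`,
integrals over the whole curve that do not depend on `θ` (`eulerLagrange_eq_integral`).

*Geodesics of the piecewise linear curves.* If `c`, `h`, `z` are piecewise linear then `D` is
constant on each grid interval, so the integral `∫ ⟨D, k_θ⟩` depends on `k` only through its
increments over the grid intervals, and replacing `k` by its piecewise linear interpolation does
not change it. Hence a path of piecewise linear immersions that is critical for piecewise linear
variations is critical for all variations (`isGeodesic_of_isGeodesic_plImmersions`).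

*Existence.* On piecewise linear curves the geodesic equation says that `D` is the same vector on
all grid intervals. Solving for the second derivatives of the slopes gives a smooth ordinary
differential equation in a finite-dimensional space, in which the unknown common vector is, up to
sign, the Lagrange multiplier `plMultiplier` of the constraint that the curve closes up
(`exists_isGeodesic_of_mem_plSubmodule`).

*Geodesics tangent to the piecewise linear curves.* Let `P` be the piecewise linear interpolation,
let `γ` be a geodesic that is tangent to the range of `P` at time `t₀`, and let `x = γ - P γ`.
Since `x_θ` has mean zero on the grid intervals, testing the weak equation with `x'` annihilates
all terms that are constant on grid intervals, and what remains bounds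
`∫ |(P γ)_θ|⁻¹ ⟨x''_θ, x'_θ⟩` by the weighted `H¹`-norms of `x` and `x'`
(`abs_formI_deviation_le`). Gronwall's inequality for the sum of the squares of these norms gives
`x = 0` near `t₀` (`eventually_mem_plSubmodule_of_isGeodesic`). The nonlocal coefficients need no
estimate: whatever `A` and `B` are, the density of the interpolation is annihilated, so the values
of `A` and `B` that belong to `γ` can be used in both densities.
-/

/-! ### Integral functionals on spaces of essentially bounded functions -/

/-- A property of pairs that holds near the diagonal over each point of a compact set, with a
constant depending on the point, holds uniformly near that compact set. -/
theorem IsCompact.exists_uniform_of_eventually {Y : Type*} [PseudoMetricSpace Y] {K : Set Y}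
    (hK : IsCompact K) {Q : ℝ → Y → Y → Prop}
    (hmono : ∀ C C' b c, C ≤ C' → Q C b c → Q C' b c)
    (h : ∀ y ∈ K, ∃ C, ∀ᶠ p : Y × Y in 𝓝 (y, y), Q C p.1 p.2) :
    ∃ C, ∃ δ > 0, ∀ a ∈ K, ∀ b c, dist b a < δ → dist c a < δ → Q C b c := by
  refine hK.induction_on (p := fun S => ∃ C, ∃ δ > 0, ∀ a ∈ S, ∀ b c, dist b a < δ →
    dist c a < δ → Q C b c) ⟨0, 1, one_pos, by simp⟩ ?_ ?_ ?_
  · rintro s t hst ⟨C, δ, hδ, H⟩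
    exact ⟨C, δ, hδ, fun a ha => H a (hst ha)⟩
  · rintro s t ⟨C, δ, hδ, H⟩ ⟨C', δ', hδ', H'⟩
    refine ⟨max C C', min δ δ', lt_min hδ hδ', ?_⟩
    rintro a (ha | ha) b c hb hc
    · exact hmono _ _ _ _ (le_max_left _ _)
        (H a ha b c (hb.trans_le (min_le_left _ _)) (hc.trans_le (min_le_left _ _)))
    · exact hmono _ _ _ _ (le_max_right _ _)
        (H' a ha b c (hb.trans_le (min_le_right _ _)) (hc.trans_le (min_le_right _ _)))
  · intro y hy
    obtain ⟨C, hC⟩ := h y hy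
    obtain ⟨δ, hδ, H⟩ := Metric.eventually_nhds_iff.1 hC
    refine ⟨Metric.ball y (δ / 2), mem_nhdsWithin_of_mem_nhds (Metric.ball_mem_nhds _ (half_pos hδ)),
      C, δ / 2, half_pos hδ, fun a ha b c hb hc => ?_⟩
    have ha' : dist a y < δ / 2 := ha
    refine H (y := (b, c)) ?_
    rw [Prod.dist_eq]
    refine max_lt ?_ ?_
    · linarith [dist_triangle b a y]
    · linarith [dist_triangle c a y]

theorem IsCompact.exists_bound_near {Y : Type*} [PseudoMetricSpace Y] {K : Set Y} {g : Y → ℝ}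
    (hK : IsCompact K) (hg : ∀ y ∈ K, ContinuousAt g y) :
    ∃ C, ∃ δ > 0, ∀ a ∈ K, ∀ b, dist b a < δ → ‖g b‖ ≤ C := by
  obtain ⟨C, δ, hδ, H⟩ := hK.exists_uniform_of_eventually (Q := fun C b _ => ‖g b‖ ≤ C)
    (fun C C' b c h h' => h'.trans h) fun y hy => by
      refine ⟨‖g y‖ + 1, ?_⟩
      have h1 : ∀ᶠ b in 𝓝 y, ‖g b‖ < ‖g y‖ + 1 :=
        (hg y hy).norm.eventually (gt_mem_nhds (lt_add_one _))
      exact (continuous_fst.continuousAt.eventually h1).mono fun p hp => hp.le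
  exact ⟨C, δ, hδ, fun a ha b hb => H a ha b b hb hb⟩

/-- `e` represents the elements of the normed space `Z` by functions on a measure space, linearly up
to null sets, and with essential supremum bounded by a multiple of the norm. -/
structure IsEssBoundedEval {Z Y α : Type*} [NormedAddCommGroup Z] [NormedSpace ℝ Z]
    [NormedAddCommGroup Y] [NormedSpace ℝ Y] [MeasurableSpace Y] [MeasurableSpace α]
    (μ : Measure α) (e : Z → α → Y) : Prop where
  measurable : ∀ z, Measurable (e z)
  sub : ∀ z w, ∀ᵐ θ ∂μ, e (z - w) θ = e z θ - e w θ
  smul : ∀ (r : ℝ) z, ∀ᵐ θ ∂μ, e (r • z) θ = r • e z θ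
  bound : ∃ C : ℝ, 0 ≤ C ∧ ∀ z, ∀ᵐ θ ∂μ, ‖e z θ‖ ≤ C * ‖z‖

namespace IsEssBoundedEval

variable {Z Y Z' Y' α : Type*} [NormedAddCommGroup Z] [NormedSpace ℝ Z]
  [NormedAddCommGroup Y] [NormedSpace ℝ Y] [MeasurableSpace Y]
  [NormedAddCommGroup Z'] [NormedSpace ℝ Z']
  [NormedAddCommGroup Y'] [NormedSpace ℝ Y'] [MeasurableSpace Y'] [MeasurableSpace α]
  {μ : Measure α} {e : Z → α → Y} {e' : Z' → α → Y'}

theorem prod (he : IsEssBoundedEval μ e) (he' : IsEssBoundedEval μ e') :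
    IsEssBoundedEval μ (fun (z : Z × Z') θ => (e z.1 θ, e' z.2 θ)) where
  measurable z := (he.measurable z.1).prodMk (he'.measurable z.2)
  sub z w := by
    filter_upwards [he.sub z.1 w.1, he'.sub z.2 w.2] with θ h1 h2
    simp [h1, h2]
  smul r z := by
    filter_upwards [he.smul r z.1, he'.smul r z.2] with θ h1 h2
    simp [h1, h2]
  bound := by
    obtain ⟨C, hC0, hC⟩ := he.bound
    obtain ⟨C', hC0', hC'⟩ := he'.bound
    refine ⟨max C C', le_max_of_le_left hC0, fun z => ?_⟩
    filter_upwards [hC z.1, hC' z.2] with θ h1 h2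
    rw [Prod.norm_def]
    refine max_le (h1.trans ?_) (h2.trans ?_)
    · exact mul_le_mul (le_max_left _ _) (norm_fst_le z) (norm_nonneg _) (le_max_of_le_left hC0)
    · exact mul_le_mul (le_max_right _ _) (norm_snd_le z) (norm_nonneg _) (le_max_of_le_left hC0)

theorem eventually_ae_dist_lt (he : IsEssBoundedEval μ e) (z : Z) {δ : ℝ} (hδ : 0 < δ) :
    ∀ᶠ w in 𝓝 z, ∀ᵐ θ ∂μ, dist (e w θ) (e z θ) < δ := by
  obtain ⟨C, hC0, hC⟩ := he.bound
  filter_upwards [Metric.ball_mem_nhds z (div_pos hδ (by positivity : 0 < C + 1))] with w hw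
  filter_upwards [he.sub w z, hC (w - z)] with θ h1 h2
  rw [dist_eq_norm, ← h1]
  rw [Metric.mem_ball, dist_eq_norm, lt_div_iff₀ (by positivity)] at hw
  nlinarith [norm_nonneg (w - z)]

variable [IsFiniteMeasure μ] {K : Set Y} {z : Z}

theorem eventually_integrable (he : IsEssBoundedEval μ e) (hK : IsCompact K) {g : Y → ℝ}
    (hg : ∀ y ∈ K, ContinuousAt g y) (hgm : Measurable g) (hz : ∀ᵐ θ ∂μ, e z θ ∈ K) :
    ∀ᶠ w in 𝓝 z, Integrable (fun θ => g (e w θ)) μ := by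
  obtain ⟨C, δ, hδ, H⟩ := hK.exists_bound_near hg
  filter_upwards [he.eventually_ae_dist_lt z hδ] with w hw
  refine Integrable.of_bound (hgm.comp (he.measurable w)).aestronglyMeasurable C ?_
  filter_upwards [hw, hz] with θ h1 h2
  exact H _ h2 _ h1

theorem integrable (he : IsEssBoundedEval μ e) (hK : IsCompact K) {g : Y → ℝ}
    (hg : ∀ y ∈ K, ContinuousAt g y) (hgm : Measurable g) (hz : ∀ᵐ θ ∂μ, e z θ ∈ K) :
    Integrable (fun θ => g (e z θ)) μ :=
  (he.eventually_integrable hK hg hgm hz).self_of_nhds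

/-- The functional `z ↦ ∫ g(z(θ)) dθ` is continuous where the integrand is continuous at the
essential values. -/
theorem continuousAt_integral (he : IsEssBoundedEval μ e) (hK : IsCompact K) {g : Y → ℝ}
    (hg : ∀ y ∈ K, ContinuousAt g y) (hgm : Measurable g) (hz : ∀ᵐ θ ∂μ, e z θ ∈ K) :
    ContinuousAt (fun w => ∫ θ, g (e w θ) ∂μ) z := by
  refine Metric.continuousAt_iff'.2 fun ε hε => ?_
  set m := μ.real univ with hm
  have hm0 : 0 ≤ m := measureReal_nonneg
  set η := ε / (m + 1) with hη
  have hη0 : 0 < η := by positivity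
  obtain ⟨-, δ, hδ, H⟩ := hK.exists_uniform_of_eventually
    (Q := fun _ b c => ‖g b - g c‖ ≤ η) (fun _ _ _ _ _ h => h) fun y hy => by
      refine ⟨0, ?_⟩
      have h1 : ContinuousAt (fun p : Y × Y => ‖g p.1 - g p.2‖) (y, y) := by
        have ha : ContinuousAt (fun p : Y × Y => g p.1) (y, y) :=
          ContinuousAt.comp (f := Prod.fst) (x := (y, y)) (hg y hy) continuousAt_fst
        have hb : ContinuousAt (fun p : Y × Y => g p.2) (y, y) :=
          ContinuousAt.comp (f := Prod.snd) (x := (y, y)) (hg y hy) continuousAt_snd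
        exact (ha.sub hb).norm
      have h2 := h1.eventually (gt_mem_nhds (by simpa using hη0 : ‖g y - g y‖ < η))
      exact h2.mono fun p hp => le_of_lt hp
  filter_upwards [he.eventually_ae_dist_lt z hδ, he.eventually_integrable hK hg hgm hz] with w hw hi
  rw [dist_eq_norm, ← integral_sub hi (he.integrable hK hg hgm hz)]
  have h1 : ‖∫ θ, (g (e w θ) - g (e z θ)) ∂μ‖ ≤ η * m := by
    refine norm_integral_le_of_norm_le_const ?_
    filter_upwards [hw, hz] with θ h1 h2
    exact H _ h2 _ _ h1 (by simpa using hδ)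
  refine h1.trans_lt ?_
  rw [hη, div_mul_eq_mul_div, div_lt_iff₀ (by positivity)]
  nlinarith

/-- Differentiation under the integral along a differentiable path, for a `C¹` integrand. -/
theorem hasDerivAt_integral [BorelSpace Y] [SecondCountableTopology Y] [FiniteDimensional ℝ Y]
    (he : IsEssBoundedEval μ e) (hK : IsCompact K)
    {g : Y → ℝ} (hg : ∀ y ∈ K, ContDiffAt ℝ 1 g y) (hgm : Measurable g) {c : ℝ → Z} {c' : Z}
    {t : ℝ} (hc : HasDerivAt c c' t) (hz : ∀ᵐ θ ∂μ, e (c t) θ ∈ K) :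
    Integrable (fun θ => fderiv ℝ g (e (c t) θ) (e c' θ)) μ ∧
    HasDerivAt (fun s => ∫ θ, g (e (c s) θ) ∂μ) (∫ θ, fderiv ℝ g (e (c t) θ) (e c' θ) ∂μ) t := by
  obtain ⟨C, hC0, hC⟩ := he.bound
  have hgc : ∀ y ∈ K, ContinuousAt g y := fun y hy => (hg y hy).continuousAt
  have hfc : ∀ y ∈ K, ContinuousAt (fderiv ℝ g) y := fun y hy =>
    (hg y hy).continuousAt_fderiv one_ne_zero
  -- the derivative of the integrand is bounded on the essential values
  obtain ⟨B, hB⟩ : ∃ B, ∀ y ∈ K, ‖fderiv ℝ g y‖ ≤ B :=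
    hK.exists_bound_of_continuousOn fun y hy => (hfc y hy).continuousWithinAt
  have hBm : ∀ᵐ θ ∂μ, ‖fderiv ℝ g (e (c t) θ)‖ ≤ max B 0 := by
    filter_upwards [hz] with θ h
    exact (hB _ h).trans (le_max_left _ _)
  have hint : ∀ w, Integrable (fun θ => fderiv ℝ g (e (c t) θ) (e w θ)) μ := by
    intro w
    refine Integrable.of_bound (C := max B 0 * (C * ‖w‖)) ?_ ?_
    · have h1 : Measurable fun θ => fderiv ℝ g (e (c t) θ) :=
        (measurable_fderiv ℝ g).comp (he.measurable _)
      have h2 : Measurable fun θ => (fderiv ℝ g (e (c t) θ), e w θ) := h1.prodMk (he.measurable w)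
      exact (isBoundedBilinearMap_apply.continuous.measurable.comp h2).aestronglyMeasurable
    · filter_upwards [hBm, hC w] with θ h1 h2
      exact (ContinuousLinearMap.le_opNorm _ _).trans
        (mul_le_mul h1 h2 (norm_nonneg _) (le_max_right _ _))
  refine ⟨hint c', ?_⟩
  rw [hasDerivAt_iff_isLittleO, Asymptotics.isLittleO_iff]
  intro ε hε
  set m := μ.real univ with hm
  have hm0 : 0 ≤ m := measureReal_nonneg
  -- the error is split into a second order part of the integrand and that of the path
  set η := ε / (2 * (m + 1) * (C + 1) * (‖c'‖ + 1)) with hη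
  have hη0 : 0 < η := by positivity
  set κ := min 1 (ε / (2 * (m + 1) * (C + 1) * (max B 0 + 1))) with hκ
  have hB0 : 0 ≤ max B 0 := le_max_right _ _
  have hκ0 : 0 < κ := lt_min one_pos (by positivity)
  obtain ⟨-, δ, hδ, H⟩ := hK.exists_uniform_of_eventually
    (Q := fun _ b a => ‖g b - g a - fderiv ℝ g a (b - a)‖ ≤ η * ‖b - a‖)
    (fun _ _ _ _ _ h => h) fun y hy => by
      refine ⟨0, ?_⟩
      have h1 := ((hg y hy).hasStrictFDerivAt one_ne_zero).isLittleO.def (half_pos hη0)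
      have h2 : ∀ᶠ a in 𝓝 y, ‖fderiv ℝ g a - fderiv ℝ g y‖ < η / 2 := by
        have := Metric.continuousAt_iff'.1 (hfc y hy) (η / 2) (half_pos hη0)
        simpa [dist_eq_norm] using this
      have h2' : ∀ᶠ p : Y × Y in 𝓝 (y, y), ‖fderiv ℝ g p.2 - fderiv ℝ g y‖ < η / 2 :=
        (continuous_snd.tendsto (y, y)).eventually h2
      filter_upwards [h1, h2'] with p hp1 hp2
      have h3 : g p.1 - g p.2 - fderiv ℝ g p.2 (p.1 - p.2) =
        (g p.1 - g p.2 - fderiv ℝ g y (p.1 - p.2)) -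
          (fderiv ℝ g p.2 - fderiv ℝ g y) (p.1 - p.2) := by
        simp only [_root_.sub_apply]; ring
      rw [h3]
      have h4 := (fderiv ℝ g p.2 - fderiv ℝ g y).le_opNorm (p.1 - p.2)
      have h5 := mul_le_mul_of_nonneg_right hp2.le (norm_nonneg (p.1 - p.2))
      linarith [norm_sub_le (g p.1 - g p.2 - fderiv ℝ g y (p.1 - p.2))
        ((fderiv ℝ g p.2 - fderiv ℝ g y) (p.1 - p.2))]
  have hct := hc.continuousAt
  filter_upwards [hct.eventually (he.eventually_ae_dist_lt (c t) hδ),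
    hct.eventually (he.eventually_integrable hK hgc hgm hz),
    (hasDerivAt_iff_isLittleO.1 hc).def hκ0] with s hs1 hs2 hs3
  have hs4 : ‖c s - c t‖ ≤ (‖c'‖ + 1) * ‖s - t‖ := by
    have h1 := norm_add_le (c s - c t - (s - t) • c') ((s - t) • c')
    rw [sub_add_cancel, norm_smul] at h1
    have h2 : κ * ‖s - t‖ ≤ 1 * ‖s - t‖ :=
      mul_le_mul_of_nonneg_right (min_le_left _ _) (norm_nonneg _)
    linarith
  have hi : Integrable (fun θ => g (e (c t) θ)) μ := he.integrable hK hgc hgm hz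
  have hsub : (∫ θ, g (e (c s) θ) ∂μ) - (∫ θ, g (e (c t) θ) ∂μ) -
      (s - t) • ∫ θ, fderiv ℝ g (e (c t) θ) (e c' θ) ∂μ =
      ∫ θ, (g (e (c s) θ) - g (e (c t) θ) - (s - t) • fderiv ℝ g (e (c t) θ) (e c' θ)) ∂μ := by
    rw [← integral_smul, ← integral_sub hs2 hi]
    exact (integral_sub (hs2.sub hi) ((hint c').smul (s - t))).symm
  rw [hsub]
  have key : ‖∫ θ, (g (e (c s) θ) - g (e (c t) θ) -
      (s - t) • fderiv ℝ g (e (c t) θ) (e c' θ)) ∂μ‖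
      ≤ (η * (C * ((‖c'‖ + 1) * ‖s - t‖)) + max B 0 * (C * (κ * ‖s - t‖))) * m := by
    refine norm_integral_le_of_norm_le_const ?_
    filter_upwards [hs1, hz, hBm, he.sub (c s) (c t), hC (c s - c t),
      hC (c s - c t - (s - t) • c'), he.sub (c s - c t) ((s - t) • c'), he.smul (s - t) c']
      with θ h1 h2 h3 h4 h5 h6 h7 h8
    have e1 : g (e (c s) θ) - g (e (c t) θ) - (s - t) • fderiv ℝ g (e (c t) θ) (e c' θ) =
        (g (e (c s) θ) - g (e (c t) θ) - fderiv ℝ g (e (c t) θ) (e (c s) θ - e (c t) θ)) +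
        fderiv ℝ g (e (c t) θ) (e (c s - c t - (s - t) • c') θ) := by
      rw [h7, h8, h4, map_sub (fderiv ℝ g (e (c t) θ)) _ ((s - t) • e c' θ), map_smul]; ring
    rw [e1]
    refine (norm_add_le _ _).trans (add_le_add ?_ ?_)
    · refine (H _ h2 _ _ h1 (by simpa using hδ)).trans ?_
      rw [← h4]
      exact mul_le_mul_of_nonneg_left
        (h5.trans (mul_le_mul_of_nonneg_left hs4 hC0)) hη0.le
    · exact (ContinuousLinearMap.le_opNorm _ _).trans (mul_le_mul h3
        (h6.trans (mul_le_mul_of_nonneg_left hs3 hC0)) (norm_nonneg _) hB0)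
  refine key.trans ?_
  have hn : 0 ≤ ‖s - t‖ := norm_nonneg _
  have h1 : η * (C * (‖c'‖ + 1)) * m ≤ ε / 2 := by
    have : ε / 2 = η * ((C + 1) * (‖c'‖ + 1)) * (m + 1) := by rw [hη]; field_simp
    rw [this]
    gcongr <;> linarith
  have h2 : max B 0 * (C * κ) * m ≤ ε / 2 := by
    have : ε / 2 = (max B 0 + 1) * ((C + 1) * (ε / (2 * (m + 1) * (C + 1) * (max B 0 + 1))))
      * (m + 1) := by field_simp
    rw [this]
    gcongr
    · linarith
    · linarith
    · exact min_le_right _ _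
    · linarith
  nlinarith

end IsEssBoundedEval

/-! ### The integrals entering the metric, and their derivatives -/

section Functionals

variable {d : ℕ}

/-- Lebesgue measure on a fundamental domain of the circle. -/
noncomputable abbrev circleMeasure : Measure ℝ := volume.restrict (Ioc 0 (2 * π))

/-- The derivative `c_θ` of a curve of mean zero. -/
noncomputable def dθ₀ (c : LipCurve₀ d) : ℝ → EuclideanSpace ℝ (Fin d) := (c : LipCurve d).dθ

theorem ae_norm_dθ₀_le (c : LipCurve₀ d) : ∀ᵐ θ ∂circleMeasure, ‖dθ₀ c θ‖ ≤ ‖c‖ := by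
  refine ae_restrict_of_ae ?_
  filter_upwards [(c : LipCurve d).ae_norm_dθ_le] with θ h
  refine h.trans ?_
  rw [Submodule.norm_coe c |>.symm, LipCurve.norm_def]
  exact le_add_of_nonneg_left (norm_nonneg _)

theorem isEssBoundedEval_dθ₀ : IsEssBoundedEval circleMeasure (dθ₀ (d := d)) where
  measurable c := measurable_deriv _
  sub c k := by
    have h := LipCurve.dθ_add ((c : LipCurve d) - (k : LipCurve d)) (k : LipCurve d)
    rw [sub_add_cancel] at h
    refine ae_restrict_of_ae ?_
    filter_upwards [h] with θ h1
    exact eq_sub_of_add_eq h1.symm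
  smul r c := Eventually.of_forall fun θ => congrFun (LipCurve.dθ_smul r (c : LipCurve d)) θ
  bound := ⟨1, zero_le_one, fun c => by simpa only [one_mul] using ae_norm_dθ₀_le c⟩

/-- The derivatives of four curves, as functions with values in a product. -/
noncomputable def dθ₄ (z : LipCurve₀ d × LipCurve₀ d × LipCurve₀ d × LipCurve₀ d) (θ : ℝ) :
    EuclideanSpace ℝ (Fin d) × EuclideanSpace ℝ (Fin d) × EuclideanSpace ℝ (Fin d) ×
      EuclideanSpace ℝ (Fin d) :=
  (dθ₀ z.1 θ, dθ₀ z.2.1 θ, dθ₀ z.2.2.1 θ, dθ₀ z.2.2.2 θ)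

theorem isEssBoundedEval_dθ₄ : IsEssBoundedEval circleMeasure (dθ₄ (d := d)) :=
  isEssBoundedEval_dθ₀.prod (isEssBoundedEval_dθ₀.prod
    (isEssBoundedEval_dθ₀.prod isEssBoundedEval_dθ₀))

theorem mem_immersions_iff {c : LipCurve₀ d} :
    c ∈ Immersions₀ d ↔ ∃ ε : ℝ, 0 < ε ∧ ∀ᵐ θ : ℝ, ε ≤ ‖dθ₀ c θ‖ := Iff.rfl

/-- The essential values of the derivatives of an immersion and of three tangent vectors lie in a
compact set that avoids the zero velocity. -/
theorem exists_compact_dθ₄ (z : LipCurve₀ d × LipCurve₀ d × LipCurve₀ d × LipCurve₀ d)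
    (hz : z.1 ∈ Immersions₀ d) :
    ∃ K, IsCompact K ∧ (∀ y ∈ K, y.1 ≠ 0) ∧ ∀ᵐ θ ∂circleMeasure, dθ₄ z θ ∈ K := by
  obtain ⟨ε, hε, h⟩ := mem_immersions_iff.1 hz
  obtain ⟨C, hC0, hC⟩ := (isEssBoundedEval_dθ₄ (d := d)).bound
  refine ⟨Metric.closedBall 0 (C * ‖z‖) ∩ {y | ε ≤ ‖y.1‖},
    (isCompact_closedBall _ _).inter_right
      (isClosed_le continuous_const (continuous_fst.norm)), ?_, ?_⟩
  · rintro y ⟨-, hy⟩ h0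
    have hy' : ε ≤ ‖y.1‖ := hy
    rw [h0, norm_zero] at hy'
    linarith
  · filter_upwards [ae_restrict_of_ae h, hC z] with θ h1 h2
    exact ⟨by simpa using h2, h1⟩

theorem integrable_dθ₄ (z : LipCurve₀ d × LipCurve₀ d × LipCurve₀ d × LipCurve₀ d)
    (hz : z.1 ∈ Immersions₀ d) {g : EuclideanSpace ℝ (Fin d) × EuclideanSpace ℝ (Fin d) ×
      EuclideanSpace ℝ (Fin d) × EuclideanSpace ℝ (Fin d) → ℝ}
    (hg : ∀ y, y.1 ≠ 0 → ContinuousAt g y) (hgm : Measurable g) :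
    Integrable (fun θ => g (dθ₄ z θ)) circleMeasure := by
  obtain ⟨K, hK, hK0, hzK⟩ := exists_compact_dθ₄ z hz
  exact isEssBoundedEval_dθ₄.integrable hK (fun y hy => hg y (hK0 y hy)) hgm hzK

theorem continuousAt_integral_dθ₄ (z : LipCurve₀ d × LipCurve₀ d × LipCurve₀ d × LipCurve₀ d)
    (hz : z.1 ∈ Immersions₀ d) {g : EuclideanSpace ℝ (Fin d) × EuclideanSpace ℝ (Fin d) ×
      EuclideanSpace ℝ (Fin d) × EuclideanSpace ℝ (Fin d) → ℝ}
    (hg : ∀ y, y.1 ≠ 0 → ContinuousAt g y) (hgm : Measurable g) :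
    ContinuousAt (fun z => ∫ θ, g (dθ₄ z θ) ∂circleMeasure) z := by
  obtain ⟨K, hK, hK0, hzK⟩ := exists_compact_dθ₄ z hz
  exact isEssBoundedEval_dθ₄.continuousAt_integral hK (fun y hy => hg y (hK0 y hy)) hgm hzK

/-- Differentiation under the integral, for an integrand that is `C¹` at nonzero velocities and
whose directional derivatives are given by `g'`. -/
theorem hasDerivAt_integral_dθ₄
    {c : ℝ → LipCurve₀ d × LipCurve₀ d × LipCurve₀ d × LipCurve₀ d}
    {c' : LipCurve₀ d × LipCurve₀ d × LipCurve₀ d × LipCurve₀ d} {t : ℝ}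
    (hc : HasDerivAt c c' t) (hz : (c t).1 ∈ Immersions₀ d)
    {g : EuclideanSpace ℝ (Fin d) × EuclideanSpace ℝ (Fin d) × EuclideanSpace ℝ (Fin d) ×
      EuclideanSpace ℝ (Fin d) → ℝ}
    {g' : EuclideanSpace ℝ (Fin d) × EuclideanSpace ℝ (Fin d) × EuclideanSpace ℝ (Fin d) ×
      EuclideanSpace ℝ (Fin d) → EuclideanSpace ℝ (Fin d) × EuclideanSpace ℝ (Fin d) ×
      EuclideanSpace ℝ (Fin d) × EuclideanSpace ℝ (Fin d) → ℝ}
    (hg : ∀ y, y.1 ≠ 0 → ContDiffAt ℝ 1 g y) (hgm : Measurable g)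
    (hg' : ∀ y v, y.1 ≠ 0 → HasDerivAt (fun s : ℝ => g (y + s • v)) (g' y v) 0) :
    HasDerivAt (fun s => ∫ θ, g (dθ₄ (c s) θ) ∂circleMeasure)
      (∫ θ, g' (dθ₄ (c t) θ) (dθ₄ c' θ) ∂circleMeasure) t := by
  obtain ⟨K, hK, hK0, hzK⟩ := exists_compact_dθ₄ (c t) hz
  have h := (isEssBoundedEval_dθ₄.hasDerivAt_integral hK (fun y hy => hg y (hK0 y hy)) hgm hc
    hzK).2
  refine h.congr_deriv (integral_congr_ae ?_)
  filter_upwards [hzK] with θ hθ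
  set y := dθ₄ (c t) θ
  set v := dθ₄ c' θ
  have h1 : HasFDerivAt g (fderiv ℝ g y) (y + (0 : ℝ) • v) := by
    rw [zero_smul, add_zero]
    exact ((hg y (hK0 y hθ)).differentiableAt one_ne_zero).hasFDerivAt
  have h2 : HasDerivAt (fun s : ℝ => y + s • v) v 0 := by
    simpa using ((hasDerivAt_id (0 : ℝ)).smul_const v).const_add y
  exact (h1.comp_hasDerivAt 0 h2).unique (hg' y v (hK0 y hθ))

theorem hasDerivAt_norm_of_ne_zero {E : Type*} [NormedAddCommGroup E] [InnerProductSpace ℝ E]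
    {u : ℝ → E} {u' : E} {t : ℝ} (hu : HasDerivAt u u' t) (h0 : u t ≠ 0) :
    HasDerivAt (fun s => ‖u s‖) (‖u t‖⁻¹ * inner ℝ (u t) u') t := by
  have h1 := hu.norm_sq.sqrt (by positivity)
  simp only [Real.sqrt_sq (norm_nonneg _)] at h1
  refine h1.congr_deriv ?_
  have : ‖u t‖ ≠ 0 := norm_ne_zero_iff.2 h0
  field_simp

/-- The length `∫ |c_θ| dθ`. -/
noncomputable def lenI (c : LipCurve₀ d) : ℝ := ∫ θ, ‖dθ₀ c θ‖ ∂circleMeasure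

/-- The integral `∫ ⟨h_θ, k_θ⟩ / |c_θ| dθ`, which is `ℓ_c G_c(h, k)`. -/
noncomputable def formI (c h k : LipCurve₀ d) : ℝ :=
  ∫ θ, ‖dθ₀ c θ‖⁻¹ * inner ℝ (dθ₀ h θ) (dθ₀ k θ) ∂circleMeasure

/-- The derivative of the length at `c` in the direction `w`. -/
noncomputable def dlenI (c w : LipCurve₀ d) : ℝ :=
  ∫ θ, ‖dθ₀ c θ‖⁻¹ * inner ℝ (dθ₀ c θ) (dθ₀ w θ) ∂circleMeasure

/-- The derivative of `c ↦ ∫ ⟨h_θ, k_θ⟩ / |c_θ| dθ` in the direction `w`. -/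
noncomputable def dformI (c w h k : LipCurve₀ d) : ℝ :=
  ∫ θ, -(‖dθ₀ c θ‖⁻¹ ^ 3 * inner ℝ (dθ₀ c θ) (dθ₀ w θ) * inner ℝ (dθ₀ h θ) (dθ₀ k θ))
    ∂circleMeasure

theorem integrable_formI {c h k : LipCurve₀ d} (hc : c ∈ Immersions₀ d) :
    Integrable (fun θ => ‖dθ₀ c θ‖⁻¹ * inner ℝ (dθ₀ h θ) (dθ₀ k θ)) circleMeasure :=
  integrable_dθ₄ (c, 0, h, k) hc (g := fun y => ‖y.1‖⁻¹ * inner ℝ y.2.2.1 y.2.2.2)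
    (fun y hy => by
      have : ‖y.1‖ ≠ 0 := norm_ne_zero_iff.2 hy
      fun_prop (disch := assumption)) (by fun_prop)

theorem integrable_dformI {c w h k : LipCurve₀ d} (hc : c ∈ Immersions₀ d) :
    Integrable (fun θ => -(‖dθ₀ c θ‖⁻¹ ^ 3 * inner ℝ (dθ₀ c θ) (dθ₀ w θ) *
      inner ℝ (dθ₀ h θ) (dθ₀ k θ))) circleMeasure :=
  integrable_dθ₄ (c, w, h, k) hc
    (g := fun y => -(‖y.1‖⁻¹ ^ 3 * inner ℝ y.1 y.2.1 * inner ℝ y.2.2.1 y.2.2.2))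
    (fun y hy => by
      have : ‖y.1‖ ≠ 0 := norm_ne_zero_iff.2 hy
      fun_prop (disch := assumption)) (by fun_prop)

theorem metricG₀_eq (c h k : LipCurve₀ d) : metricG₀ c h k = (lenI c)⁻¹ * formI c h k := by
  unfold metricG₀ LipCurve.metricG LipCurve.length lenI formI
  rw [intervalIntegral.integral_of_le Real.two_pi_pos.le,
    intervalIntegral.integral_of_le Real.two_pi_pos.le]
  rfl

theorem formI_comm (c h k : LipCurve₀ d) : formI c h k = formI c k h := by
  simp only [formI, real_inner_comm]

theorem dθ₀_zero : dθ₀ (0 : LipCurve₀ d) = 0 := by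
  simpa [dθ₀] using LipCurve.dθ_smul 0 (0 : LipCurve d)

theorem formI_zero_right (c h : LipCurve₀ d) : formI c h 0 = 0 := by
  simp [formI, dθ₀_zero]

theorem lenI_pos {c : LipCurve₀ d} (hc : c ∈ Immersions₀ d) : 0 < lenI c := by
  obtain ⟨ε, hε, h⟩ := mem_immersions_iff.1 hc
  have hi : Integrable (fun θ => ‖dθ₀ c θ‖) circleMeasure :=
    integrable_dθ₄ (c, 0, 0, 0) hc (g := fun y => ‖y.1‖)
      (fun y _ => by fun_prop) (by fun_prop)
  have h1 : ∫ _, ε ∂circleMeasure ≤ lenI c :=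
    integral_mono_ae (integrable_const _) hi (ae_restrict_of_ae h)
  refine lt_of_lt_of_le ?_ h1
  simp only [integral_const, smul_eq_mul]
  refine mul_pos ?_ hε
  simp [Measure.real, ENNReal.toReal_ofReal Real.pi_pos.le, Real.pi_pos]

theorem continuousOn_lenI {T : Type*} [TopologicalSpace T] {s : Set T} {c : T → LipCurve₀ d}
    (hc : ContinuousOn c s) (hM : ∀ t ∈ s, c t ∈ Immersions₀ d) :
    ContinuousOn (fun t => lenI (c t)) s := fun t ht =>
  (continuousAt_integral_dθ₄ (c t, 0, 0, 0) (hM t ht) (g := fun y => ‖y.1‖)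
    (fun y _ => by fun_prop) (by fun_prop)).comp_continuousWithinAt
      (f := fun t => (c t, 0, 0, 0)) ((hc t ht).prodMk continuousWithinAt_const)

theorem continuousOn_formI {T : Type*} [TopologicalSpace T] {s : Set T} {c h k : T → LipCurve₀ d}
    (hc : ContinuousOn c s) (hh : ContinuousOn h s) (hk : ContinuousOn k s)
    (hM : ∀ t ∈ s, c t ∈ Immersions₀ d) :
    ContinuousOn (fun t => formI (c t) (h t) (k t)) s := fun t ht =>
  (continuousAt_integral_dθ₄ (c t, 0, h t, k t) (hM t ht)
    (g := fun y => ‖y.1‖⁻¹ * inner ℝ y.2.2.1 y.2.2.2)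
    (fun y hy => by
      have : ‖y.1‖ ≠ 0 := norm_ne_zero_iff.2 hy
      fun_prop (disch := assumption)) (by fun_prop)).comp_continuousWithinAt
      (f := fun t => (c t, 0, h t, k t))
      ((hc t ht).prodMk (continuousWithinAt_const.prodMk ((hh t ht).prodMk (hk t ht))))

theorem continuousOn_dlenI {T : Type*} [TopologicalSpace T] {s : Set T} {c w : T → LipCurve₀ d}
    (hc : ContinuousOn c s) (hw : ContinuousOn w s) (hM : ∀ t ∈ s, c t ∈ Immersions₀ d) :
    ContinuousOn (fun t => dlenI (c t) (w t)) s := continuousOn_formI hc hc hw hM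

theorem continuousOn_dformI {T : Type*} [TopologicalSpace T] {s : Set T}
    {c w h k : T → LipCurve₀ d} (hc : ContinuousOn c s) (hw : ContinuousOn w s)
    (hh : ContinuousOn h s) (hk : ContinuousOn k s) (hM : ∀ t ∈ s, c t ∈ Immersions₀ d) :
    ContinuousOn (fun t => dformI (c t) (w t) (h t) (k t)) s := fun t ht =>
  (continuousAt_integral_dθ₄ (c t, w t, h t, k t) (hM t ht)
    (g := fun y => -(‖y.1‖⁻¹ ^ 3 * inner ℝ y.1 y.2.1 * inner ℝ y.2.2.1 y.2.2.2))
    (fun y hy => by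
      have : ‖y.1‖ ≠ 0 := norm_ne_zero_iff.2 hy
      fun_prop (disch := assumption)) (by fun_prop)).comp_continuousWithinAt
      (f := fun t => (c t, w t, h t, k t))
      ((hc t ht).prodMk ((hw t ht).prodMk ((hh t ht).prodMk (hk t ht))))

theorem hasDerivAt_lenI {c : ℝ → LipCurve₀ d} {c' : LipCurve₀ d} {t : ℝ} (hc : HasDerivAt c c' t)
    (hM : c t ∈ Immersions₀ d) : HasDerivAt (fun s => lenI (c s)) (dlenI (c t) c') t := by
  refine hasDerivAt_integral_dθ₄ (c := fun s => (c s, 0, 0, 0)) (c' := (c', 0, 0, 0))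
    (hc.prodMk (hasDerivAt_const _ _)) hM (g := fun y => ‖y.1‖)
    (g' := fun y v => ‖y.1‖⁻¹ * inner ℝ y.1 v.1) ?_ (by fun_prop) ?_
  · intro y hy
    exact contDiffAt_fst.norm ℝ hy
  · intro y v hy
    have h2 : HasDerivAt (fun s : ℝ => y.1 + s • v.1) v.1 0 := by
      simpa using ((hasDerivAt_id (0 : ℝ)).smul_const v.1).const_add y.1
    simpa using (hasDerivAt_norm_of_ne_zero h2 (by simpa using hy))

theorem hasDerivAt_formI {c h k : ℝ → LipCurve₀ d} {c' h' k' : LipCurve₀ d} {t : ℝ}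
    (hc : HasDerivAt c c' t) (hh : HasDerivAt h h' t) (hk : HasDerivAt k k' t)
    (hM : c t ∈ Immersions₀ d) :
    HasDerivAt (fun s => formI (c s) (h s) (k s))
      (dformI (c t) c' (h t) (k t) + formI (c t) h' (k t) + formI (c t) (h t) k') t := by
  have key := hasDerivAt_integral_dθ₄ (c := fun s => (c s, 0, h s, k s)) (c' := (c', 0, h', k'))
    (hc.prodMk ((hasDerivAt_const _ _).prodMk (hh.prodMk hk))) hM
    (g := fun y => ‖y.1‖⁻¹ * inner ℝ y.2.2.1 y.2.2.2)
    (g' := fun y v => -(‖y.1‖⁻¹ ^ 3 * inner ℝ y.1 v.1 * inner ℝ y.2.2.1 y.2.2.2) +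
      ‖y.1‖⁻¹ * inner ℝ v.2.2.1 y.2.2.2 + ‖y.1‖⁻¹ * inner ℝ y.2.2.1 v.2.2.2) ?_ (by fun_prop) ?_
  · refine key.congr_deriv ?_
    have i1 := integrable_dformI (w := c') (h := h t) (k := k t) hM
    have i2 := integrable_formI (h := h') (k := k t) hM
    have i3 := integrable_formI (h := h t) (k := k') hM
    unfold formI dformI
    rw [← integral_add i1 i2, ← integral_add (i1.fun_add i2) i3]
    rfl
  · intro y hy
    have : ‖y.1‖ ≠ 0 := norm_ne_zero_iff.2 hy
    exact ((contDiffAt_fst.norm ℝ hy).inv this).mul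
      (ContDiffAt.inner ℝ (by fun_prop) (by fun_prop))
  · intro y v hy
    have hn : ‖y.1‖ ≠ 0 := norm_ne_zero_iff.2 hy
    have h1 : HasDerivAt (fun s : ℝ => y.1 + s • v.1) v.1 0 := by
      simpa using ((hasDerivAt_id (0 : ℝ)).smul_const v.1).const_add y.1
    have h2 : HasDerivAt (fun s : ℝ => y.2.2.1 + s • v.2.2.1) v.2.2.1 0 := by
      simpa using ((hasDerivAt_id (0 : ℝ)).smul_const v.2.2.1).const_add y.2.2.1
    have h3 : HasDerivAt (fun s : ℝ => y.2.2.2 + s • v.2.2.2) v.2.2.2 0 := by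
      simpa using ((hasDerivAt_id (0 : ℝ)).smul_const v.2.2.2).const_add y.2.2.2
    have h4 := ((hasDerivAt_norm_of_ne_zero h1 (by simpa using hy)).fun_inv (by simpa using hn)).mul
      (h2.inner ℝ h3)
    refine h4.congr_deriv ?_
    simp only [zero_smul, add_zero]
    field_simp
    ring

/-- The weak Euler–Lagrange expression of the energy, multiplied by the length, at a point `c` with
velocity `h` and acceleration `z`, tested with `k`. -/
noncomputable def eulerLagrange (c h z k : LipCurve₀ d) : ℝ :=
  1 / 2 * dformI c k h h - 1 / 2 * (formI c h h / lenI c) * dlenI c k - dformI c h h k +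
    dlenI c h / lenI c * formI c h k - formI c z k

/-- The pointwise density of the Euler–Lagrange expression, where `u`, `v` and `z` are the values of
`c_θ`, `c_tθ` and `c_ttθ`, and the numbers `a` and `b` stand for the nonlocal quantities
`(∫ |c_tθ|² / |c_θ| dθ) / ℓ` and `ℓ_t / ℓ`. -/
noncomputable def elDensity (u v z : EuclideanSpace ℝ (Fin d)) (a b : ℝ) :
    EuclideanSpace ℝ (Fin d) :=
  -(1 / 2 * (‖u‖⁻¹ ^ 3 * inner ℝ v v) + 1 / 2 * (a * ‖u‖⁻¹)) • u +
    (‖u‖⁻¹ ^ 3 * inner ℝ u v + b * ‖u‖⁻¹) • v - ‖u‖⁻¹ • z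

theorem eulerLagrange_eq_integral {c h z k : LipCurve₀ d} (hc : c ∈ Immersions₀ d) :
    eulerLagrange c h z k = ∫ θ, inner ℝ (elDensity (dθ₀ c θ) (dθ₀ h θ) (dθ₀ z θ)
      (formI c h h / lenI c) (dlenI c h / lenI c)) (dθ₀ k θ) ∂circleMeasure := by
  set a := formI c h h / lenI c with ha
  set b := dlenI c h / lenI c with hb
  have i1 := (integrable_dformI (w := k) (h := h) (k := h) hc).const_mul (1 / 2)
  have i2 := (integrable_formI (h := c) (k := k) hc).const_mul (1 / 2 * a)
  have i3 := integrable_dformI (w := h) (h := h) (k := k) hc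
  have i4 := (integrable_formI (h := h) (k := k) hc).const_mul b
  have i5 := integrable_formI (h := z) (k := k) hc
  unfold eulerLagrange
  rw [← ha, ← hb]
  unfold formI dformI dlenI
  rw [← integral_const_mul, ← integral_const_mul, ← integral_const_mul, ← integral_sub i1 i2,
    ← integral_sub (i1.sub' i2) i3, ← integral_add ((i1.sub' i2).sub' i3) i4,
    ← integral_sub (((i1.sub' i2).sub' i3).fun_add i4) i5]
  refine integral_congr_ae (Eventually.of_forall fun θ => ?_)
  simp only [elDensity, inner_sub_left, inner_add_left, inner_smul_left, RCLike.conj_to_real]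
  ring

end Functionals

/-! ### The first variation of the energy -/

section FirstVariation

variable {d : ℕ}

/-- The derivative of `G_c(h, h)` when `c` and `h` vary in the directions `w` and `k`. -/
noncomputable def firstVariation (c h w k : LipCurve₀ d) : ℝ :=
  -(dlenI c w) / lenI c ^ 2 * formI c h h +
    (lenI c)⁻¹ * (dformI c w h h + formI c k h + formI c h k)

theorem hasDerivAt_metricG₀ {c h : ℝ → LipCurve₀ d} {c' h' : LipCurve₀ d} {t : ℝ}
    (hc : HasDerivAt c c' t) (hh : HasDerivAt h h' t) (hM : c t ∈ Immersions₀ d) :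
    HasDerivAt (fun s => metricG₀ (c s) (h s) (h s)) (firstVariation (c t) (h t) c' h') t := by
  simp only [metricG₀_eq]
  exact ((hasDerivAt_lenI hc hM).fun_inv (lenI_pos hM).ne').mul (hasDerivAt_formI hc hh hh hM)

/-- Integration by parts: up to the Euler–Lagrange expression, the first variation along a path is
the derivative of the momentum. -/
theorem hasDerivAt_momentum {γ h w : ℝ → LipCurve₀ d} {z w' : LipCurve₀ d} {t : ℝ}
    (hγ : HasDerivAt γ (h t) t) (hh : HasDerivAt h z t) (hw : HasDerivAt w w' t)
    (hM : γ t ∈ Immersions₀ d) :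
    HasDerivAt (fun s => 2 * ((lenI (γ s))⁻¹ * formI (γ s) (h s) (w s)))
      (firstVariation (γ t) (h t) (w t) w' -
        2 * ((lenI (γ t))⁻¹ * eulerLagrange (γ t) (h t) z (w t))) t := by
  have h0 : lenI (γ t) ≠ 0 := (lenI_pos hM).ne'
  have key := (((hasDerivAt_lenI hγ hM).fun_inv h0).mul
    (hasDerivAt_formI hγ hh hw hM)).const_mul 2
  refine key.congr_deriv ?_
  unfold firstVariation eulerLagrange
  rw [formI_comm (γ t) w' (h t)]
  field_simp
  ring

theorem continuousOn_firstVariation {T : Type*} [TopologicalSpace T] {s : Set T}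
    {c h w k : T → LipCurve₀ d} (hc : ContinuousOn c s) (hh : ContinuousOn h s)
    (hw : ContinuousOn w s) (hk : ContinuousOn k s) (hM : ∀ t ∈ s, c t ∈ Immersions₀ d) :
    ContinuousOn (fun t => firstVariation (c t) (h t) (w t) (k t)) s := by
  have hl := continuousOn_lenI hc hM
  have h0 : ∀ t ∈ s, lenI (c t) ≠ 0 := fun t ht => (lenI_pos (hM t ht)).ne'
  exact (((continuousOn_dlenI hc hw hM).neg.div (hl.pow 2) fun t ht => pow_ne_zero 2 (h0 t ht)).mul
    (continuousOn_formI hc hh hh hM)).add ((hl.inv₀ h0).mul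
    (((continuousOn_dformI hc hw hh hh hM).add (continuousOn_formI hc hk hh hM)).add
      (continuousOn_formI hc hh hk hM)))

theorem continuousOn_eulerLagrange {T : Type*} [TopologicalSpace T] {s : Set T}
    {c h z k : T → LipCurve₀ d} (hc : ContinuousOn c s) (hh : ContinuousOn h s)
    (hz : ContinuousOn z s) (hk : ContinuousOn k s) (hM : ∀ t ∈ s, c t ∈ Immersions₀ d) :
    ContinuousOn (fun t => eulerLagrange (c t) (h t) (z t) (k t)) s := by
  have hl := continuousOn_lenI hc hM
  have h0 : ∀ t ∈ s, lenI (c t) ≠ 0 := fun t ht => (lenI_pos (hM t ht)).ne'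
  exact ((((continuousOn_const.mul (continuousOn_dformI hc hk hh hh hM)).sub
    ((continuousOn_const.mul ((continuousOn_formI hc hh hh hM).div hl h0)).mul
      (continuousOn_dlenI hc hk hM))).sub (continuousOn_dformI hc hh hh hk hM)).add
    (((continuousOn_dlenI hc hh hM).div hl h0).mul (continuousOn_formI hc hh hk hM))).sub
    (continuousOn_formI hc hz hk hM)

/-- On an open set, a smooth path has a derivative, which is again smooth. -/
theorem ContDiffOn.hasDerivAt_and_deriv {E : Type*} [NormedAddCommGroup E] [NormedSpace ℝ E]
    {γ : ℝ → E} {I : Set ℝ} (hI : IsOpen I) (h : ContDiffOn ℝ ∞ γ I) :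
    (∀ t ∈ I, HasDerivAt γ (deriv γ t) t) ∧ ContDiffOn ℝ ∞ (deriv γ) I := by
  have h1 := (contDiffOn_infty_iff_deriv_of_isOpen hI).1 h
  exact ⟨fun t ht => ((h1.1 t ht).differentiableAt (hI.mem_nhds ht)).hasDerivAt, h1.2⟩

/-- The first variation formula: along a smooth variation with fixed end points, the derivative of
the energy is the integral of the Euler–Lagrange expression tested with the variation field. -/
theorem hasDerivAt_energy {γ : ℝ → LipCurve₀ d} {I : Set ℝ} (hI : IsOpen I)
    (hγ : ContDiffOn ℝ ∞ γ I) {a b δ : ℝ} (hab : a < b) (hIab : Icc a b ⊆ I) (hδ : 0 < δ)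
    {Γ : ℝ → ℝ → LipCurve₀ d} (hΓ : IsProperVariation (Immersions₀ d) I γ a b δ Γ) :
    HasDerivAt (fun ε => energy metricG₀ a b (Γ ε))
      (∫ t in a..b, (lenI (γ t))⁻¹ * eulerLagrange (γ t) (deriv γ t) (deriv (deriv γ) t)
        (deriv (fun ε => Γ ε t) 0)) 0 := by
  obtain ⟨hsm, hmem, hbase, hleft, hright⟩ := hΓ
  set J : Set ℝ := Ioo (-δ) δ with hJ
  have hJo : IsOpen J := isOpen_Ioo
  have h0J : (0 : ℝ) ∈ J := ⟨by linarith, hδ⟩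
  have hUo : IsOpen (J ×ˢ I) := hJo.prod hI
  set F := Function.uncurry Γ with hF
  -- partial derivatives of the variation
  have hdF : ContDiffOn ℝ ∞ (fderiv ℝ F) (J ×ˢ I) := hsm.fderiv_of_isOpen hUo (by simp)
  set Ft : ℝ × ℝ → LipCurve₀ d := fun p => fderiv ℝ F p (0, 1) with hFt
  set Fe : ℝ × ℝ → LipCurve₀ d := fun p => fderiv ℝ F p (1, 0) with hFe
  have hFtc : ContDiffOn ℝ ∞ Ft (J ×ˢ I) := hdF.clm_apply contDiffOn_const
  have hFec : ContDiffOn ℝ ∞ Fe (J ×ˢ I) := hdF.clm_apply contDiffOn_const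
  set Fte : ℝ × ℝ → LipCurve₀ d := fun p => fderiv ℝ Ft p (1, 0) with hFte
  have hFtec : ContDiffOn ℝ ∞ Fte (J ×ˢ I) :=
    (hFtc.fderiv_of_isOpen hUo (by simp)).clm_apply contDiffOn_const
  have hdiff : ∀ {g : ℝ × ℝ → LipCurve₀ d}, ContDiffOn ℝ ∞ g (J ×ˢ I) → ∀ p ∈ J ×ˢ I,
      HasFDerivAt g (fderiv ℝ g p) p := fun hg p hp =>
    ((hg.differentiableOn (by simp) p hp).differentiableAt (hUo.mem_nhds hp)).hasFDerivAt
  have he1 : ∀ ε t : ℝ, HasDerivAt (fun s : ℝ => (s, t)) ((1 : ℝ), (0 : ℝ)) ε := fun ε t =>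
    (hasDerivAt_id ε).prodMk (hasDerivAt_const ε t)
  have he2 : ∀ ε t : ℝ, HasDerivAt (fun s : ℝ => (ε, s)) ((0 : ℝ), (1 : ℝ)) t := fun ε t =>
    (hasDerivAt_const t ε).prodMk (hasDerivAt_id t)
  have dt : ∀ ε ∈ J, ∀ t ∈ I, HasDerivAt (Γ ε) (Ft (ε, t)) t := fun ε hε t ht =>
    (hdiff hsm (ε, t) ⟨hε, ht⟩).comp_hasDerivAt t (he2 ε t)
  have de : ∀ ε ∈ J, ∀ t ∈ I, HasDerivAt (fun s => Γ s t) (Fe (ε, t)) ε := fun ε hε t ht =>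
    (hdiff hsm (ε, t) ⟨hε, ht⟩).comp_hasDerivAt (f := fun s => (s, t)) ε (he1 ε t)
  have dte : ∀ ε ∈ J, ∀ t ∈ I, HasDerivAt (fun s => Ft (s, t)) (Fte (ε, t)) ε := fun ε hε t ht =>
    (hdiff hFtc (ε, t) ⟨hε, ht⟩).comp_hasDerivAt (f := fun s => (s, t)) ε (he1 ε t)
  have det : ∀ ε ∈ J, ∀ t ∈ I, HasDerivAt (fun s => Fe (ε, s)) (Fte (ε, t)) t := by
    intro ε hε t ht
    have hp : (ε, t) ∈ J ×ˢ I := ⟨hε, ht⟩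
    have h1 := (hdiff hFec (ε, t) hp).comp_hasDerivAt t (he2 ε t)
    refine h1.congr_deriv ?_
    -- the mixed second derivatives agree
    have h2 : HasFDerivAt (fderiv ℝ F) (fderiv ℝ (fderiv ℝ F) (ε, t)) (ε, t) :=
      ((hdF.differentiableOn (by simp) _ hp).differentiableAt (hUo.mem_nhds hp)).hasFDerivAt
    have h3 := second_derivative_symmetric_of_eventually (f := F) (f' := fderiv ℝ F)
      (x := (ε, t)) (by
        filter_upwards [hUo.mem_nhds hp] with q hq
        exact hdiff hsm q hq) h2 (0, 1) (1, 0)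
    have h4 : fderiv ℝ Fe (ε, t) (0, 1) = fderiv ℝ (fderiv ℝ F) (ε, t) (0, 1) (1, 0) := by
      have := (h2.clm_apply (hasFDerivAt_const ((1 : ℝ), (0 : ℝ)) (ε, t))).fderiv
      rw [hFe, this]; simp
    have h5 : fderiv ℝ Ft (ε, t) (1, 0) = fderiv ℝ (fderiv ℝ F) (ε, t) (1, 0) (0, 1) := by
      have := (h2.clm_apply (hasFDerivAt_const ((0 : ℝ), (1 : ℝ)) (ε, t))).fderiv
      rw [hFt, this]; simp
    rw [h4, h3, ← h5]
  -- differentiation under the time integral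
  set L : ℝ → ℝ → ℝ := fun ε t => metricG₀ (Γ ε t) (Ft (ε, t)) (Ft (ε, t)) with hL
  set L' : ℝ → ℝ → ℝ := fun ε t => firstVariation (Γ ε t) (Ft (ε, t)) (Fe (ε, t)) (Fte (ε, t))
    with hL'
  have hsub : J ×ˢ Icc a b ⊆ J ×ˢ I := prod_mono le_rfl hIab
  have hL'c : ContinuousOn (Function.uncurry L') (J ×ˢ Icc a b) :=
    continuousOn_firstVariation (c := F) (hsm.continuousOn.mono hsub)
      (hFtc.continuousOn.mono hsub) (hFec.continuousOn.mono hsub) (hFtec.continuousOn.mono hsub)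
      fun p hp => hmem p.1 hp.1 p.2 hp.2
  have hLc : ContinuousOn (Function.uncurry L) (J ×ˢ Icc a b) := by
    have hM : ∀ p ∈ J ×ˢ Icc a b, F p ∈ Immersions₀ d := fun p hp => hmem p.1 hp.1 p.2 hp.2
    have h1 := continuousOn_lenI (hsm.continuousOn.mono hsub) hM
    have h2 := continuousOn_formI (hsm.continuousOn.mono hsub) (hFtc.continuousOn.mono hsub)
      (hFtc.continuousOn.mono hsub) hM
    refine ((h1.inv₀ fun p hp => (lenI_pos (hM p hp)).ne').mul h2).congr fun p _ => ?_
    exact metricG₀_eq _ _ _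
  have hslice : ∀ {g : ℝ → ℝ → ℝ}, ContinuousOn (Function.uncurry g) (J ×ˢ Icc a b) → ∀ ε ∈ J,
      ContinuousOn (g ε) (Icc a b) := fun hg ε hε =>
    hg.comp (f := fun t => (ε, t)) (by fun_prop) fun t ht => ⟨hε, ht⟩
  have hSJ : Icc (-(δ / 2)) (δ / 2) ⊆ J := fun x hx => ⟨by linarith [hx.1], by linarith [hx.2]⟩
  obtain ⟨C, hC⟩ := (isCompact_Icc.prod isCompact_Icc).exists_bound_of_continuousOn
    (hL'c.mono (prod_mono hSJ (le_refl (Icc a b))))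
  have huI : uIoc a b ⊆ Icc a b := by rw [uIoc_of_le hab.le]; exact Ioc_subset_Icc_self
  have huIcc : uIcc a b = Icc a b := uIcc_of_le hab.le
  have hmeas : ∀ {g : ℝ → ℝ}, ContinuousOn g (Icc a b) →
      AEStronglyMeasurable g (volume.restrict (uIoc a b)) := fun hg =>
    (hg.aestronglyMeasurable measurableSet_Icc).mono_measure (Measure.restrict_mono huI le_rfl)
  have hder := (intervalIntegral.hasDerivAt_integral_of_dominated_loc_of_deriv_le
    (μ := volume) (a := a) (b := b) (F := L) (F' := L') (x₀ := (0 : ℝ)) (bound := fun _ => C)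
    (s := Icc (-(δ / 2)) (δ / 2)) (Icc_mem_nhds (by linarith) (by linarith))
    (by filter_upwards [hJo.mem_nhds h0J] with ε hε using hmeas (hslice hLc ε hε))
    ((hslice hLc 0 h0J).intervalIntegrable_of_Icc hab.le)
    (hmeas (hslice hL'c 0 h0J))
    (Eventually.of_forall fun t ht x hx => hC (x, t) ⟨hx, huI ht⟩)
    intervalIntegrable_const
    (Eventually.of_forall fun t ht x hx => hasDerivAt_metricG₀ (de x (hSJ hx) t (hIab (huI ht)))
      (dte x (hSJ hx) t (hIab (huI ht))) (hmem x (hSJ hx) t (huI ht)))).2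
  have hen : (fun ε => energy metricG₀ a b (Γ ε)) =ᶠ[𝓝 0] fun ε => 1 / 2 * ∫ t in a..b, L ε t := by
    filter_upwards [hJo.mem_nhds h0J] with ε hε
    unfold energy
    congr 1
    refine intervalIntegral.integral_congr fun t ht => ?_
    rw [huIcc] at ht
    simp only [hL, (dt ε hε t (hIab ht)).deriv]
  refine ((hder.const_mul (1 / 2)).congr_of_eventuallyEq hen).congr_deriv ?_
  -- integration by parts in time
  obtain ⟨hγd, hγ'⟩ := hγ.hasDerivAt_and_deriv hI
  obtain ⟨hγ'd, hγ''⟩ := hγ'.hasDerivAt_and_deriv hI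
  have hmemγ : ∀ t ∈ Icc a b, γ t ∈ Immersions₀ d := fun t ht => by
    rw [← hbase t (hIab ht)]; exact hmem 0 h0J t ht
  have hFt0 : ∀ t ∈ I, Ft (0, t) = deriv γ t := fun t ht => by
    refine (dt 0 h0J t ht).unique ((hγd t ht).congr_of_eventuallyEq ?_)
    filter_upwards [hI.mem_nhds ht] with s hs using hbase s hs
  have hFe0 : ∀ t ∈ I, Fe (0, t) = deriv (fun ε => Γ ε t) 0 := fun t ht => (de 0 h0J t ht).deriv.symm
  have hsl0 : ∀ {g : ℝ × ℝ → LipCurve₀ d}, ContDiffOn ℝ ∞ g (J ×ˢ I) →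
      ContinuousOn (fun t => g (0, t)) (Icc a b) := fun hg =>
    hg.continuousOn.comp (f := fun t : ℝ => ((0 : ℝ), t)) (by fun_prop)
      fun t ht => ⟨h0J, hIab ht⟩
  set EL : ℝ → ℝ := fun t =>
    (lenI (γ t))⁻¹ * eulerLagrange (γ t) (deriv γ t) (deriv (deriv γ) t) (Fe (0, t)) with hEL
  have hELc : ContinuousOn EL (Icc a b) :=
    ((continuousOn_lenI (hγ.continuousOn.mono hIab) hmemγ).inv₀
      fun t ht => (lenI_pos (hmemγ t ht)).ne').mul
    (continuousOn_eulerLagrange (hγ.continuousOn.mono hIab) (hγ'.continuousOn.mono hIab)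
      (hγ''.continuousOn.mono hIab) (hsl0 hFec) hmemγ)
  have hL0c := hslice hL'c 0 h0J
  have hparts : ∫ t in a..b, (L' 0 t - 2 * EL t) = 0 := by
    have h1 := intervalIntegral.integral_eq_sub_of_hasDerivAt (a := a) (b := b)
      (f := fun s => 2 * ((lenI (γ s))⁻¹ * formI (γ s) (deriv γ s) (Fe (0, s))))
      (f' := fun t => L' 0 t - 2 * EL t) (fun t ht => by
        rw [huIcc] at ht
        have h2 := hasDerivAt_momentum (hγd t (hIab ht)) (hγ'd t (hIab ht))
          (det 0 h0J t (hIab ht)) (hmemγ t ht)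
        refine h2.congr_deriv ?_
        simp only [hL', hbase t (hIab ht), hFt0 t (hIab ht), hEL])
      ((hL0c.sub (hELc.const_smul (2 : ℝ))).intervalIntegrable_of_Icc hab.le)
    have hwa : Fe (0, a) = 0 := by
      refine (de 0 h0J a (hIab (left_mem_Icc.2 hab.le))).unique
        ((hasDerivAt_const (0 : ℝ) (γ a)).congr_of_eventuallyEq ?_)
      filter_upwards [hJo.mem_nhds h0J] with ε hε using hleft ε hε
    have hwb : Fe (0, b) = 0 := by
      refine (de 0 h0J b (hIab (right_mem_Icc.2 hab.le))).unique
        ((hasDerivAt_const (0 : ℝ) (γ b)).congr_of_eventuallyEq ?_)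
      filter_upwards [hJo.mem_nhds h0J] with ε hε using hright ε hε
    rw [h1, hwa, hwb, formI_zero_right, formI_zero_right]
    simp
  rw [intervalIntegral.integral_sub (g := fun t => 2 * EL t) (hL0c.intervalIntegrable_of_Icc hab.le)
    ((hELc.const_smul (2 : ℝ)).intervalIntegrable_of_Icc hab.le),
    intervalIntegral.integral_const_mul] at hparts
  have hfin : ∫ t in a..b, EL t = ∫ t in a..b, (lenI (γ t))⁻¹ *
      eulerLagrange (γ t) (deriv γ t) (deriv (deriv γ) t) (deriv (fun ε => Γ ε t) 0) := by
    refine intervalIntegral.integral_congr fun t ht => ?_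
    rw [huIcc] at ht
    simp only [hEL, hFe0 t (hIab ht)]
  rw [← hfin]
  linarith

end FirstVariation

/-! ### The geodesic equation in weak form -/

section GeodesicEquation

variable {d : ℕ}

theorem dθ₀_smul (r : ℝ) (k : LipCurve₀ d) (θ : ℝ) : dθ₀ (r • k) θ = r • dθ₀ k θ :=
  congrFun (LipCurve.dθ_smul r (k : LipCurve d)) θ

theorem eulerLagrange_smul {c : LipCurve₀ d} (hc : c ∈ Immersions₀ d) (h z k : LipCurve₀ d)
    (r : ℝ) : eulerLagrange c h z (r • k) = r * eulerLagrange c h z k := by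
  rw [eulerLagrange_eq_integral hc, eulerLagrange_eq_integral hc, ← integral_const_mul]
  simp only [dθ₀_smul, inner_smul_right]

/-- A smooth path of immersions that solves the weak Euler–Lagrange equation is a geodesic. -/
theorem isGeodesic_of_eulerLagrange {γ : ℝ → LipCurve₀ d} {I : Set ℝ} (hI : IsOpen I)
    (hord : I.OrdConnected) (hγ : ContDiffOn ℝ ∞ γ I) (hmem : ∀ t ∈ I, γ t ∈ Immersions₀ d)
    (hEL : ∀ t ∈ I, ∀ k, eulerLagrange (γ t) (deriv γ t) (deriv (deriv γ) t) k = 0) :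
    IsGeodesic metricG₀ (Immersions₀ d : Set (LipCurve₀ d)) I γ where
  isOpen := hI
  ordConnected := hord
  smooth := hγ
  mem := hmem
  critical a b hab hIab δ Γ hδ hΓ := by
    refine (hasDerivAt_energy hI hγ hab hIab hδ hΓ).congr_deriv ?_
    rw [← intervalIntegral.integral_zero (a := a) (b := b) (μ := volume)]
    refine intervalIntegral.integral_congr fun t ht => ?_
    rw [uIcc_of_le hab.le] at ht
    simp only [hEL t (hIab ht), mul_zero]

/-- A family of paths, continuous in the parameter, stays in an open set on a compact interval for
small parameters if it does so for the parameter `0`. -/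
theorem exists_pos_forall_mem_of_isOpen {E : Type*} [TopologicalSpace E] {M : Set E} (hM : IsOpen M)
    {F : ℝ × ℝ → E} {I : Set ℝ} (hI : IsOpen I) (hF : ContinuousOn F (univ ×ˢ I)) {a b : ℝ}
    (hIab : Icc a b ⊆ I) (h0 : ∀ t ∈ Icc a b, F (0, t) ∈ M) :
    ∃ δ > 0, ∀ ε ∈ Ioo (-δ) δ, ∀ t ∈ Icc a b, F (ε, t) ∈ M := by
  have hn := hF.isOpen_inter_preimage (isOpen_univ.prod hI) hM
  obtain ⟨u, v, hu, -, h0u, hv, huv⟩ := generalized_tube_lemma (isCompact_singleton (x := (0 : ℝ)))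
    (isCompact_Icc (a := a) (b := b)) hn (by
      rintro ⟨ε, t⟩ ⟨hε, ht⟩
      obtain rfl : ε = 0 := hε
      exact ⟨⟨mem_univ _, hIab ht⟩, h0 t ht⟩)
  obtain ⟨δ, hδ, h⟩ := Metric.isOpen_iff.1 hu 0 (h0u rfl)
  rw [Real.ball_eq_Ioo, zero_sub, zero_add] at h
  exact ⟨δ, hδ, fun ε hε t ht => (huv ⟨h hε, hv ht⟩).2⟩

/-- A geodesic of a subset `S` of the space of immersions satisfies the weak Euler–Lagrange equation
in each direction `k` such that `S` is locally invariant under translations by multiples of `k`. -/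
theorem IsGeodesic.eulerLagrange_eq_zero {S : Set (LipCurve₀ d)}
    (hS : S ⊆ (Immersions₀ d : Set (LipCurve₀ d))) {γ : ℝ → LipCurve₀ d} {I : Set ℝ}
    (hγ : IsGeodesic metricG₀ S I γ) {k : LipCurve₀ d}
    (hk : ∀ c ∈ S, ∀ r : ℝ, c + r • k ∈ Immersions₀ d → c + r • k ∈ S) {t : ℝ} (ht : t ∈ I) :
    eulerLagrange (γ t) (deriv γ t) (deriv (deriv γ) t) k = 0 := by
  obtain ⟨hI, -, hsm, hmem, hcrit⟩ := hγ
  obtain ⟨hγd, hγ'⟩ := hsm.hasDerivAt_and_deriv hI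
  obtain ⟨hγ'd, hγ''⟩ := hγ'.hasDerivAt_and_deriv hI
  obtain ⟨a, b, htab, hnhds, hIab⟩ := exists_Icc_mem_subset_of_mem_nhds (hI.mem_nhds ht)
  have htab' : t ∈ Ioo a b := by rwa [← interior_Icc, mem_interior_iff_mem_nhds]
  have hab : a < b := htab'.1.trans htab'.2
  have hIoo : Ioo a b ⊆ I := Ioo_subset_Icc_self.trans hIab
  set f : ℝ → ℝ := fun t =>
    (lenI (γ t))⁻¹ * eulerLagrange (γ t) (deriv γ t) (deriv (deriv γ) t) k with hf
  have hfc : ContinuousOn f I :=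
    ((continuousOn_lenI hsm.continuousOn fun t ht => hS (hmem t ht)).inv₀
      fun t ht => (lenI_pos (hS (hmem t ht))).ne').mul
    (continuousOn_eulerLagrange hsm.continuousOn hγ'.continuousOn
      hγ''.continuousOn continuousOn_const fun t ht => hS (hmem t ht))
  have hae : ∀ᵐ s : ℝ, s ∈ Ioo a b → f s = 0 := by
    refine isOpen_Ioo.ae_eq_zero_of_integral_contDiff_smul_eq_zero
      ((hfc.mono hIoo).locallyIntegrableOn measurableSet_Ioo) fun η hη _ hsupp => ?_
    have hη0 : ∀ s, s ∉ Ioo a b → η s = 0 := fun s hs => by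
      by_contra h
      exact hs (hsupp (subset_tsupport _ h))
    -- the variation `γ + ε η k`
    set Γ : ℝ → ℝ → LipCurve₀ d := fun ε s => γ s + (ε * η s) • k with hΓ
    have hΓsm : ContDiffOn ℝ ∞ (Function.uncurry Γ) (univ ×ˢ I) := by
      have h1 : ContDiffOn ℝ ∞ (fun p : ℝ × ℝ => γ p.2) (univ ×ˢ I) :=
        hsm.comp contDiffOn_snd fun p hp => hp.2
      have h2 : ContDiffOn ℝ ∞ (fun p : ℝ × ℝ => (p.1 * η p.2) • k) (univ ×ˢ I) :=
        ((contDiff_fst.mul (hη.comp contDiff_snd)).smul contDiff_const).contDiffOn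
      exact h1.add h2
    obtain ⟨δ, hδ, hδM⟩ := exists_pos_forall_mem_of_isOpen (Immersions₀ d).isOpen hI
      hΓsm.continuousOn hIab (by
        intro s hs
        simpa [hΓ] using hS (hmem s (hIab hs)))
    have hvar : IsProperVariation S I γ a b δ Γ :=
      { smooth := hΓsm.mono (prod_mono (subset_univ _) le_rfl)
        mem := fun ε hε s hs => hk _ (hmem s (hIab hs)) _ (hδM ε hε s hs)
        base := fun s _ => by simp [hΓ]
        left := fun ε _ => by simp [hΓ, hη0 a (by simp)]
        right := fun ε _ => by simp [hΓ, hη0 b (by simp)] }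
    have hvarM : IsProperVariation (Immersions₀ d : Set (LipCurve₀ d)) I γ a b δ Γ :=
      { hvar with mem := fun ε hε s hs => hS (hvar.mem ε hε s hs) }
    have h0 := (hasDerivAt_energy hI hsm hab hIab hδ hvarM).unique (hcrit a b hab hIab δ Γ hδ hvar)
    rw [← h0, intervalIntegral.integral_of_le hab.le, integral_Ioc_eq_integral_Ioo,
      ← setIntegral_eq_integral_of_forall_compl_eq_zero (s := Ioo a b)
        (fun s hs => by rw [hη0 s hs, zero_smul])]
    refine setIntegral_congr_fun measurableSet_Ioo fun s hs => ?_
    have hd : HasDerivAt (fun ε => Γ ε s) (η s • k) 0 := by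
      have := (((hasDerivAt_id (0 : ℝ)).mul_const (η s)).smul_const k).const_add (γ s)
      simpa [hΓ] using this
    simp only [hd.deriv, hf, smul_eq_mul]
    rw [eulerLagrange_smul (hS (hmem s (hIoo hs)))]
    ring
  have heq : EqOn f 0 (Ioo a b) := by
    refine Measure.eqOn_open_of_ae_eq (μ := volume) ?_ isOpen_Ioo (hfc.mono hIoo) continuousOn_const
    exact (ae_restrict_iff' measurableSet_Ioo).2 hae
  have hft : f t = 0 := heq htab'
  exact (mul_eq_zero.1 hft).resolve_left (inv_ne_zero (lenI_pos (hS (hmem t ht))).ne')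

end GeodesicEquation

/-! ### Piecewise linear curves -/

section PiecewiseLinear

variable {d : ℕ}

theorem LipCurve.integral_inner_dθ (c : LipCurve d) (v : EuclideanSpace ℝ (Fin d)) (s t : ℝ) :
    ∫ x in s..t, inner ℝ v (c.dθ x) = inner ℝ v (c.lift t - c.lift s) := by
  obtain ⟨K, hK⟩ := c.lipschitz
  let φ : EuclideanSpace ℝ (Fin d) →L[ℝ] ℝ := innerSL ℝ v
  have hφ : LipschitzWith (‖φ‖₊ * K) (φ ∘ c.lift) :=
    φ.lipschitz.comp (LipCurve.lipschitzWith_lift hK)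
  have h := (hφ.lipschitzOnWith (s := uIcc s t)).absolutelyContinuousOnInterval.integral_deriv_eq_sub
  have h1 : φ (c.lift t - c.lift s) = (φ ∘ c.lift) t - (φ ∘ c.lift) s := by simp
  change _ = φ (c.lift t - c.lift s)
  rw [h1, ← h]
  refine intervalIntegral.integral_congr_ae ?_
  filter_upwards [c.ae_differentiableAt_lift] with x hd _
  exact ((φ.hasFDerivAt.comp_hasDerivAt x hd.hasDerivAt).deriv).symm

/-- A curve of mean zero whose derivative vanishes almost everywhere is zero. -/
theorem eq_zero_of_dθ₀_ae_eq_zero {c : LipCurve₀ d} (h : ∀ᵐ θ ∂circleMeasure, dθ₀ c θ = 0) :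
    c = 0 := by
  have hconst : ∀ t ∈ Icc 0 (2 * π), (c : LipCurve d).lift t = (c : LipCurve d).lift 0 := by
    intro t ht
    set v := (c : LipCurve d).lift t - (c : LipCurve d).lift 0 with hv
    have h1 := (c : LipCurve d).integral_inner_dθ v 0 t
    have h2 : ∫ x in (0 : ℝ)..t, inner ℝ v ((c : LipCurve d).dθ x) = 0 := by
      rw [intervalIntegral.integral_of_le ht.1]
      have hle : volume.restrict (Ioc 0 t) ≤ circleMeasure :=
        Measure.restrict_mono (Ioc_subset_Ioc_right ht.2) le_rfl
      refine integral_eq_zero_of_ae ?_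
      filter_upwards [ae_mono hle h] with x hx
      have hx' : (c : LipCurve d).dθ x = 0 := hx
      simp [hx']
    rw [h2, ← hv, real_inner_self_eq_norm_sq] at h1
    have : ‖v‖ = 0 := by simpa using h1.symm
    exact sub_eq_zero.1 (norm_eq_zero.1 this)
  have hmean : ∫ θ in (0 : ℝ)..2 * π, (c : LipCurve d).lift θ = 0 := c.2
  have h3 : ∫ θ in (0 : ℝ)..2 * π, (c : LipCurve d).lift θ =
      ∫ _ in (0 : ℝ)..2 * π, (c : LipCurve d).lift 0 :=
    intervalIntegral.integral_congr fun t ht =>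
      hconst t (by rwa [uIcc_of_le Real.two_pi_pos.le] at ht)
  rw [h3, intervalIntegral.integral_const, sub_zero] at hmean
  have h0 : (c : LipCurve d).lift 0 = 0 := (smul_eq_zero.1 hmean).resolve_left Real.two_pi_pos.ne'
  refine Subtype.ext (LipCurve.ext fun x => ?_)
  have hx := (AddCircle.equivIco (2 * π) 0 x).2
  have h4 := hconst _ ⟨hx.1, by simpa using hx.2.le⟩
  rw [h0] at h4
  simpa [LipCurve.lift] using h4

/-- The nodes `2πi/n` of the uniform grid. -/
noncomputable def gridNode (n i : ℕ) : ℝ := 2 * π * i / n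

theorem gridNode_succ (n i : ℕ) : gridNode n (i + 1) = 2 * π * (i + 1) / n := by
  simp [gridNode]

theorem gridNode_lt_succ {n : ℕ} (hn : 1 ≤ n) (i : ℕ) : gridNode n i < gridNode n (i + 1) := by
  have hn' : (0 : ℝ) < n := by exact_mod_cast hn
  rw [gridNode_succ, gridNode]
  gcongr
  linarith

theorem gridNode_succ_sub {n : ℕ} (i : ℕ) :
    gridNode n (i + 1) - gridNode n i = 2 * π / n := by
  rw [gridNode_succ, gridNode]
  ring

theorem gridNode_self {n : ℕ} (hn : 1 ≤ n) : gridNode n n = 2 * π := by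
  have hn' : (n : ℝ) ≠ 0 := by exact_mod_cast (by omega : n ≠ 0)
  rw [gridNode]; field_simp

theorem gridNode_le_two_pi {n : ℕ} (hn : 1 ≤ n) {i : ℕ} (hi : i ≤ n) : gridNode n i ≤ 2 * π := by
  have hn' : (0 : ℝ) < n := by exact_mod_cast hn
  have hi' : (i : ℝ) ≤ n := by exact_mod_cast hi
  rw [gridNode, div_le_iff₀ hn']
  have := Real.pi_pos
  nlinarith

theorem gridNode_nonneg (n i : ℕ) : 0 ≤ gridNode n i := by
  have := Real.pi_pos
  unfold gridNode; positivity

/-- Evaluation of Lipschitz curves at a point. -/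
noncomputable def LipCurve.evalL (x : AddCircle (2 * π)) :
    LipCurve d →L[ℝ] EuclideanSpace ℝ (Fin d) :=
  LinearMap.mkContinuous
    { toFun := fun c => c x
      map_add' := fun _ _ => rfl
      map_smul' := fun _ _ => rfl } 1 fun c => by
    rw [one_mul, LipCurve.norm_def]
    exact (c.toCM.norm_coe_le_norm x).trans (le_add_of_nonneg_right ENNReal.toReal_nonneg)

@[simp] theorem LipCurve.evalL_apply (x : AddCircle (2 * π)) (c : LipCurve d) :
    LipCurve.evalL x c = c x := rfl

/-- The mean slopes of a curve on the intervals of the uniform grid. -/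
noncomputable def slopes (n : ℕ) : LipCurve₀ d →L[ℝ] (Fin n → EuclideanSpace ℝ (Fin d)) :=
  ContinuousLinearMap.pi fun i => ((n : ℝ) / (2 * π)) •
    ((LipCurve.evalL (gridNode n (i + 1) : ℝ) - LipCurve.evalL (gridNode n i : ℝ)).comp
      (LipCurve₀ d).subtypeL)

theorem slopes_apply (n : ℕ) (c : LipCurve₀ d) (i : Fin n) :
    slopes n c i = ((n : ℝ) / (2 * π)) •
      ((c : LipCurve d).lift (gridNode n (i + 1)) - (c : LipCurve d).lift (gridNode n i)) := rfl

theorem lift_sub_lift_eq_slopes {n : ℕ} (hn : 1 ≤ n) (c : LipCurve₀ d) (i : Fin n) :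
    (c : LipCurve d).lift (gridNode n (i + 1)) - (c : LipCurve d).lift (gridNode n i) =
      (2 * π / n) • slopes n c i := by
  have hn' : (n : ℝ) ≠ 0 := by exact_mod_cast (by omega : n ≠ 0)
  have := Real.pi_ne_zero
  rw [slopes_apply, smul_smul]
  have h : 2 * π / n * (n / (2 * π)) = 1 := by field_simp
  rw [h, one_smul]

theorem LipCurve.lift_two_pi (c : LipCurve d) : c.lift (2 * π) = c.lift 0 := by
  simp [LipCurve.lift, AddCircle.coe_period]

theorem sum_slopes {n : ℕ} (hn : 1 ≤ n) (c : LipCurve₀ d) : ∑ i, slopes n c i = 0 := by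
  simp only [slopes_apply, ← Finset.smul_sum]
  rw [Fin.sum_univ_eq_sum_range (fun i => (c : LipCurve d).lift (gridNode n (i + 1)) -
    (c : LipCurve d).lift (gridNode n i)) n,
    Finset.sum_range_sub (fun i => (c : LipCurve d).lift (gridNode n i)), gridNode_self hn,
    LipCurve.lift_two_pi]
  simp [gridNode]

/-- The piecewise linear curves of mean zero. -/
def plSubmodule (n d : ℕ) : Submodule ℝ (LipCurve₀ d) where
  carrier := {c | (c : LipCurve d).IsPiecewiseLinear n}
  add_mem' := by
    intro c k hc hk i hi
    obtain ⟨a, b, h⟩ := hc i hi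
    obtain ⟨a', b', h'⟩ := hk i hi
    refine ⟨a + a', b + b', fun θ hθ => ?_⟩
    have : ((c + k : LipCurve₀ d) : LipCurve d).lift θ =
      (c : LipCurve d).lift θ + (k : LipCurve d).lift θ := rfl
    rw [this, h θ hθ, h' θ hθ, smul_add]
    abel
  zero_mem' := fun i _ => ⟨0, 0, fun θ _ => by
    rw [smul_zero, add_zero]
    rfl⟩
  smul_mem' := by
    intro r c hc i hi
    obtain ⟨a, b, h⟩ := hc i hi
    refine ⟨r • a, r • b, fun θ hθ => ?_⟩
    have : ((r • c : LipCurve₀ d) : LipCurve d).lift θ = r • (c : LipCurve d).lift θ := rfl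
    rw [this, h θ hθ, smul_add, smul_comm]

theorem dθ₀_eq_slopes {n : ℕ} (hn : 1 ≤ n) {c : LipCurve₀ d} (hc : c ∈ plSubmodule n d) (i : Fin n)
    {θ : ℝ} (hθ : θ ∈ Ioo (gridNode n i) (gridNode n (i + 1))) : dθ₀ c θ = slopes n c i := by
  obtain ⟨a, b, h⟩ := hc i i.2
  rw [← gridNode_succ, ← gridNode] at h
  have hlt := gridNode_lt_succ hn i
  have h1 : HasDerivAt (c : LipCurve d).lift b θ := by
    have h2 : HasDerivAt (fun θ : ℝ => a + θ • b) b θ := by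
      simpa using ((hasDerivAt_id θ).smul_const b).const_add a
    refine h2.congr_of_eventuallyEq ?_
    filter_upwards [isOpen_Ioo.mem_nhds hθ] with s hs using h s (Ioo_subset_Icc_self hs)
  have hn' : (n : ℝ) ≠ 0 := by exact_mod_cast (by omega : n ≠ 0)
  have := Real.pi_ne_zero
  rw [slopes_apply, h _ (right_mem_Icc.2 hlt.le), h _ (left_mem_Icc.2 hlt.le),
    add_sub_add_left_eq_sub, ← sub_smul, gridNode_succ_sub, smul_smul]
  have h3 : (n : ℝ) / (2 * π) * (2 * π / n) = 1 := by field_simp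
  rw [h3, one_smul]
  exact h1.deriv

theorem integral_circleMeasure_eq_sum {n : ℕ} (hn : 1 ≤ n) {f : ℝ → ℝ}
    (hf : Integrable f circleMeasure) :
    ∫ θ, f θ ∂circleMeasure =
      ∑ i : Fin n, ∫ θ in gridNode n i..gridNode n (i + 1), f θ := by
  rw [Fin.sum_univ_eq_sum_range
    (fun i => ∫ θ in gridNode n i..gridNode n (i + 1), f θ) n,
    intervalIntegral.sum_integral_adjacent_intervals, gridNode_self hn,
    intervalIntegral.integral_of_le]
  · simp [gridNode]
  · simpa [gridNode] using Real.pi_pos.le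
  · intro i hi
    rw [intervalIntegrable_iff_integrableOn_Ioc_of_le (gridNode_lt_succ hn i).le]
    exact IntegrableOn.mono_set hf (Ioc_subset_Ioc (gridNode_nonneg _ _)
      (gridNode_le_two_pi hn hi))

theorem intervalIntegral_congr_Ioo {a b : ℝ} (hab : a ≤ b) {f g : ℝ → ℝ}
    (h : ∀ θ ∈ Ioo a b, f θ = g θ) : ∫ θ in a..b, f θ = ∫ θ in a..b, g θ := by
  rw [intervalIntegral.integral_of_le hab, intervalIntegral.integral_of_le hab,
    integral_Ioc_eq_integral_Ioo, integral_Ioc_eq_integral_Ioo]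
  exact setIntegral_congr_fun measurableSet_Ioo h

/-- Almost every point of the circle lies inside an interval of the grid. -/
theorem ae_exists_mem_Ioo_gridNode {n : ℕ} (hn : 1 ≤ n) :
    ∀ᵐ θ ∂circleMeasure, ∃ i : Fin n, θ ∈ Ioo (gridNode n i) (gridNode n (i + 1)) := by
  have hcount : ∀ᵐ θ : ℝ, θ ∉ range (gridNode n) :=
    (countable_range (gridNode n)).ae_notMem volume
  filter_upwards [ae_restrict_of_ae hcount, ae_restrict_mem measurableSet_Ioc] with θ h1 h2
  have hn' : (0 : ℝ) < n := by exact_mod_cast hn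
  have hpi := Real.two_pi_pos
  set r : ℝ := θ * n / (2 * π) with hr
  have hr0 : 0 ≤ r := by have := h2.1.le; positivity
  have hθ : θ = 2 * π * r / n := by rw [hr]; field_simp
  have hf1 := Nat.floor_le hr0
  have hf2 := Nat.lt_floor_add_one r
  have hne : ∀ i, θ ≠ gridNode n i := fun i hi => h1 ⟨i, hi.symm⟩
  have hlt1 : gridNode n ⌊r⌋₊ < θ := by
    refine lt_of_le_of_ne ?_ (hne _).symm
    rw [hθ, gridNode]; gcongr
  have hlt2 : θ < gridNode n (⌊r⌋₊ + 1) := by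
    rw [hθ, gridNode_succ]; gcongr
  refine ⟨⟨⌊r⌋₊, ?_⟩, hlt1, hlt2⟩
  by_contra hcon
  have h3 : gridNode n n ≤ gridNode n ⌊r⌋₊ := by
    unfold gridNode
    have : (n : ℝ) ≤ ⌊r⌋₊ := by exact_mod_cast not_lt.1 hcon
    gcongr
  rw [gridNode_self hn] at h3
  linarith [h2.2]

theorem integrable_of_gridwise_const {Y : Type*} [NormedAddCommGroup Y] {n : ℕ} (hn : 1 ≤ n)
    {f : ℝ → Y} {y : Fin n → Y}
    (hf : ∀ i : Fin n, ∀ θ ∈ Ioo (gridNode n i) (gridNode n (i + 1)), f θ = y i)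
    (hm : AEStronglyMeasurable f circleMeasure) : Integrable f circleMeasure := by
  refine Integrable.of_bound hm (∑ i, ‖y i‖) ?_
  filter_upwards [ae_exists_mem_Ioo_gridNode hn] with θ ⟨i, hi⟩
  rw [hf i θ hi]
  exact Finset.single_le_sum (f := fun i => ‖y i‖) (fun _ _ => norm_nonneg _) (Finset.mem_univ i)

/-- The integral of a function that is constant on the intervals of the grid. -/
theorem integral_of_gridwise_const {n : ℕ} (hn : 1 ≤ n) {f : ℝ → ℝ} {y : Fin n → ℝ}
    (hf : ∀ i : Fin n, ∀ θ ∈ Ioo (gridNode n i) (gridNode n (i + 1)), f θ = y i)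
    (hm : AEStronglyMeasurable f circleMeasure) :
    ∫ θ, f θ ∂circleMeasure = 2 * π / n * ∑ i, y i := by
  rw [integral_circleMeasure_eq_sum hn (integrable_of_gridwise_const hn hf hm), Finset.mul_sum]
  refine Finset.sum_congr rfl fun i _ => ?_
  rw [intervalIntegral_congr_Ioo (gridNode_lt_succ hn i).le (hf i),
    intervalIntegral.integral_const, gridNode_succ_sub, smul_eq_mul]

/-- Integrated against a gridwise constant function, the derivative of a curve may be replaced by
its mean slopes. -/
theorem integral_inner_of_gridwise_const {n : ℕ} (hn : 1 ≤ n)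
    {φ : ℝ → EuclideanSpace ℝ (Fin d)} {y : Fin n → EuclideanSpace ℝ (Fin d)}
    (hφ : ∀ i : Fin n, ∀ θ ∈ Ioo (gridNode n i) (gridNode n (i + 1)), φ θ = y i)
    (k : LipCurve₀ d) (hi : Integrable (fun θ => inner ℝ (φ θ) (dθ₀ k θ)) circleMeasure) :
    ∫ θ, inner ℝ (φ θ) (dθ₀ k θ) ∂circleMeasure = 2 * π / n * ∑ i, inner ℝ (y i) (slopes n k i) := by
  rw [integral_circleMeasure_eq_sum hn hi, Finset.mul_sum]
  refine Finset.sum_congr rfl fun i _ => ?_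
  rw [intervalIntegral_congr_Ioo (g := fun θ => inner ℝ (y i) (dθ₀ k θ))
    (gridNode_lt_succ hn i).le (fun θ hθ => by rw [hφ i θ hθ])]
  rw [← inner_smul_right, ← lift_sub_lift_eq_slopes hn]
  exact (k : LipCurve d).integral_inner_dθ (y i) _ _

end PiecewiseLinear

/-! ### Piecewise linear interpolation and the dimension count -/

section Interpolation

variable {d : ℕ}

/-- The tent function on the circle, with peak at `0` and, for `n ≥ 2`, with support of
half-width `2π/n`. -/
noncomputable def tent (n : ℕ) (x : AddCircle (2 * π)) : ℝ := max 0 (1 - n / (2 * π) * ‖x‖)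

theorem exists_lipschitzWith_tent (n : ℕ) (a : AddCircle (2 * π)) :
    ∃ K : ℝ≥0, LipschitzWith K fun x => tent n (x - a) := by
  have h1 : LipschitzWith 1 fun x : AddCircle (2 * π) => ‖x - a‖ := by
    simpa [dist_eq_norm] using LipschitzWith.dist_left a
  have h2 : LipschitzWith (‖-((n : ℝ) / (2 * π))‖₊ * 1)
      fun x : AddCircle (2 * π) => -((n : ℝ) / (2 * π)) * ‖x - a‖ :=
    (lipschitzWith_smul (-((n : ℝ) / (2 * π)))).comp h1
  have h3 := ((LipschitzWith.const (1 : ℝ)).add h2).const_max 0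
  have h4 : (fun x => tent n (x - a)) =
      fun x => max 0 (1 + -((n : ℝ) / (2 * π)) * ‖x - a‖) := by
    funext x
    rw [tent, neg_mul, ← sub_eq_add_neg]
  rw [h4]
  exact ⟨_, h3⟩

/-- Values of the tent function in units of the grid. -/
theorem tent_of_abs_le {n : ℕ} (hn : 2 ≤ n) {r : ℝ} (hr : |r| ≤ 1) :
    tent n ((2 * π * r / n : ℝ) : AddCircle (2 * π)) = 1 - |r| := by
  have hn' : (2 : ℝ) ≤ n := by exact_mod_cast hn
  have hpi := Real.pi_pos
  have h1 : |2 * π * r / n| = 2 * π * |r| / n := by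
    rw [abs_div, abs_mul, abs_of_pos Real.two_pi_pos, Nat.abs_cast]
  have h2 : ‖((2 * π * r / n : ℝ) : AddCircle (2 * π))‖ = 2 * π * |r| / n := by
    rw [← h1]
    refine (AddCircle.norm_coe_eq_abs_iff (2 * π) Real.two_pi_pos.ne').2 ?_
    rw [h1, abs_of_pos Real.two_pi_pos, div_le_iff₀ (by linarith)]
    nlinarith
  rw [tent, h2]
  have h3 : (n : ℝ) / (2 * π) * (2 * π * |r| / n) = |r| := by
    have : (n : ℝ) ≠ 0 := by linarith
    field_simp
  rw [h3]
  exact max_eq_right (by linarith)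

theorem tent_eq_zero {n : ℕ} (hn : 1 ≤ n) {m : ℤ} (hm : ¬ (n : ℤ) ∣ m) (hm1 : ¬ (n : ℤ) ∣ m + 1)
    {τ : ℝ} (hτ : τ ∈ Icc (0 : ℝ) 1) :
    tent n ((2 * π * (m + τ) / n : ℝ) : AddCircle (2 * π)) = 0 := by
  have hn' : (0 : ℝ) < n := by exact_mod_cast hn
  have hpi := Real.pi_pos
  rw [tent, AddCircle.norm_eq]
  set k : ℤ := round ((2 * π)⁻¹ * (2 * π * (m + τ) / n)) with hk
  have h1 : 2 * π * (m + τ) / n - k * (2 * π) = 2 * π / n * ((m - k * n : ℤ) + τ) := by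
    push_cast; field_simp; ring
  have h2 : 1 ≤ |((m - k * n : ℤ) : ℝ) + τ| := by
    have ha : m - k * n ≠ 0 := fun h => hm ⟨k, by linarith⟩
    have hb : m - k * n ≠ -1 := fun h => hm1 ⟨k, by linarith⟩
    rcases lt_or_ge (m - k * n) 0 with h | h
    · have : m - k * n ≤ -2 := by omega
      have h' : ((m - k * n : ℤ) : ℝ) ≤ -2 := by exact_mod_cast this
      rw [le_abs]; right; linarith [hτ.2]
    · have : 1 ≤ m - k * n := by omega
      have h' : (1 : ℝ) ≤ ((m - k * n : ℤ) : ℝ) := by exact_mod_cast this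
      rw [le_abs]; left; linarith [hτ.1]
  rw [h1, abs_mul, abs_of_pos (by positivity : 0 < 2 * π / (n : ℝ))]
  have h3 : (n : ℝ) / (2 * π) * (2 * π / n * |((m - k * n : ℤ) : ℝ) + τ|) =
    |((m - k * n : ℤ) : ℝ) + τ| := by field_simp
  rw [h3]
  exact max_eq_left (by linarith)

/-- A Lipschitz function, as an element of `W^{1,∞}`. -/
noncomputable def LipCurve.ofLipschitz (f : AddCircle (2 * π) → EuclideanSpace ℝ (Fin d))
    (hf : ∃ K : ℝ≥0, LipschitzWith K f) : LipCurve d := ⟨f, hf⟩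

theorem LipCurve.ofLipschitz_apply (f : AddCircle (2 * π) → EuclideanSpace ℝ (Fin d))
    (hf : ∃ K : ℝ≥0, LipschitzWith K f) (x : AddCircle (2 * π)) :
    LipCurve.ofLipschitz f hf x = f x := rfl

/-- The Lipschitz curve `∑ i, tent (θ - 2πi/n) z_i`. -/
noncomputable def tentCurve (n : ℕ) (z : ℕ → EuclideanSpace ℝ (Fin d)) : LipCurve d :=
  ∑ j ∈ Finset.range n, LipCurve.ofLipschitz (fun x => tent n (x - (gridNode n j : ℝ)) • z j) (by
    obtain ⟨K, hK⟩ := exists_lipschitzWith_tent n (gridNode n j : ℝ)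
    exact ⟨‖(ContinuousLinearMap.toSpanSingleton ℝ (z j))‖₊ * K,
      (ContinuousLinearMap.toSpanSingleton ℝ (z j)).lipschitz.comp hK⟩)

theorem tentCurve_apply (n : ℕ) (z : ℕ → EuclideanSpace ℝ (Fin d)) (x : AddCircle (2 * π)) :
    tentCurve n z x = ∑ j ∈ Finset.range n, tent n (x - (gridNode n j : ℝ)) • z j := by
  rw [← LipCurve.evalL_apply, tentCurve, map_sum]
  simp only [LipCurve.evalL_apply, LipCurve.ofLipschitz_apply]

/-- Between two nodes the curve interpolates linearly. -/
theorem tentCurve_lift {n : ℕ} (hn : 2 ≤ n) {z : ℕ → EuclideanSpace ℝ (Fin d)} (hz : z n = z 0)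
    {i : ℕ} (hi : i < n) {τ : ℝ} (hτ : τ ∈ Icc (0 : ℝ) 1) :
    (tentCurve n z).lift (2 * π * (i + τ) / n) = (1 - τ) • z i + τ • z (i + 1) := by
  have hn' : (0 : ℝ) < n := by exact_mod_cast (by omega : 0 < n)
  have hpi := Real.pi_pos
  -- the index of the right end point, modulo `n`
  obtain ⟨j₁, hj₁, hj₁z, q, hq⟩ : ∃ j₁ < n, z j₁ = z (i + 1) ∧ ∃ q : ℤ, (i : ℤ) + 1 - j₁ = q * n := by
    rcases Nat.lt_or_ge (i + 1) n with h | h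
    · exact ⟨i + 1, h, rfl, 0, by push_cast; ring⟩
    · have : i + 1 = n := by omega
      refine ⟨0, by omega, by rw [this, hz], 1, ?_⟩
      push_cast; omega
  have hval : ∀ j : ℕ, ((2 * π * (i + τ) / n : ℝ) : AddCircle (2 * π)) - (gridNode n j : ℝ) =
      ((2 * π * (((i - j : ℤ) : ℝ) + τ) / n : ℝ) : AddCircle (2 * π)) := by
    intro j
    rw [← AddCircle.coe_sub]
    congr 1
    rw [gridNode]
    push_cast
    ring
  have hne : i ≠ j₁ := by
    rintro rfl
    have h1 : (1 : ℤ) = q * n := by linarith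
    have h2 : (n : ℤ) ∣ 1 := ⟨q, by linarith⟩
    have := Int.le_of_dvd one_pos h2
    omega
  rw [LipCurve.lift, tentCurve_apply]
  rw [Finset.sum_eq_add i j₁ hne]
  · congr 1
    · rw [hval i]
      simp only [sub_self, Int.cast_zero, zero_add]
      rw [tent_of_abs_le hn (by rw [abs_of_nonneg hτ.1]; exact hτ.2), abs_of_nonneg hτ.1]
    · rw [hval j₁, hj₁z]
      have h1 : ((2 * π * (((i - j₁ : ℤ) : ℝ) + τ) / n : ℝ) : AddCircle (2 * π)) =
          ((2 * π * (τ - 1) / n : ℝ) : AddCircle (2 * π)) := by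
        have hq' : (i : ℝ) + 1 - j₁ = q * n := by exact_mod_cast hq
        have h2 : 2 * π * (((i - j₁ : ℤ) : ℝ) + τ) / n = 2 * π * (τ - 1) / n + q * (2 * π) := by
          have : (((i - j₁ : ℤ) : ℝ) + τ) = (τ - 1) + q * n := by push_cast; linarith
          rw [this]; field_simp
        rw [h2, AddCircle.coe_add, ← zsmul_eq_mul, AddCircle.coe_zsmul, AddCircle.coe_period,
          smul_zero, add_zero]
      rw [h1, tent_of_abs_le hn (by rw [abs_le]; constructor <;> linarith [hτ.1, hτ.2]),
        abs_of_nonpos (by linarith [hτ.2])]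
      congr 1
      ring
  · rintro j hj ⟨hji, hjj⟩
    rw [Finset.mem_range] at hj
    rw [hval j, tent_eq_zero (by omega) ?_ ?_ hτ, zero_smul]
    · intro h
      have := Int.eq_zero_of_abs_lt_dvd h (by rw [abs_lt]; constructor <;> omega)
      omega
    · intro h
      have h2 : (n : ℤ) ∣ (j₁ : ℤ) - j := by
        have : (j₁ : ℤ) - j = (i - j + 1) - q * n := by linarith
        rw [this]
        exact dvd_sub h ⟨q, by ring⟩
      have := Int.eq_zero_of_abs_lt_dvd h2 (by rw [abs_lt]; constructor <;> omega)
      omega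
  · intro h; exact absurd (Finset.mem_range.2 hi) h
  · intro h; exact absurd (Finset.mem_range.2 hj₁) h

/-- Every family of slopes with sum zero is the family of slopes of a piecewise linear curve. -/
theorem exists_mem_plSubmodule_slopes {n : ℕ} (hn : 1 ≤ n)
    (y : Fin n → EuclideanSpace ℝ (Fin d)) (hy : ∑ i, y i = 0) :
    ∃ c ∈ plSubmodule n d, slopes n c = y := by
  rcases hn.eq_or_lt with rfl | hn2
  · refine ⟨0, zero_mem _, ?_⟩
    ext1 i
    have : y i = 0 := by simpa [Subsingleton.elim i 0] using hy
    rw [this, map_zero]; rfl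
  have hn' : (0 : ℝ) < n := by exact_mod_cast (by omega : 0 < n)
  have hpi := Real.pi_pos
  -- the values at the nodes
  set y' : ℕ → EuclideanSpace ℝ (Fin d) := fun i => if h : i < n then y ⟨i, h⟩ else 0 with hy'
  set z : ℕ → EuclideanSpace ℝ (Fin d) := fun i =>
    (2 * π / n) • ∑ j ∈ Finset.range i, y' j with hz
  have hzn : z n = z 0 := by
    have h1 : ∑ j ∈ Finset.range n, y' j = 0 := by
      rw [← Fin.sum_univ_eq_sum_range, ← hy]
      exact Finset.sum_congr rfl fun i _ => by simp [hy']
    simp [hz, h1]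
  set c := tentCurve n z with hc
  -- subtract the mean
  set m : EuclideanSpace ℝ (Fin d) := (2 * π)⁻¹ • ∫ θ in (0 : ℝ)..2 * π, c.lift θ with hm
  let c₁ : LipCurve d := c - LipCurve.ofLipschitz (fun _ => m) ⟨0, LipschitzWith.const m⟩
  have hlift : ∀ θ, c₁.lift θ = c.lift θ - m := fun θ => rfl
  have hc₁ : c₁ ∈ LipCurve₀ d := by
    change ∫ θ in (0 : ℝ)..2 * π, c₁.lift θ = 0
    simp only [hlift]
    rw [intervalIntegral.integral_sub (c.continuous_lift.intervalIntegrable _ _)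
      intervalIntegrable_const, intervalIntegral.integral_const, hm, sub_zero, smul_smul,
      mul_inv_cancel₀ Real.two_pi_pos.ne', one_smul, sub_self]
  refine ⟨⟨c₁, hc₁⟩, ?_, ?_⟩
  · intro i hi
    refine ⟨z i - (i : ℝ) • (z (i + 1) - z i) - m, (n / (2 * π)) • (z (i + 1) - z i),
      fun θ hθ => ?_⟩
    change c₁.lift θ = _
    set τ : ℝ := n / (2 * π) * θ - i with hτ
    have hθτ : θ = 2 * π * (i + τ) / n := by rw [hτ]; field_simp; ring
    have hτ' : τ ∈ Icc (0 : ℝ) 1 := by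
      have h1 := hθ.1
      have h2 := hθ.2
      rw [hθτ] at h1 h2
      rw [div_le_div_iff_of_pos_right hn', mul_le_mul_iff_right₀ Real.two_pi_pos] at h1 h2
      constructor <;> linarith
    have h3 := tentCurve_lift hn2 hzn hi hτ'
    rw [← hθτ] at h3
    rw [hlift, h3, smul_smul θ, mul_comm θ, show (n : ℝ) / (2 * π) * θ = i + τ by rw [hτ]; ring]
    clear_value z
    module
  · ext1 i
    have e1 : c.lift (gridNode n i) = z i := by
      have := tentCurve_lift hn2 hzn i.2 (τ := 0) (by simp)
      simpa [gridNode] using this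
    have e2 : c.lift (gridNode n (i + 1)) = z (i + 1) := by
      have := tentCurve_lift hn2 hzn i.2 (τ := 1) (by simp)
      simpa [gridNode] using this
    rw [slopes_apply]
    change (_ : ℝ) • (c₁.lift _ - c₁.lift _) = _
    rw [hlift, hlift, sub_sub_sub_cancel_right, e1, e2]
    have e3 : z (i + 1) - z i = (2 * π / n) • y i := by
      simp only [hz]
      rw [← smul_sub, Finset.sum_range_succ, add_sub_cancel_left]
      simp [hy']
    rw [e3, smul_smul, show (n : ℝ) / (2 * π) * (2 * π / n) = 1 by field_simp, one_smul]

theorem eq_zero_of_slopes_eq_zero {n : ℕ} (hn : 1 ≤ n) {c : LipCurve₀ d}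
    (hc : c ∈ plSubmodule n d) (h : slopes n c = 0) : c = 0 := by
  refine eq_zero_of_dθ₀_ae_eq_zero ?_
  filter_upwards [ae_exists_mem_Ioo_gridNode hn] with θ ⟨i, hi⟩
  rw [dθ₀_eq_slopes hn hc i hi, h]
  rfl

/-- Summation of the slopes. -/
noncomputable def slopeSum (n d : ℕ) :
    (Fin n → EuclideanSpace ℝ (Fin d)) →ₗ[ℝ] EuclideanSpace ℝ (Fin d) :=
  ∑ i, LinearMap.proj i

theorem slopeSum_apply {n : ℕ} (y : Fin n → EuclideanSpace ℝ (Fin d)) :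
    slopeSum n d y = ∑ i, y i := by
  simp [slopeSum]

/-- The slopes of piecewise linear curves. -/
noncomputable def plSlopes (n d : ℕ) : plSubmodule n d →ₗ[ℝ] (Fin n → EuclideanSpace ℝ (Fin d)) :=
  (slopes n).toLinearMap ∘ₗ (plSubmodule n d).subtype

theorem plSlopes_apply {n : ℕ} (c : plSubmodule n d) :
    plSlopes n d c = slopes n (c : LipCurve₀ d) := rfl

theorem plSlopes_injective {n : ℕ} (hn : 1 ≤ n) : Function.Injective (plSlopes n d) := by
  refine (injective_iff_map_eq_zero _).2 fun c hc => ?_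
  exact Subtype.ext (eq_zero_of_slopes_eq_zero hn c.2 hc)

theorem range_plSlopes {n : ℕ} (hn : 1 ≤ n) :
    LinearMap.range (plSlopes n d) = LinearMap.ker (slopeSum n d) := by
  ext y
  rw [LinearMap.mem_range, LinearMap.mem_ker, slopeSum_apply]
  constructor
  · rintro ⟨c, rfl⟩
    simpa only [plSlopes_apply] using sum_slopes hn (c : LipCurve₀ d)
  · intro hy
    obtain ⟨c, hc, h⟩ := exists_mem_plSubmodule_slopes hn y hy
    exact ⟨⟨c, hc⟩, (plSlopes_apply _).trans h⟩

theorem finiteDimensional_plSubmodule {n : ℕ} (hn : 1 ≤ n) :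
    FiniteDimensional ℝ (plSubmodule n d) :=
  FiniteDimensional.of_injective _ (plSlopes_injective hn)

theorem finrank_plSubmodule {n : ℕ} (hn : 1 ≤ n) :
    Module.finrank ℝ (plSubmodule n d) = (n - 1) * d := by
  have h1 := (LinearEquiv.ofInjective _ (plSlopes_injective (d := d) hn)).finrank_eq
  rw [range_plSlopes hn] at h1
  have h2 := LinearMap.finrank_range_add_finrank_ker (slopeSum n d)
  have h3 : LinearMap.range (slopeSum n d) = ⊤ := by
    rw [LinearMap.range_eq_top]
    intro v
    refine ⟨Pi.single ⟨0, hn⟩ v, ?_⟩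
    rw [slopeSum_apply, Finset.sum_pi_single']
    simp
  rw [h3, finrank_top, Module.finrank_pi_fintype] at h2
  simp only [finrank_euclideanSpace, Fintype.card_fin, Finset.sum_const, Finset.card_univ,
    smul_eq_mul] at h2
  rw [h1, Nat.sub_mul, one_mul]
  omega

/-- Reconstruction of piecewise linear curves from their slopes. -/
theorem exists_reconstruction {n : ℕ} (hn : 1 ≤ n) :
    ∃ R : (Fin n → EuclideanSpace ℝ (Fin d)) →L[ℝ] plSubmodule n d,
      (∀ c : plSubmodule n d, R (slopes n c) = c) ∧
      ∀ y : Fin n → EuclideanSpace ℝ (Fin d), ∑ i, y i = 0 → slopes n (R y : LipCurve₀ d) = y := by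
  obtain ⟨R, hR⟩ := (plSlopes n d).exists_leftInverse_of_injective
    (LinearMap.ker_eq_bot.2 (plSlopes_injective hn))
  have hR' : ∀ c, R (plSlopes n d c) = c := fun c => LinearMap.congr_fun hR c
  refine ⟨LinearMap.toContinuousLinearMap R, hR', fun y hy => ?_⟩
  have h : y ∈ LinearMap.range (plSlopes n d) := by
    rw [range_plSlopes hn, LinearMap.mem_ker, slopeSum_apply, hy]
  obtain ⟨c, rfl⟩ := h
  exact congrArg (plSlopes n d) (hR' c)

end Interpolation

/-! ### The geodesic equation on piecewise linear curves -/

section PiecewiseLinearGeodesics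

variable {d : ℕ}

/-- Piecewise linear interpolation at the nodes is a continuous projection onto the piecewise linear
curves; it preserves the mean slopes. -/
theorem exists_plProjection {n : ℕ} (hn : 1 ≤ n) :
    ∃ P : LipCurve₀ d →L[ℝ] LipCurve₀ d, (∀ c, P c ∈ plSubmodule n d) ∧
      (∀ c ∈ plSubmodule n d, P c = c) ∧ ∀ c, slopes n (P c) = slopes n c := by
  obtain ⟨R, hR1, hR2⟩ := exists_reconstruction (d := d) hn
  refine ⟨(plSubmodule n d).subtypeL.comp (R.comp (slopes n)), fun c => (R (slopes n c)).2,
    fun c hc => ?_, fun c => hR2 _ (sum_slopes hn c)⟩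
  exact congrArg Subtype.val (hR1 ⟨c, hc⟩)

theorem deriv_mem_plSubmodule {n : ℕ} (hn : 1 ≤ n) {σ : ℝ → LipCurve₀ d} {σ' : LipCurve₀ d} {t : ℝ}
    (hσ : HasDerivAt σ σ' t) (hmem : ∀ᶠ s in 𝓝 t, σ s ∈ plSubmodule n d) :
    σ' ∈ plSubmodule n d := by
  obtain ⟨P, hP1, hP2, -⟩ := exists_plProjection (d := d) hn
  have h1 : HasDerivAt (fun s => P (σ s)) (P σ') t := P.hasFDerivAt.comp_hasDerivAt t hσ
  have h2 : HasDerivAt σ (P σ') t :=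
    h1.congr_of_eventuallyEq (hmem.mono fun s hs => (hP2 _ hs).symm)
  rw [hσ.unique h2]
  exact hP1 _

theorem mem_image_plImmersions {n : ℕ} {c : LipCurve₀ d} :
    c ∈ Subtype.val '' PLImmersions₀ n d ↔ c ∈ Immersions₀ d ∧ c ∈ plSubmodule n d := by
  constructor
  · rintro ⟨c, hc, rfl⟩
    exact ⟨c.2, hc⟩
  · rintro ⟨h1, h2⟩
    exact ⟨⟨c, h1⟩, h2, rfl⟩

theorem integrable_inner_elDensity {c h z k : LipCurve₀ d} (hc : c ∈ Immersions₀ d) (a b : ℝ) :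
    Integrable (fun θ => inner ℝ (elDensity (dθ₀ c θ) (dθ₀ h θ) (dθ₀ z θ) a b) (dθ₀ k θ))
      circleMeasure :=
  integrable_dθ₄ (c, h, z, k) hc
    (g := fun y => inner ℝ (elDensity y.1 y.2.1 y.2.2.1 a b) y.2.2.2)
    (fun y hy => by
      have : ‖y.1‖ ≠ 0 := norm_ne_zero_iff.2 hy
      unfold elDensity
      fun_prop (disch := assumption)) (by unfold elDensity; fun_prop)

theorem integral_inner_elDensity_eq_sum {n : ℕ} (hn : 1 ≤ n) {c h z : LipCurve₀ d}
    (hc : c ∈ Immersions₀ d) (hcP : c ∈ plSubmodule n d) (hhP : h ∈ plSubmodule n d)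
    (hzP : z ∈ plSubmodule n d) (a b : ℝ) (k : LipCurve₀ d) :
    ∫ θ, inner ℝ (elDensity (dθ₀ c θ) (dθ₀ h θ) (dθ₀ z θ) a b) (dθ₀ k θ) ∂circleMeasure =
      2 * π / n * ∑ i, inner ℝ (elDensity (slopes n c i) (slopes n h i) (slopes n z i) a b)
        (slopes n k i) := by
  refine integral_inner_of_gridwise_const hn (fun i θ hθ => ?_) k
    (integrable_inner_elDensity hc a b)
  rw [dθ₀_eq_slopes hn hcP i hθ, dθ₀_eq_slopes hn hhP i hθ, dθ₀_eq_slopes hn hzP i hθ]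

/-- Along piecewise linear curves, the Euler–Lagrange expression only sees the mean slopes of the
test direction. -/
theorem eulerLagrange_congr_slopes {n : ℕ} (hn : 1 ≤ n) {c h z : LipCurve₀ d}
    (hc : c ∈ Immersions₀ d) (hcP : c ∈ plSubmodule n d) (hhP : h ∈ plSubmodule n d)
    (hzP : z ∈ plSubmodule n d) {k k' : LipCurve₀ d} (hk : slopes n k = slopes n k') :
    eulerLagrange c h z k = eulerLagrange c h z k' := by
  rw [eulerLagrange_eq_integral hc, eulerLagrange_eq_integral hc,
    integral_inner_elDensity_eq_sum hn hc hcP hhP hzP,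
    integral_inner_elDensity_eq_sum hn hc hcP hhP hzP, hk]

/-- Geodesics of the submanifold of piecewise linear curves are geodesics of the ambient space. -/
theorem isGeodesic_of_isGeodesic_plImmersions {n : ℕ} (hn : 1 ≤ n) {I : Set ℝ}
    {γ : ℝ → LipCurve₀ d} (hγ : IsGeodesic metricG₀ (Subtype.val '' PLImmersions₀ n d) I γ) :
    IsGeodesic metricG₀ (Immersions₀ d : Set (LipCurve₀ d)) I γ := by
  have hS : Subtype.val '' PLImmersions₀ n d ⊆ (Immersions₀ d : Set (LipCurve₀ d)) :=
    fun c hc => (mem_image_plImmersions.1 hc).1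
  obtain ⟨P, hP1, -, hP3⟩ := exists_plProjection (d := d) hn
  obtain ⟨hγd, hγ'⟩ := hγ.smooth.hasDerivAt_and_deriv hγ.isOpen
  obtain ⟨hγ'd, -⟩ := hγ'.hasDerivAt_and_deriv hγ.isOpen
  have h0 : ∀ t ∈ I, γ t ∈ plSubmodule n d := fun t ht => (mem_image_plImmersions.1 (hγ.mem t ht)).2
  have h1 : ∀ t ∈ I, deriv γ t ∈ plSubmodule n d := fun t ht =>
    deriv_mem_plSubmodule hn (hγd t ht) (by
      filter_upwards [hγ.isOpen.mem_nhds ht] with s hs using h0 s hs)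
  have h2 : ∀ t ∈ I, deriv (deriv γ) t ∈ plSubmodule n d := fun t ht =>
    deriv_mem_plSubmodule hn (hγ'd t ht) (by
      filter_upwards [hγ.isOpen.mem_nhds ht] with s hs using h1 s hs)
  refine isGeodesic_of_eulerLagrange hγ.isOpen hγ.ordConnected hγ.smooth
    (fun t ht => hS (hγ.mem t ht)) fun t ht k => ?_
  rw [eulerLagrange_congr_slopes hn (hS (hγ.mem t ht)) (h0 t ht) (h1 t ht) (h2 t ht)
    (hP3 k).symm]
  refine hγ.eulerLagrange_eq_zero hS (fun c hc r hr => ?_) ht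
  exact mem_image_plImmersions.2 ⟨hr, add_mem (mem_image_plImmersions.1 hc).2
    (Submodule.smul_mem _ _ (hP1 k))⟩

/-! ### Existence of piecewise linear geodesics -/

theorem slopes_ne_zero {n : ℕ} (hn : 1 ≤ n) {c : LipCurve₀ d} (hc : c ∈ Immersions₀ d)
    (hcP : c ∈ plSubmodule n d) (i : Fin n) : slopes n c i ≠ 0 := by
  obtain ⟨ε, hε, h⟩ := mem_immersions_iff.1 hc
  intro h0
  have h1 : ∀ᵐ θ : ℝ, θ ∉ Ioo (gridNode n i) (gridNode n (i + 1)) := by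
    filter_upwards [h] with θ h2 h3
    rw [dθ₀_eq_slopes hn hcP i h3, h0, norm_zero] at h2
    linarith
  have h2 : volume (Ioo (gridNode n i) (gridNode n (i + 1))) = 0 := by
    rw [ae_iff] at h1
    simpa only [not_not, ofPred_mem_eq] using h1
  rw [Real.volume_Ioo, ENNReal.ofReal_eq_zero] at h2
  linarith [gridNode_lt_succ hn i]

variable {n : ℕ}

/-- The total length of a family of slopes, up to the mesh size. -/
noncomputable def plLen (u : Fin n → EuclideanSpace ℝ (Fin d)) : ℝ := ∑ i, ‖u i‖

/-- The quantity `(∫ |c_tθ|² / |c_θ| dθ) / ℓ` in terms of the slopes. -/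
noncomputable def plA (u v : Fin n → EuclideanSpace ℝ (Fin d)) : ℝ :=
  (∑ i, ‖u i‖⁻¹ * inner ℝ (v i) (v i)) / plLen u

/-- The quantity `ℓ_t / ℓ` in terms of the slopes. -/
noncomputable def plB (u v : Fin n → EuclideanSpace ℝ (Fin d)) : ℝ :=
  (∑ i, ‖u i‖⁻¹ * inner ℝ (u i) (v i)) / plLen u

/-- The Lagrange multiplier of the constraint that the slopes sum to zero. -/
noncomputable def plMultiplier (u v : Fin n → EuclideanSpace ℝ (Fin d)) :
    EuclideanSpace ℝ (Fin d) :=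
  -(plLen u)⁻¹ • ∑ i, ‖u i‖ • elDensity (u i) (v i) 0 (plA u v) (plB u v)

/-- The geodesic acceleration in terms of the slopes: the Euler–Lagrange density is made equal to a
constant, namely to minus the Lagrange multiplier. -/
noncomputable def plAcceleration (u v : Fin n → EuclideanSpace ℝ (Fin d)) :
    Fin n → EuclideanSpace ℝ (Fin d) := fun i =>
  ‖u i‖ • (elDensity (u i) (v i) 0 (plA u v) (plB u v) + plMultiplier u v)

theorem plLen_pos (hn : 1 ≤ n) {u : Fin n → EuclideanSpace ℝ (Fin d)} (hu : ∀ i, u i ≠ 0) :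
    0 < plLen u :=
  Finset.sum_pos (fun i _ => norm_pos_iff.2 (hu i)) ⟨⟨0, hn⟩, Finset.mem_univ _⟩

theorem sum_plAcceleration (hn : 1 ≤ n) {u v : Fin n → EuclideanSpace ℝ (Fin d)}
    (hu : ∀ i, u i ≠ 0) : ∑ i, plAcceleration u v i = 0 := by
  have h0 := (plLen_pos hn hu).ne'
  simp only [plAcceleration, smul_add, Finset.sum_add_distrib]
  rw [← Finset.sum_smul]
  change _ + plLen u • plMultiplier u v = 0
  rw [plMultiplier, smul_smul, mul_neg, mul_inv_cancel₀ h0, neg_smul, one_smul, add_neg_cancel]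

theorem elDensity_plAcceleration {u v : Fin n → EuclideanSpace ℝ (Fin d)} (hu : ∀ i, u i ≠ 0)
    (i : Fin n) : elDensity (u i) (v i) (plAcceleration u v i) (plA u v) (plB u v) =
      -plMultiplier u v := by
  have h0 : ‖u i‖ ≠ 0 := norm_ne_zero_iff.2 (hu i)
  have h1 : ∀ z : EuclideanSpace ℝ (Fin d), elDensity (u i) (v i) z (plA u v) (plB u v) =
      elDensity (u i) (v i) 0 (plA u v) (plB u v) - ‖u i‖⁻¹ • z := fun z => by
    simp [elDensity]
  rw [h1, plAcceleration, smul_smul, inv_mul_cancel₀ h0, one_smul]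
  abel

theorem contDiffAt_elDensity {p : EuclideanSpace ℝ (Fin d) × EuclideanSpace ℝ (Fin d) ×
    EuclideanSpace ℝ (Fin d) × ℝ × ℝ} (hp : p.1 ≠ 0) :
    ContDiffAt ℝ ∞ (fun p : EuclideanSpace ℝ (Fin d) × EuclideanSpace ℝ (Fin d) ×
      EuclideanSpace ℝ (Fin d) × ℝ × ℝ => elDensity p.1 p.2.1 p.2.2.1 p.2.2.2.1 p.2.2.2.2) p := by
  have h1 : ContDiffAt ℝ ∞ (fun p : EuclideanSpace ℝ (Fin d) × EuclideanSpace ℝ (Fin d) ×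
      EuclideanSpace ℝ (Fin d) × ℝ × ℝ => ‖p.1‖⁻¹) p :=
    (contDiffAt_fst.norm ℝ hp).inv (norm_ne_zero_iff.2 hp)
  have h2 : ContDiffAt ℝ ∞ (fun p : EuclideanSpace ℝ (Fin d) × EuclideanSpace ℝ (Fin d) ×
      EuclideanSpace ℝ (Fin d) × ℝ × ℝ => p.2.1) p := by fun_prop
  have h3 : ContDiffAt ℝ ∞ (fun p : EuclideanSpace ℝ (Fin d) × EuclideanSpace ℝ (Fin d) ×
      EuclideanSpace ℝ (Fin d) × ℝ × ℝ => p.2.2.1) p := by fun_prop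
  have h4 : ContDiffAt ℝ ∞ (fun p : EuclideanSpace ℝ (Fin d) × EuclideanSpace ℝ (Fin d) ×
      EuclideanSpace ℝ (Fin d) × ℝ × ℝ => p.2.2.2.1) p := by fun_prop
  have h5 : ContDiffAt ℝ ∞ (fun p : EuclideanSpace ℝ (Fin d) × EuclideanSpace ℝ (Fin d) ×
      EuclideanSpace ℝ (Fin d) × ℝ × ℝ => p.2.2.2.2) p := by fun_prop
  exact (((((contDiffAt_const.mul ((h1.pow 3).mul (h2.inner ℝ h2))).add
    (contDiffAt_const.mul (h4.mul h1))).neg).smul contDiffAt_fst).add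
    ((((h1.pow 3).mul (contDiffAt_fst.inner ℝ h2)).add (h5.mul h1)).smul h2)).sub (h1.smul h3)

theorem contDiffAt_plAcceleration (hn : 1 ≤ n) {p : (Fin n → EuclideanSpace ℝ (Fin d)) ×
    (Fin n → EuclideanSpace ℝ (Fin d))} (hp : ∀ i, p.1 i ≠ 0) :
    ContDiffAt ℝ ∞ (fun p : (Fin n → EuclideanSpace ℝ (Fin d)) ×
      (Fin n → EuclideanSpace ℝ (Fin d)) => plAcceleration p.1 p.2) p := by
  have hu : ∀ i, ContDiffAt ℝ ∞ (fun p : (Fin n → EuclideanSpace ℝ (Fin d)) ×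
      (Fin n → EuclideanSpace ℝ (Fin d)) => p.1 i) p := fun i => by fun_prop
  have hv : ∀ i, ContDiffAt ℝ ∞ (fun p : (Fin n → EuclideanSpace ℝ (Fin d)) ×
      (Fin n → EuclideanSpace ℝ (Fin d)) => p.2 i) p := fun i => by fun_prop
  have h1 : ∀ i, ContDiffAt ℝ ∞ (fun p : (Fin n → EuclideanSpace ℝ (Fin d)) ×
      (Fin n → EuclideanSpace ℝ (Fin d)) => ‖p.1 i‖) p := fun i => (hu i).norm ℝ (hp i)
  have h2 : ∀ i, ContDiffAt ℝ ∞ (fun p : (Fin n → EuclideanSpace ℝ (Fin d)) ×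
      (Fin n → EuclideanSpace ℝ (Fin d)) => ‖p.1 i‖⁻¹) p := fun i =>
    (h1 i).inv (norm_ne_zero_iff.2 (hp i))
  have h3 : ContDiffAt ℝ ∞ (fun p : (Fin n → EuclideanSpace ℝ (Fin d)) ×
      (Fin n → EuclideanSpace ℝ (Fin d)) => plLen p.1) p :=
    ContDiffAt.sum fun i _ => h1 i
  have h3' := h3.inv (plLen_pos hn hp).ne'
  have h4 : ContDiffAt ℝ ∞ (fun p : (Fin n → EuclideanSpace ℝ (Fin d)) ×
      (Fin n → EuclideanSpace ℝ (Fin d)) => plA p.1 p.2) p :=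
    (ContDiffAt.sum fun i _ => (h2 i).mul ((hv i).inner ℝ (hv i))).mul h3'
  have h5 : ContDiffAt ℝ ∞ (fun p : (Fin n → EuclideanSpace ℝ (Fin d)) ×
      (Fin n → EuclideanSpace ℝ (Fin d)) => plB p.1 p.2) p :=
    (ContDiffAt.sum fun i _ => (h2 i).mul ((hu i).inner ℝ (hv i))).mul h3'
  have h6 : ∀ i, ContDiffAt ℝ ∞ (fun p : (Fin n → EuclideanSpace ℝ (Fin d)) ×
      (Fin n → EuclideanSpace ℝ (Fin d)) =>
        elDensity (p.1 i) (p.2 i) 0 (plA p.1 p.2) (plB p.1 p.2)) p := fun i =>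
    (contDiffAt_elDensity (p := (p.1 i, p.2 i, 0, plA p.1 p.2, plB p.1 p.2)) (hp i)).comp
      (f := fun p : (Fin n → EuclideanSpace ℝ (Fin d)) × (Fin n → EuclideanSpace ℝ (Fin d)) =>
        (p.1 i, p.2 i, (0 : EuclideanSpace ℝ (Fin d)), plA p.1 p.2, plB p.1 p.2)) p
      ((hu i).prodMk ((hv i).prodMk (contDiffAt_const.prodMk (h4.prodMk h5))))
  have h7 : ContDiffAt ℝ ∞ (fun p : (Fin n → EuclideanSpace ℝ (Fin d)) ×
      (Fin n → EuclideanSpace ℝ (Fin d)) => plMultiplier p.1 p.2) p :=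
    h3'.neg.smul (ContDiffAt.sum fun i _ => (h1 i).smul (h6 i))
  exact contDiffAt_pi.2 fun i => (h1 i).smul ((h6 i).add h7)

/-- On piecewise linear curves the nonlocal coefficients of the Euler–Lagrange density are given by
the slopes; the mesh size cancels. -/
theorem nonlocal_coefficients_eq (hn : 1 ≤ n) {c h : LipCurve₀ d} (hc : c ∈ Immersions₀ d)
    (hcP : c ∈ plSubmodule n d) (hhP : h ∈ plSubmodule n d) :
    formI c h h / lenI c = plA (slopes n c) (slopes n h) ∧
      dlenI c h / lenI c = plB (slopes n c) (slopes n h) := by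
  have hn' : (0 : ℝ) < n := by exact_mod_cast hn
  have hpi := Real.pi_pos
  have hl : lenI c = 2 * π / n * plLen (slopes n c) :=
    integral_of_gridwise_const hn (y := fun i => ‖slopes n c i‖)
      (fun i θ hθ => by rw [dθ₀_eq_slopes hn hcP i hθ])
      (isEssBoundedEval_dθ₀.measurable c).norm.aestronglyMeasurable
  have hA : formI c h h = 2 * π / n * ∑ i, ‖slopes n c i‖⁻¹ *
      inner ℝ (slopes n h i) (slopes n h i) :=
    integral_of_gridwise_const hn (fun i θ hθ => by
      rw [dθ₀_eq_slopes hn hcP i hθ, dθ₀_eq_slopes hn hhP i hθ])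
      (integrable_formI hc).aestronglyMeasurable
  have hB : dlenI c h = 2 * π / n * ∑ i, ‖slopes n c i‖⁻¹ *
      inner ℝ (slopes n c i) (slopes n h i) :=
    integral_of_gridwise_const hn (fun i θ hθ => by
      rw [dθ₀_eq_slopes hn hcP i hθ, dθ₀_eq_slopes hn hhP i hθ])
      (integrable_formI hc).aestronglyMeasurable
  have h0 : 2 * π / (n : ℝ) ≠ 0 := by positivity
  rw [hl, hA, hB, mul_div_mul_left _ _ h0, mul_div_mul_left _ _ h0]
  exact ⟨rfl, rfl⟩

/-- A piecewise linear curve whose slopes move with the geodesic acceleration solves the weak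
Euler–Lagrange equation in all directions. -/
theorem eulerLagrange_eq_zero_of_plAcceleration (hn : 1 ≤ n) {c h z : LipCurve₀ d}
    (hc : c ∈ Immersions₀ d) (hcP : c ∈ plSubmodule n d) (hhP : h ∈ plSubmodule n d)
    (hzP : z ∈ plSubmodule n d) (hz : slopes n z = plAcceleration (slopes n c) (slopes n h))
    (k : LipCurve₀ d) : eulerLagrange c h z k = 0 := by
  have hu := slopes_ne_zero hn hc hcP
  rw [eulerLagrange_eq_integral hc, integral_inner_elDensity_eq_sum hn hc hcP hhP hzP,
    (nonlocal_coefficients_eq hn hc hcP hhP).1, (nonlocal_coefficients_eq hn hc hcP hhP).2, hz]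
  simp only [elDensity_plAcceleration hu]
  rw [← inner_sum, sum_slopes hn, inner_zero_right, mul_zero]

/-- Integral curves of a smooth vector field are smooth. -/
theorem contDiffOn_of_hasDerivAt {E : Type*} [NormedAddCommGroup E] [NormedSpace ℝ E] {V : E → E}
    {α : ℝ → E} {I : Set ℝ} (hI : IsOpen I) (hα : ∀ t ∈ I, HasDerivAt α (V (α t)) t)
    (hV : ∀ t ∈ I, ContDiffAt ℝ ∞ V (α t)) : ContDiffOn ℝ ∞ α I := by
  refine contDiffOn_infty.2 fun m => ?_
  induction m with
  | zero => exact contDiffOn_zero.2 fun t ht => (hα t ht).continuousAt.continuousWithinAt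
  | succ m ih =>
    push_cast
    refine (contDiffOn_succ_iff_deriv_of_isOpen hI).2
      ⟨fun t ht => (hα t ht).differentiableAt.differentiableWithinAt, by simp, ?_⟩
    have h1 : ContDiffOn ℝ m (fun t => V (α t)) I := fun t ht =>
      ((hV t ht).of_le (by exact_mod_cast le_top)).comp_contDiffWithinAt t (ih t ht)
    exact h1.congr fun t ht => (hα t ht).deriv

/-- Each tangent vector to the piecewise linear immersions is the initial velocity of a geodesic. -/
theorem exists_isGeodesic_of_mem_plSubmodule (hn : 1 ≤ n) {x v : LipCurve₀ d}
    (hx : x ∈ Immersions₀ d) (hxP : x ∈ plSubmodule n d) (hvP : v ∈ plSubmodule n d) :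
    ∃ δ > 0, ∃ γ : ℝ → LipCurve₀ d,
      IsGeodesic metricG₀ (Immersions₀ d : Set (LipCurve₀ d)) (Ioo (-δ) δ) γ ∧ γ 0 = x ∧
        deriv γ 0 = v := by
  obtain ⟨R₀, hR1, hR2⟩ := exists_reconstruction (d := d) hn
  set R : (Fin n → EuclideanSpace ℝ (Fin d)) →L[ℝ] LipCurve₀ d :=
    (plSubmodule n d).subtypeL.comp R₀ with hRdef
  have hRP : ∀ y, R y ∈ plSubmodule n d := fun y => (R₀ y).2
  have hRid : ∀ c ∈ plSubmodule n d, R (slopes n c) = c := fun c hc =>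
    congrArg Subtype.val (hR1 ⟨c, hc⟩)
  have hR : ∀ y : Fin n → EuclideanSpace ℝ (Fin d), ∑ i, y i = 0 → slopes n (R y) = y := hR2
  -- the second order equation as a vector field on the space of slopes and their velocities
  set V : (Fin n → EuclideanSpace ℝ (Fin d)) × (Fin n → EuclideanSpace ℝ (Fin d)) →
      (Fin n → EuclideanSpace ℝ (Fin d)) × (Fin n → EuclideanSpace ℝ (Fin d)) :=
    fun q => (q.2, plAcceleration (slopes n (R q.1)) (slopes n (R q.2))) with hVdef
  have hV : ∀ q : (Fin n → EuclideanSpace ℝ (Fin d)) × (Fin n → EuclideanSpace ℝ (Fin d)),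
      R q.1 ∈ Immersions₀ d → ContDiffAt ℝ ∞ V q := by
    intro q hq
    have h1 : ContDiffAt ℝ ∞ (fun q : (Fin n → EuclideanSpace ℝ (Fin d)) ×
        (Fin n → EuclideanSpace ℝ (Fin d)) => (slopes n (R q.1), slopes n (R q.2))) q :=
      (((slopes n).contDiff.comp (R.contDiff.comp contDiff_fst)).prodMk
        ((slopes n).contDiff.comp (R.contDiff.comp contDiff_snd))).contDiffAt
    have h2 := (contDiffAt_plAcceleration hn (p := (slopes n (R q.1), slopes n (R q.2)))
      (slopes_ne_zero hn hq (hRP _))).comp q h1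
    exact contDiffAt_snd.prodMk h2
  set q₀ : (Fin n → EuclideanSpace ℝ (Fin d)) × (Fin n → EuclideanSpace ℝ (Fin d)) :=
    (slopes n x, slopes n v) with hq₀
  have hx0 : R q₀.1 ∈ Immersions₀ d := by rw [hq₀, hRid x hxP]; exact hx
  obtain ⟨r, hr, ε, hε, H⟩ :=
    ((hV q₀ hx0).of_le (by exact_mod_cast le_top) :
      ContDiffAt ℝ 1 V q₀).exists_forall_mem_closedBall_exists_eq_forall_mem_Ioo_hasDerivAt 0
  obtain ⟨α, hα0, hα⟩ := H q₀ (Metric.mem_closedBall_self hr.le)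
  rw [zero_sub, zero_add] at hα
  -- restriction to a time interval on which the curves are immersed
  have hcont : ContinuousAt (fun t => R (α t).1) 0 :=
    R.continuous.continuousAt.comp
      (continuous_fst.continuousAt.comp (hα 0 ⟨by linarith, hε⟩).continuousAt)
  have hev : ∀ᶠ t in 𝓝 (0 : ℝ), R (α t).1 ∈ Immersions₀ d :=
    hcont.eventually ((Immersions₀ d).isOpen.mem_nhds (by simp only [hα0]; exact hx0))
  obtain ⟨δ', hδ', hmem⟩ := Metric.eventually_nhds_iff.1 hev
  set δ := min ε δ' with hδ
  have hδ0 : 0 < δ := lt_min hε hδ'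
  have hα1 : ∀ t ∈ Ioo (-δ) δ, HasDerivAt α (V (α t)) t := fun t ht =>
    hα t ⟨by linarith [ht.1, min_le_left ε δ'], ht.2.trans_le (min_le_left _ _)⟩
  have hmem1 : ∀ t ∈ Ioo (-δ) δ, R (α t).1 ∈ Immersions₀ d := fun t ht => hmem (by
    rw [Real.dist_eq, sub_zero, abs_lt]
    exact ⟨by linarith [ht.1, min_le_right ε δ'], ht.2.trans_le (min_le_right _ _)⟩)
  have hsm := contDiffOn_of_hasDerivAt isOpen_Ioo hα1 fun t ht => hV _ (hmem1 t ht)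
  set γ : ℝ → LipCurve₀ d := fun t => R (α t).1 with hγ
  have hd1 : ∀ t ∈ Ioo (-δ) δ, HasDerivAt γ (R (α t).2) t := fun t ht => by
    have h1 : HasDerivAt (fun t => (α t).1) (α t).2 t :=
      (hasFDerivAt_fst (p := α t)).comp_hasDerivAt t (hα1 t ht)
    exact R.hasFDerivAt.comp_hasDerivAt t h1
  have hd2 : ∀ t ∈ Ioo (-δ) δ, HasDerivAt (deriv γ)
      (R (plAcceleration (slopes n (R (α t).1)) (slopes n (R (α t).2)))) t := fun t ht => by
    have h1 : HasDerivAt (fun t => (α t).2)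
        (plAcceleration (slopes n (R (α t).1)) (slopes n (R (α t).2))) t :=
      (hasFDerivAt_snd (p := α t)).comp_hasDerivAt t (hα1 t ht)
    refine (R.hasFDerivAt.comp_hasDerivAt t h1).congr_of_eventuallyEq ?_
    filter_upwards [isOpen_Ioo.mem_nhds ht] with s hs using (hd1 s hs).deriv
  have h00 : (0 : ℝ) ∈ Ioo (-δ) δ := ⟨by linarith, hδ0⟩
  refine ⟨δ, hδ0, γ, isGeodesic_of_eulerLagrange isOpen_Ioo ordConnected_Ioo ?_ hmem1 ?_, ?_, ?_⟩
  · exact R.contDiff.comp_contDiffOn (contDiff_fst.comp_contDiffOn hsm)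
  · intro t ht k
    rw [(hd1 t ht).deriv, (hd2 t ht).deriv]
    exact eulerLagrange_eq_zero_of_plAcceleration hn (hmem1 t ht) (hRP _) (hRP _) (hRP _)
      (hR _ (sum_plAcceleration hn (slopes_ne_zero hn (hmem1 t ht) (hRP _)))) k
  · rw [hγ]; simp only [hα0, hq₀]
    exact hRid x hxP
  · rw [(hd1 0 h00).deriv, hα0]
    exact hRid v hvP

end PiecewiseLinearGeodesics

/-! ### Geodesics tangent to the piecewise linear curves -/

section Tangent

variable {d : ℕ}

theorem ae_dθ₀_sub (c k : LipCurve₀ d) :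
    ∀ᵐ θ ∂circleMeasure, dθ₀ (c - k) θ = dθ₀ c θ - dθ₀ k θ :=
  isEssBoundedEval_dθ₀.sub c k

theorem formI_self_nonneg (c h : LipCurve₀ d) : 0 ≤ formI c h h :=
  integral_nonneg fun _ => mul_nonneg (inv_nonneg.2 (norm_nonneg _)) real_inner_self_nonneg

theorem eq_zero_of_formI_self_eq_zero {c h : LipCurve₀ d} (hc : c ∈ Immersions₀ d)
    (h0 : formI c h h = 0) : h = 0 := by
  refine eq_zero_of_dθ₀_ae_eq_zero ?_
  have h1 := (integral_eq_zero_iff_of_nonneg (fun _ => mul_nonneg (inv_nonneg.2 (norm_nonneg _))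
    real_inner_self_nonneg) (integrable_formI hc)).1 h0
  obtain ⟨ε, hε, h2⟩ := mem_immersions_iff.1 hc
  filter_upwards [h1, ae_restrict_of_ae h2] with θ h3 h4
  have h5 : ‖dθ₀ c θ‖⁻¹ ≠ 0 := inv_ne_zero (by linarith : 0 < ‖dθ₀ c θ‖).ne'
  exact inner_self_eq_zero.1 ((mul_eq_zero.1 h3).resolve_left h5)

theorem two_mul_abs_formI_le {c : LipCurve₀ d} (hc : c ∈ Immersions₀ d) (h k : LipCurve₀ d) :
    2 * |formI c h k| ≤ formI c h h + formI c k k := by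
  have h1 : ‖formI c h k‖ ≤ ∫ θ, 1 / 2 * (‖dθ₀ c θ‖⁻¹ * inner ℝ (dθ₀ h θ) (dθ₀ h θ) +
      ‖dθ₀ c θ‖⁻¹ * inner ℝ (dθ₀ k θ) (dθ₀ k θ)) ∂circleMeasure := by
    refine norm_integral_le_of_norm_le (((integrable_formI hc).add (integrable_formI hc)).const_mul _)
      (Eventually.of_forall fun θ => ?_)
    have h2 := abs_real_inner_le_norm (dθ₀ h θ) (dθ₀ k θ)
    have h3 := two_mul_le_add_sq ‖dθ₀ h θ‖ ‖dθ₀ k θ‖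
    have h4 : 0 ≤ ‖dθ₀ c θ‖⁻¹ := inv_nonneg.2 (norm_nonneg _)
    rw [real_inner_self_eq_norm_sq, real_inner_self_eq_norm_sq, norm_mul, Real.norm_eq_abs,
      Real.norm_eq_abs, abs_of_nonneg h4]
    nlinarith
  rw [integral_const_mul, integral_add (integrable_formI hc) (integrable_formI hc),
    Real.norm_eq_abs] at h1
  change |formI c h k| ≤ 1 / 2 * (formI c h h + formI c k k) at h1
  linarith

theorem abs_dformI_le {c w : LipCurve₀ d} (hc : c ∈ Immersions₀ d) (h : LipCurve₀ d) {m R : ℝ}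
    (hm : 0 < m) (hmc : ∀ᵐ θ ∂circleMeasure, m ≤ ‖dθ₀ c θ‖)
    (hRw : ∀ᵐ θ ∂circleMeasure, ‖dθ₀ w θ‖ ≤ R) : |dformI c w h h| ≤ R / m * formI c h h := by
  have h1 : ‖dformI c w h h‖ ≤ ∫ θ, R / m * (‖dθ₀ c θ‖⁻¹ * inner ℝ (dθ₀ h θ) (dθ₀ h θ))
      ∂circleMeasure := by
    refine norm_integral_le_of_norm_le ((integrable_formI hc).const_mul _) ?_
    filter_upwards [hmc, hRw] with θ h2 h3
    have h4 := abs_real_inner_le_norm (dθ₀ c θ) (dθ₀ w θ)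
    have h5 : 0 < ‖dθ₀ c θ‖ := hm.trans_le h2
    rw [norm_neg, norm_mul, norm_mul, norm_pow, norm_inv, norm_norm, Real.norm_eq_abs,
      Real.norm_eq_abs, abs_of_nonneg (real_inner_self_nonneg (x := dθ₀ h θ)), ← mul_assoc]
    refine mul_le_mul_of_nonneg_right ?_ real_inner_self_nonneg
    calc ‖dθ₀ c θ‖⁻¹ ^ 3 * |inner ℝ (dθ₀ c θ) (dθ₀ w θ)|
        ≤ ‖dθ₀ c θ‖⁻¹ ^ 3 * (‖dθ₀ c θ‖ * ‖dθ₀ w θ‖) := by gcongr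
      _ = ‖dθ₀ w θ‖ / ‖dθ₀ c θ‖ * ‖dθ₀ c θ‖⁻¹ := by field_simp
      _ ≤ R / m * ‖dθ₀ c θ‖⁻¹ := by
        have : 0 ≤ R := (norm_nonneg _).trans h3
        gcongr
  rw [integral_const_mul] at h1
  exact h1

/-- The acceleration of the deviation `x` of a solution `c` of the geodesic equation from its
piecewise linear interpolation `p`, paired with the velocity `x'` of the deviation. The
Euler–Lagrange densities of `c` and `p` are both orthogonal to `x'`, the second one because it is
constant on the intervals of the grid. -/
theorem abs_formI_deviation_le {n : ℕ} (hn : 1 ≤ n) {c c' c'' p p' p'' : LipCurve₀ d}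
    (hc : c ∈ Immersions₀ d) (hp : p ∈ Immersions₀ d)
    (hEL : ∀ k, eulerLagrange c c' c'' k = 0)
    (hpP : p ∈ plSubmodule n d) (hp'P : p' ∈ plSubmodule n d) (hp''P : p'' ∈ plSubmodule n d)
    (hs : slopes n (c' - p') = 0) {C R : ℝ} (hC : 0 ≤ C)
    (hR : ∀ᵐ θ ∂circleMeasure, 0 < ‖dθ₀ p θ‖ ∧ ‖dθ₀ p θ‖ ≤ R)
    (hLip : ∀ᵐ θ ∂circleMeasure,
      ‖elDensity (dθ₀ c θ) (dθ₀ c' θ) (dθ₀ c'' θ) (formI c c' c' / lenI c) (dlenI c c' / lenI c) -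
        elDensity (dθ₀ p θ) (dθ₀ p' θ) (dθ₀ c'' θ) (formI c c' c' / lenI c) (dlenI c c' / lenI c)‖
        ≤ C * (‖dθ₀ (c - p) θ‖ + ‖dθ₀ (c' - p') θ‖)) :
    |formI p (c'' - p'') (c' - p')| ≤
      2 * C * R * (formI p (c' - p') (c' - p') + formI p (c - p) (c - p)) := by
  set a := formI c c' c' / lenI c with ha
  set b := dlenI c c' / lenI c with hb
  set x := c - p with hx
  set x' := c' - p' with hx'
  have e1 : ∫ θ, inner ℝ (elDensity (dθ₀ c θ) (dθ₀ c' θ) (dθ₀ c'' θ) a b) (dθ₀ x' θ)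
      ∂circleMeasure = 0 := by rw [← hEL x', eulerLagrange_eq_integral hc]
  have e2 : ∫ θ, inner ℝ (elDensity (dθ₀ p θ) (dθ₀ p' θ) (dθ₀ p'' θ) a b) (dθ₀ x' θ)
      ∂circleMeasure = 0 := by
    rw [integral_inner_elDensity_eq_sum hn hp hpP hp'P hp''P, hs]
    simp
  have i1 := integrable_inner_elDensity (h := c') (z := c'') (k := x') hc a b
  have i2 := integrable_inner_elDensity (h := p') (z := p'') (k := x') hp a b
  have e3 : formI p (c'' - p'') x' = ∫ θ, inner ℝ
      (elDensity (dθ₀ c θ) (dθ₀ c' θ) (dθ₀ c'' θ) a b -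
        elDensity (dθ₀ p θ) (dθ₀ p' θ) (dθ₀ c'' θ) a b) (dθ₀ x' θ) ∂circleMeasure := by
    have e4 : formI p (c'' - p'') x' = formI p (c'' - p'') x' +
        (∫ θ, inner ℝ (elDensity (dθ₀ c θ) (dθ₀ c' θ) (dθ₀ c'' θ) a b) (dθ₀ x' θ)
          ∂circleMeasure -
        ∫ θ, inner ℝ (elDensity (dθ₀ p θ) (dθ₀ p' θ) (dθ₀ p'' θ) a b) (dθ₀ x' θ)
          ∂circleMeasure) := by rw [e1, e2]; ring
    rw [e4, ← integral_sub i1 i2, formI, ← integral_add (integrable_formI hp) (i1.sub' i2)]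
    refine integral_congr_ae ?_
    filter_upwards [ae_dθ₀_sub c'' p''] with θ h1
    simp only [h1, elDensity, inner_sub_left, inner_add_left, inner_smul_left,
      RCLike.conj_to_real]
    ring
  have hnorm : ‖formI p (c'' - p'') x'‖ ≤ ∫ θ, 2 * C * R * (‖dθ₀ p θ‖⁻¹ *
      inner ℝ (dθ₀ x' θ) (dθ₀ x' θ) + ‖dθ₀ p θ‖⁻¹ * inner ℝ (dθ₀ x θ) (dθ₀ x θ))
      ∂circleMeasure := by
    rw [e3]
    refine norm_integral_le_of_norm_le
      (((integrable_formI hp).add (integrable_formI hp)).const_mul _) ?_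
    filter_upwards [hLip, hR] with θ h1 h2
    refine (norm_inner_le_norm _ _).trans ?_
    rw [real_inner_self_eq_norm_sq, real_inner_self_eq_norm_sq]
    have h3 := mul_le_mul_of_nonneg_right h1 (norm_nonneg (dθ₀ x' θ))
    refine h3.trans ?_
    have h4 : 1 ≤ R * ‖dθ₀ p θ‖⁻¹ := by
      rw [← div_eq_mul_inv, le_div_iff₀ h2.1, one_mul]; exact h2.2
    have h5 : (‖dθ₀ x θ‖ + ‖dθ₀ x' θ‖) * ‖dθ₀ x' θ‖ ≤
        2 * (‖dθ₀ x' θ‖ ^ 2 + ‖dθ₀ x θ‖ ^ 2) := by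
      nlinarith [sq_nonneg (‖dθ₀ x θ‖ - ‖dθ₀ x' θ‖), sq_nonneg ‖dθ₀ x θ‖, sq_nonneg ‖dθ₀ x' θ‖]
    calc C * (‖dθ₀ x θ‖ + ‖dθ₀ x' θ‖) * ‖dθ₀ x' θ‖
        = C * ((‖dθ₀ x θ‖ + ‖dθ₀ x' θ‖) * ‖dθ₀ x' θ‖) := by ring
      _ ≤ C * (2 * (‖dθ₀ x' θ‖ ^ 2 + ‖dθ₀ x θ‖ ^ 2)) := by gcongr
      _ = C * (1 * (2 * (‖dθ₀ x' θ‖ ^ 2 + ‖dθ₀ x θ‖ ^ 2))) := by ring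
      _ ≤ C * (R * ‖dθ₀ p θ‖⁻¹ * (2 * (‖dθ₀ x' θ‖ ^ 2 + ‖dθ₀ x θ‖ ^ 2))) := by gcongr
      _ = _ := by ring
  rw [integral_const_mul, integral_add (integrable_formI hp) (integrable_formI hp),
    Real.norm_eq_abs] at hnorm
  exact hnorm

/-- A function whose derivative is bounded by a multiple of the function, and which vanishes at the
center of an interval, vanishes on the interval. -/
theorem eq_zero_of_abs_deriv_le_mul_abs {f f' : ℝ → ℝ} {t₀ r K : ℝ}
    (hf : ∀ t ∈ Ioo (t₀ - r) (t₀ + r), HasDerivAt f (f' t) t) (h0 : f t₀ = 0)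
    (hK : ∀ t ∈ Ioo (t₀ - r) (t₀ + r), |f' t| ≤ K * |f t|) :
    ∀ t ∈ Ioo (t₀ - r) (t₀ + r), f t = 0 := by
  have key : ∀ g g' : ℝ → ℝ, (∀ t ∈ Ioo (t₀ - r) (t₀ + r), HasDerivAt g (g' t) t) → g t₀ = 0 →
      (∀ t ∈ Ioo (t₀ - r) (t₀ + r), |g' t| ≤ K * |g t|) →
      ∀ t ∈ Ioo (t₀ - r) (t₀ + r), t₀ ≤ t → g t = 0 := by
    intro g g' hg hg0 hgK t ht htt
    have hsub : Icc t₀ t ⊆ Ioo (t₀ - r) (t₀ + r) := fun s hs =>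
      ⟨by linarith [hs.1, ht.2], hs.2.trans_lt ht.2⟩
    exact eq_zero_of_abs_deriv_le_mul_abs_self_of_eq_zero_right (f' := g') (K := K)
      (fun s hs => (hg s (hsub hs)).continuousAt.continuousWithinAt)
      (fun s hs => (hg s (hsub (Ico_subset_Icc_self hs))).hasDerivWithinAt) hg0
      (fun s hs => hgK s (hsub (Ico_subset_Icc_self hs))) t (right_mem_Icc.2 htt)
  intro t ht
  rcases le_total t₀ t with h | h
  · exact key f f' hf h0 hK t ht h
  · have hrefl : ∀ s ∈ Ioo (t₀ - r) (t₀ + r), 2 * t₀ - s ∈ Ioo (t₀ - r) (t₀ + r) := fun s hs =>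
      ⟨by linarith [hs.2], by linarith [hs.1]⟩
    have := key (fun s => f (2 * t₀ - s)) (fun s => -f' (2 * t₀ - s)) (fun s hs => by
        have h1 : HasDerivAt (fun s => 2 * t₀ - s) (-1 : ℝ) s := by
          simpa using (hasDerivAt_id s).const_sub (2 * t₀)
        exact ((hf _ (hrefl s hs)).comp s h1).congr_deriv (by ring))
      (by simpa [two_mul] using h0)
      (fun s hs => by rw [abs_neg]; exact hK _ (hrefl s hs)) (2 * t₀ - t) (hrefl t ht) (by linarith)
    simpa using this

/-- A geodesic that is tangent to the piecewise linear curves at some time stays piecewise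
linear near that time. -/
theorem eventually_mem_plSubmodule_of_isGeodesic {n : ℕ} (hn : 1 ≤ n) {I : Set ℝ}
    {γ : ℝ → LipCurve₀ d} (hγ : IsGeodesic metricG₀ (Immersions₀ d : Set (LipCurve₀ d)) I γ)
    {t₀ : ℝ} (ht₀ : t₀ ∈ I) (h0 : γ t₀ ∈ plSubmodule n d) (h1 : deriv γ t₀ ∈ plSubmodule n d) :
    ∀ᶠ t in 𝓝 t₀, γ t ∈ plSubmodule n d := by
  obtain ⟨P, hP1, hP2, hP3⟩ := exists_plProjection (d := d) hn
  have hI := hγ.isOpen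
  obtain ⟨hγd, hγ'⟩ := hγ.smooth.hasDerivAt_and_deriv hI
  obtain ⟨hγ'd, hγ''⟩ := hγ'.hasDerivAt_and_deriv hI
  have hγc : ContinuousAt γ t₀ := (hγd t₀ ht₀).continuousAt
  have hγ'c : ContinuousAt (deriv γ) t₀ := (hγ'd t₀ ht₀).continuousAt
  have hγ''c : ContinuousAt (deriv (deriv γ)) t₀ :=
    hγ''.continuousOn.continuousAt (hI.mem_nhds ht₀)
  have hM : ∀ t ∈ I, γ t ∈ Immersions₀ d := hγ.mem
  have hEL : ∀ t ∈ I, ∀ k, eulerLagrange (γ t) (deriv γ t) (deriv (deriv γ) t) k = 0 :=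
    fun t ht k => hγ.eulerLagrange_eq_zero le_rfl (fun _ _ _ h => h) ht
  -- the nonlocal coefficients of the geodesic equation
  set A : ℝ → ℝ := fun t => formI (γ t) (deriv γ t) (deriv γ t) / lenI (γ t) with hA
  set B : ℝ → ℝ := fun t => dlenI (γ t) (deriv γ t) / lenI (γ t) with hB
  have hl0 : ∀ t ∈ I, lenI (γ t) ≠ 0 := fun t ht => (lenI_pos (hM t ht)).ne'
  have hlc := continuousOn_lenI hγ.smooth.continuousOn hM
  have hAc : ContinuousAt A t₀ :=
    ((continuousOn_formI hγ.smooth.continuousOn hγ'.continuousOn hγ'.continuousOn hM).div hlc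
      hl0).continuousAt (hI.mem_nhds ht₀)
  have hBc : ContinuousAt B t₀ :=
    ((continuousOn_dlenI hγ.smooth.continuousOn hγ'.continuousOn hM).div hlc
      hl0).continuousAt (hI.mem_nhds ht₀)
  -- the Euler–Lagrange density is uniformly Lipschitz near the values it takes at the time `t₀`
  obtain ⟨K, hK, hK0, hzK⟩ := exists_compact_dθ₄ (γ t₀, deriv γ t₀, deriv (deriv γ) t₀, 0)
    (hM t₀ ht₀)
  obtain ⟨C, δ, hδ, hC⟩ := (hK.image (f := fun y : EuclideanSpace ℝ (Fin d) ×
      EuclideanSpace ℝ (Fin d) × EuclideanSpace ℝ (Fin d) × EuclideanSpace ℝ (Fin d) =>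
      (y.1, y.2.1, y.2.2.1, A t₀, B t₀)) (by fun_prop)).exists_uniform_of_eventually
    (Q := fun C p q => ‖elDensity p.1 p.2.1 p.2.2.1 p.2.2.2.1 p.2.2.2.2 -
      elDensity q.1 q.2.1 q.2.2.1 q.2.2.2.1 q.2.2.2.2‖ ≤ C * dist p q)
    (fun C C' p q hCC' h => h.trans (mul_le_mul_of_nonneg_right hCC' dist_nonneg)) (by
      rintro _ ⟨y, hy, rfl⟩
      obtain ⟨C, s, hs, hCs⟩ := ((contDiffAt_elDensity
        (p := (y.1, y.2.1, y.2.2.1, A t₀, B t₀)) (hK0 y hy)).of_le (by exact_mod_cast le_top) :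
          ContDiffAt ℝ 1 _ _).exists_lipschitzOnWith
      refine ⟨C, ?_⟩
      filter_upwards [prod_mem_nhds hs hs] with q hq
      rw [← dist_eq_norm]
      exact hCs.dist_le_mul _ hq.1 _ hq.2)
  -- the interpolation of the geodesic
  have hPd : ∀ t ∈ I, HasDerivAt (fun s => P (γ s)) (P (deriv γ t)) t := fun t ht =>
    P.hasFDerivAt.comp_hasDerivAt t (hγd t ht)
  have hPd' : ∀ t ∈ I, HasDerivAt (fun s => P (deriv γ s)) (P (deriv (deriv γ) t)) t :=
    fun t ht => P.hasFDerivAt.comp_hasDerivAt t (hγ'd t ht)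
  obtain ⟨m, hm, hm0⟩ := mem_immersions_iff.1 (hM t₀ ht₀)
  have hPt₀ : P (γ t₀) = γ t₀ := hP2 _ h0
  have hPt₀' : P (deriv γ t₀) = deriv γ t₀ := hP2 _ h1
  set R : ℝ := ‖γ t₀‖ + ‖deriv γ t₀‖ + 1 with hRdef
  have hPc : ContinuousAt (fun t => P (γ t)) t₀ := (hPd t₀ ht₀).continuousAt
  have hPc' : ContinuousAt (fun t => P (deriv γ t)) t₀ := (hPd' t₀ ht₀).continuousAt
  -- conditions that hold for times near `t₀`
  have ev1 : ∀ᶠ t in 𝓝 t₀, P (γ t) ∈ Immersions₀ d :=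
    hPc.eventually ((Immersions₀ d).isOpen.mem_nhds (by simp only [hPt₀]; exact hM t₀ ht₀))
  have ev2 : ∀ᶠ t in 𝓝 t₀, ∀ᵐ θ ∂circleMeasure, dist (dθ₀ (P (γ t)) θ) (dθ₀ (γ t₀) θ) < m / 2 := by
    have := isEssBoundedEval_dθ₀.eventually_ae_dist_lt (P (γ t₀)) (half_pos hm)
    rw [hPt₀] at this
    exact hPc.eventually (by simpa only [hPt₀] using this)
  have ev3 : ∀ᶠ t in 𝓝 t₀, ‖P (γ t)‖ < R :=
    hPc.norm.eventually (gt_mem_nhds (by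
      simp only [hPt₀, hRdef]; linarith [norm_nonneg (deriv γ t₀)]))
  have ev4 : ∀ᶠ t in 𝓝 t₀, ‖P (deriv γ t)‖ < R :=
    hPc'.norm.eventually (gt_mem_nhds (by
      simp only [hPt₀', hRdef]; linarith [norm_nonneg (γ t₀)]))
  have ev5 : ∀ᶠ t in 𝓝 t₀, ∀ᵐ θ ∂circleMeasure,
      dist (dθ₄ (γ t, deriv γ t, deriv (deriv γ) t, 0) θ)
        (dθ₄ (γ t₀, deriv γ t₀, deriv (deriv γ) t₀, 0) θ) < δ :=
    (hγc.prodMk (hγ'c.prodMk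
      (hγ''c.prodMk (continuousAt_const (y := (0 : LipCurve₀ d)))))).eventually
      (isEssBoundedEval_dθ₄.eventually_ae_dist_lt _ hδ)
  have ev6 : ∀ᶠ t in 𝓝 t₀, ∀ᵐ θ ∂circleMeasure,
      dist (dθ₄ (P (γ t), P (deriv γ t), deriv (deriv γ) t, 0) θ)
        (dθ₄ (γ t₀, deriv γ t₀, deriv (deriv γ) t₀, 0) θ) < δ := by
    have h2 := isEssBoundedEval_dθ₄.eventually_ae_dist_lt
      (P (γ t₀), P (deriv γ t₀), deriv (deriv γ) t₀, (0 : LipCurve₀ d)) hδ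
    have h3 := (hPc.prodMk (hPc'.prodMk
      (hγ''c.prodMk (continuousAt_const (y := (0 : LipCurve₀ d)))))).eventually h2
    simpa only [hPt₀, hPt₀'] using h3
  have ev7 : ∀ᶠ t in 𝓝 t₀, dist (A t) (A t₀) < δ := hAc.eventually (Metric.ball_mem_nhds _ hδ)
  have ev8 : ∀ᶠ t in 𝓝 t₀, dist (B t) (B t₀) < δ := hBc.eventually (Metric.ball_mem_nhds _ hδ)
  have ev0 : ∀ᶠ t in 𝓝 t₀, t ∈ I := hI.mem_nhds ht₀
  obtain ⟨r, hr, hev⟩ := Metric.eventually_nhds_iff_ball.1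
    (ev0.and (ev1.and (ev2.and (ev3.and (ev4.and
      (ev5.and (ev6.and (ev7.and ev8))))))))
  rw [Real.ball_eq_Ioo] at hev
  -- the weighted `H¹`-energy of the deviation from the interpolation
  set f : ℝ → ℝ := fun t => formI (P (γ t)) (deriv γ t - P (deriv γ t)) (deriv γ t - P (deriv γ t)) +
    formI (P (γ t)) (γ t - P (γ t)) (γ t - P (γ t)) with hf
  have hfz : ∀ t ∈ Ioo (t₀ - r) (t₀ + r), f t = 0 := by
    -- the bounds `R / (m / 2)`, `2 C R` (twice) and `1` come from the weight, from the acceleration of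
    -- the deviation and from the mixed terms, respectively
    refine eq_zero_of_abs_deriv_le_mul_abs (K := R / (m / 2) + 4 * max C 0 * R + 1)
      (f' := fun t =>
        (dformI (P (γ t)) (P (deriv γ t)) (deriv γ t - P (deriv γ t)) (deriv γ t - P (deriv γ t)) +
          formI (P (γ t)) (deriv (deriv γ) t - P (deriv (deriv γ) t)) (deriv γ t - P (deriv γ t)) +
          formI (P (γ t)) (deriv γ t - P (deriv γ t)) (deriv (deriv γ) t - P (deriv (deriv γ) t))) +
        (dformI (P (γ t)) (P (deriv γ t)) (γ t - P (γ t)) (γ t - P (γ t)) +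
          formI (P (γ t)) (deriv γ t - P (deriv γ t)) (γ t - P (γ t)) +
          formI (P (γ t)) (γ t - P (γ t)) (deriv γ t - P (deriv γ t)))) ?_ ?_ ?_
    · intro t ht
      obtain ⟨htI, htM, -⟩ := hev t ht
      have d1 := (hγd t htI).fun_sub (hPd t htI)
      have d2 := (hγ'd t htI).fun_sub (hPd' t htI)
      exact (hasDerivAt_formI (hPd t htI) d2 d2 htM).add (hasDerivAt_formI (hPd t htI) d1 d1 htM)
    · simp only [hf, hPt₀, hPt₀', sub_self, formI_zero_right, add_zero]
    · intro t ht
      obtain ⟨htI, htM, e2, e3, e4, e5, e6, e7, e8⟩ := hev t ht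
      have hlow : ∀ᵐ θ ∂circleMeasure, m / 2 ≤ ‖dθ₀ (P (γ t)) θ‖ := by
        filter_upwards [e2, ae_restrict_of_ae hm0] with θ h2 h3
        rw [dist_comm, dist_eq_norm] at h2
        linarith [norm_sub_norm_le (dθ₀ (γ t₀) θ) (dθ₀ (P (γ t)) θ)]
      have hup : ∀ᵐ θ ∂circleMeasure, ‖dθ₀ (P (γ t)) θ‖ ≤ R := by
        filter_upwards [ae_norm_dθ₀_le (P (γ t))] with θ h2 using h2.trans e3.le
      have hup' : ∀ᵐ θ ∂circleMeasure, ‖dθ₀ (P (deriv γ t)) θ‖ ≤ R := by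
        filter_upwards [ae_norm_dθ₀_le (P (deriv γ t))] with θ h2 using h2.trans e4.le
      have b1 := abs_dformI_le htM (deriv γ t - P (deriv γ t)) (half_pos hm) hlow hup'
      have b2 := abs_dformI_le htM (γ t - P (γ t)) (half_pos hm) hlow hup'
      have b3 := two_mul_abs_formI_le htM (γ t - P (γ t)) (deriv γ t - P (deriv γ t))
      have b4 := abs_formI_deviation_le hn (hM t htI) htM (hEL t htI) (hP1 _) (hP1 _)
        (hP1 (deriv (deriv γ) t)) (by rw [map_sub, hP3, sub_self]) (le_max_right C 0)
        (by filter_upwards [hlow, hup] with θ h2 h3 using ⟨(half_pos hm).trans_le h2, h3⟩) (by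
          filter_upwards [e5, e6, hzK, ae_dθ₀_sub (γ t) (P (γ t)),
            ae_dθ₀_sub (deriv γ t) (P (deriv γ t))] with θ h2 h3 h4 h5 h6
          have h7 := hC _ (mem_image_of_mem _ h4)
            (dθ₀ (γ t) θ, dθ₀ (deriv γ t) θ, dθ₀ (deriv (deriv γ) t) θ, A t, B t)
            (dθ₀ (P (γ t)) θ, dθ₀ (P (deriv γ t)) θ, dθ₀ (deriv (deriv γ) t) θ, A t, B t) (by
              simp only [dθ₄, Prod.dist_eq, max_lt_iff] at h2 ⊢
              exact ⟨h2.1, h2.2.1, h2.2.2.1, e7, e8⟩) (by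
              simp only [dθ₄, Prod.dist_eq, max_lt_iff] at h3 ⊢
              exact ⟨h3.1, h3.2.1, h3.2.2.1, e7, e8⟩)
          refine h7.trans (mul_le_mul (le_max_left _ _) ?_ dist_nonneg (le_max_right _ _))
          simp only [Prod.dist_eq, dist_self]
          rw [h5, h6, dist_eq_norm, dist_eq_norm]
          have n1 := norm_nonneg (dθ₀ (γ t) θ - dθ₀ (P (γ t)) θ)
          have n2 := norm_nonneg (dθ₀ (deriv γ t) θ - dθ₀ (P (deriv γ t)) θ)
          refine max_le (by linarith) (max_le (by linarith) ?_)
          linarith)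
      rw [formI_comm (P (γ t)) (deriv γ t - P (deriv γ t))
        (deriv (deriv γ) t - P (deriv (deriv γ) t)),
        formI_comm (P (γ t)) (deriv γ t - P (deriv γ t)) (γ t - P (γ t))]
      have hf0 : 0 ≤ f t := add_nonneg (formI_self_nonneg _ _) (formI_self_nonneg _ _)
      rw [abs_of_nonneg hf0]
      simp only [hf]
      rw [abs_le] at b1 b2 b4 ⊢
      have b3' := abs_le.1 (show |formI (P (γ t)) (γ t - P (γ t)) (deriv γ t - P (deriv γ t))| ≤
        (formI (P (γ t)) (γ t - P (γ t)) (γ t - P (γ t)) + formI (P (γ t))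
          (deriv γ t - P (deriv γ t)) (deriv γ t - P (deriv γ t))) / 2 by linarith)
      constructor <;> nlinarith [b1.1, b1.2, b2.1, b2.2, b3'.1, b3'.2, b4.1, b4.2]
  rw [Metric.eventually_nhds_iff_ball]
  refine ⟨r, hr, fun t ht => ?_⟩
  rw [Real.ball_eq_Ioo] at ht
  have htM := (hev t ht).2.1
  have h2 := hfz t ht
  have h3 : formI (P (γ t)) (γ t - P (γ t)) (γ t - P (γ t)) = 0 :=
    le_antisymm (by
      have := formI_self_nonneg (P (γ t)) (deriv γ t - P (deriv γ t))
      simp only [hf] at h2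
      linarith) (formI_self_nonneg _ _)
  rw [sub_eq_zero.1 (eq_zero_of_formI_self_eq_zero htM h3)]
  exact hP1 _

/-! ### The piecewise linear immersions as a totally geodesic submanifold -/

theorem isSplitSubmanifold_plImmersions {n : ℕ} (hn : 1 ≤ n) :
    IsSplitSubmanifold (LipCurve₀ d) (PLImmersions₀ n d) ((n - 1) * d) := by
  intro x _
  have hfin := finiteDimensional_plSubmodule (d := d) hn
  refine ⟨chartAt (LipCurve₀ d) x, IsManifold.chart_mem_maximalAtlas x, mem_chart_source _ x,
    plSubmodule n d, hfin, finrank_plSubmodule hn, ?_, fun y _ => Iff.rfl⟩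
  obtain ⟨P, hP1, hP2, -⟩ := exists_plProjection (d := d) hn
  exact ⟨P.codRestrict _ hP1, fun c => Subtype.ext (hP2 c c.2)⟩

end Tangent

theorem mainTheorem1 (d : ℕ) (hd : 2 ≤ d) (n : ℕ) (hn : 1 ≤ n) :
    IsTotallyGeodesicSubmanifold (Immersions₀ d) metricG₀ (PLImmersions₀ n d) ((n - 1) * d) := by
  have htan : ∀ {x v : LipCurve₀ d}, v ∈ tangentVectors (Subtype.val '' PLImmersions₀ n d) x →
      v ∈ plSubmodule n d := by
    rintro x v ⟨σ, hσ, hmem, -, rfl⟩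
    exact deriv_mem_plSubmodule hn (hσ.differentiableAt (by simp)).hasDerivAt
      (hmem.mono fun s hs => (mem_image_plImmersions.1 hs).2)
  exact
    { isSubmanifold := isSplitSubmanifold_plImmersions hn
      exists_geodesic := fun x hx v hv =>
        exists_isGeodesic_of_mem_plSubmodule hn (mem_image_plImmersions.1 hx).1
          (mem_image_plImmersions.1 hx).2 (htan hv)
      geodesic_stays := fun I γ hγ t₀ ht₀ hx hv => by
        filter_upwards [eventually_mem_plSubmodule_of_isGeodesic hn hγ ht₀
          (mem_image_plImmersions.1 hx).2 (htan hv), hγ.isOpen.mem_nhds ht₀] with t h1 h2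
        exact mem_image_plImmersions.2 ⟨hγ.mem t h2, h1⟩
      geodesic_of_geodesic := fun I γ hγ => isGeodesic_of_isGeodesic_plImmersions hn hγ }
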